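/- Let $n\ge 0$, let $C_2=\{\pm1\}$ and let $\widehat{C_2}=\{\mathbf{trv},\mathbf{sgn}\}$ be its group of complex characters. **Labelled compositions.** For a set $L$, let $\Sigma_n[L]$ be the set of $L$-compositions of $[n]$, i.e. tuples $((S_1,g_1),\dots,(S_k,g_k))$ with $(S_1,\dots,S_k)$ an ordered partition of $[n]$ into nonempty blocks and $g_i\in L$. Let $\Gamma_n[L]$ be the set of $L$-compositions of $n$, i.e. tuples $((a_1,g_1),\dots,(a_k,g_k))$ with positive integers $a_i$ of sum $n$ and $g_i\in L$. Let $\Pi_n[L]$, $\Lambda_n[L]$ be the sets of $L$-partitions of $[n]$ and of $n$, obtained by forgetting the order of the blocks (the map $\mathsf{supp}$). The map $\mathsf{type}$ replaces blocks by their sizes, $\ell$ is the number of blocks, $|\cdot|$ forgets the labels, and $L$ is omitted from the notation when it is trivial. For $p,q\in\Gamma_n[L]$ write $p\le q$ if $q$ is a label-preserving refinement of $p$. In $\Pi_n$, $X\le Y$ means that $Y$ refines $X$. **Hsiao's algebra.** $\Sigma_n[C_2]$ is a semigroup under $st=((S_1\cap T_1,h_1g_1),\dots,(S_1\cap T_l,h_lg_1),\dots,(S_k\cap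 T_l,h_lg_k))$ with empty intersections omitted, and $\mathbb C\Sigma_n[C_2]$ is its semigroup algebra, with canonical basis $H_s$. The symmetric group $\mathfrak S_n$ acts on it by permuting $[n]$. Identify $\Sigma_n$ with the compositions all of whose labels are $1$. The uniform section is $u_X=\frac1{c^X}\sum_{\mathsf{supp}(x)=X}H_x$ for $X\in\Pi_n$, where $c^X=|\{x\in\Sigma_n:\mathsf{supp}(x)=X\}|$. Define recursively $e^\circ_X=u_X-\sum_{Y>X}u_X e^\circ_Y$, and put $Q^\circ_x=H_xe^\circ_{\mathsf{supp}(x)}$ for $x\in\Sigma_n$ and $R_s=H_sQ^\circ_{|s|}$ for $s\in\Sigma_n[C_2]$. For $\phi=((S_1,\phi_1),\dots,(S_k,\phi_k))\in\Sigma_n[\widehat{C_2}]$ let $E_\phi=\frac1{2^{k}}\sum_{|s|=|\phi|}\overline{\phi(s)}\,H_s$ with $\phi(s)=\prod_i\phi_i(g_i)$, and $Q_\phi=E_\phi Q^\circ_{|\phi|}$. For $\Phi\in\Pi_n[\widehat{C_2}]$ let $e_\Phi=u_{|\Phi|}Q_\phi$ for any $\phi$ with $\mathsf{supp}(\phi)=\Phi$.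 Finally, for $p\in\Gamma_n[C_2]$, $\alpha\in\Gamma_n[\widehat{C_2}]$, $\lambda\in\Lambda_n[\widehat{C_2}]$ let $$\mathcal H_p=\sum_{\mathsf{type}(s)=p}H_s,\quad \mathcal R_p=\sum_{\mathsf{type}(s)=p}R_s,\quad \mathcal Q_\alpha=\sum_{\mathsf{type}(\phi)=\alpha}Q_\phi,\quad \mathfrak e_\lambda=\sum_{\mathsf{type}(\Phi)=\lambda}e_\Phi .$$ **The Mantaci–Reutenauer algebra.** Let $\mathfrak B_n=\mathfrak S_n[C_2]$ be the wreath product, with elements $((\sigma_1,g_1),\dots,(\sigma_n,g_n))$ and product $(\sigma,g)(\tau,h)=((\sigma_{\tau_i},g_{\tau_i}h_i))_i$. Let $\mathrm{co}(\sigma,g)$ be the coarsest $((a_1,h_1),\dots,(a_k,h_k))\in\Gamma_n[C_2]$ such that, when $1,\dots,n$ is cut into consecutive intervals of lengths $a_1,\dots,a_k$, on the $i$-th interval $\sigma$ is increasing and all $g_j=h_i$. Let $Y_p=\sum_{\mathrm{co}(\sigma,g)=p}(\sigma,g)$ and $X_p=\sum_{q\le p}Y_q$ for $p\in\Gamma_n[C_2]$,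 and let $\mathsf{MR}_n[C_2]\subseteq\mathbb C\mathfrak B_n$ be the span of the $Y_p$. On $\bigoplus_m\mathbb C\mathfrak B_m$ let $\star$ be the bilinear product $u\star v=\sum_{w}w\,(u\times v)$ for $u\in\mathfrak B_n$, $v\in\mathfrak B_m$, over $w\in\mathfrak S_{n+m}$ with $w_1<\dots<w_n$ and $w_{n+1}<\dots<w_{n+m}$. **Vazirani's elements.** For $m\ge1$ and $c\in C_2$ let $r_{m^c}=\sum_{p\in\Gamma_m}\frac{(-1)^{\ell(p)-1}}{\ell(p)}X_{p^c}$, where $p^c$ is $p$ with all blocks labelled $c$; write $r_m=r_{m^{+1}}$ and $\overline{r_m}=r_{m^{-1}}$. Let $\mathcal I_{m^{\mathbf{trv}}}=\frac12(r_m+\overline{r_m})$ and $\mathcal I_{m^{\mathbf{sgn}}}=\frac12(r_m-\overline{r_m})$. For $p=(p_1,\dots,p_k)\in\Gamma_n[C_2]$, $\alpha=(\alpha_1,\dots,\alpha_k)\in\Gamma_n[\widehat{C_2}]$ and $\lambda\in\Lambda_n[\widehat{C_2}]$ put $$r_p=r_{p_1}\star\cdots\star r_{p_k},\qquad \mathcal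 I_\alpha=\mathcal I_{\alpha_1}\star\cdots\star\mathcal I_{\alpha_k},\qquad \mathfrak g_\lambda=\frac1{\ell(\lambda)!}\sum_{\mathsf{supp}(\alpha)=\lambda}\mathcal I_\alpha .$$ **Theorem.** There is a unique linear map $f:(\mathbb C\Sigma_n[C_2])^{\mathfrak S_n}\to\mathsf{MR}_n[C_2]$ with $f(\mathcal H_p)=X_p$ for all $p\in\Gamma_n[C_2]$ (Hsiao's map). The elements $\mathcal R_p$, $\mathcal Q_\alpha$, $\mathfrak e_\lambda$ are $\mathfrak S_n$-invariant, and $$f(\mathcal R_p)=r_p,\qquad f(\mathcal Q_\alpha)=\mathcal I_\alpha,\qquad f(\mathfrak e_\lambda)=\mathfrak g_\lambda$$ for all $p\in\Gamma_n[C_2]$, $\alpha\in\Gamma_n[\widehat{C_2}]$ and $\lambda\in\Lambda_n[\widehat{C_2}]$. -/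

import Mathlib

noncomputable section

namespace HsiaoMR

open scoped Classical
open Finset

/-! ### Labelled set compositions and set partitions of `[n]` -/

/-- `Σ_n[L]`: the `L`-compositions of `[n]`, i.e. tuples `((S₁,g₁),…,(S_k,g_k))` with
`(S₁,…,S_k)` an ordered partition of `[n] = Fin n` into nonempty blocks and `g_i ∈ L`.
For `L` trivial this is the set `Σ_n` of set compositions. -/
@[ext]
structure SetComp (n : ℕ) (L : Type*) where
  blocks : List (Finset (Fin n) × L)
  nonempty : ∀ b ∈ blocks, b.1.Nonempty
  disjoint : blocks.Pairwise fun a b => Disjoint a.1 b.1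
  cover : ∀ i : Fin n, ∃ b ∈ blocks, i ∈ b.1

namespace SetComp

variable {n : ℕ} {L M : Type*}

theorem nodup_blocks (s : SetComp n L) : s.blocks.Nodup := by
  refine List.Pairwise.imp_of_mem ?_ s.disjoint
  rintro a b ha _ h rfl
  exact (s.nonempty a ha).ne_empty (by simpa using h)

theorem disjoint_of_ne (s : SetComp n L) {b c : Finset (Fin n) × L} (hb : b ∈ s.blocks)
    (hc : c ∈ s.blocks) (h : b ≠ c) : Disjoint b.1 c.1 := by
  have : Std.Symm fun a b : Finset (Fin n) × L => Disjoint a.1 b.1 := ⟨fun _ _ h => h.symm⟩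
  exact s.disjoint.forall hb hc h

instance [Finite L] : Finite (SetComp n L) := by
  have := Fintype.ofFinite L
  exact Finite.of_injective
    (fun s : SetComp n L => (⟨s.blocks, s.nodup_blocks⟩ :
      {l : List (Finset (Fin n) × L) // l.Nodup}))
    (fun s t h => SetComp.ext (congrArg Subtype.val h))

instance [Finite L] : Fintype (SetComp n L) := Fintype.ofFinite _

/-- Relabelling of the blocks. -/
def relabel (f : L → M) (s : SetComp n L) : SetComp n M where
  blocks := s.blocks.map fun b => (b.1, f b.2)
  nonempty := by
    intro b hb
    obtain ⟨c, hc, rfl⟩ := List.mem_map.1 hb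
    exact s.nonempty c hc
  disjoint := List.pairwise_map.2 s.disjoint
  cover := fun i => by
    obtain ⟨b, hb, hi⟩ := s.cover i
    exact ⟨_, List.mem_map_of_mem hb, hi⟩

/-- `|s|`: the underlying set composition. -/
def under (s : SetComp n L) : SetComp n Unit := s.relabel fun _ => ()

/-- A set composition as an idempotent of `Σ_n[G]`: all blocks get the label `1`. -/
def toIdem {G : Type*} [One G] (x : SetComp n Unit) : SetComp n G := x.relabel fun _ => 1

/-- The number `ℓ(s)` of blocks. -/
def length (s : SetComp n L) : ℕ := s.blocks.length

/-- The set partition of `[n]` underlying an `L`-composition of `[n]`,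
i.e. `supp |s| = |supp s|`. -/
def part (s : SetComp n L) : Finpartition (univ : Finset (Fin n)) :=
  Finpartition.ofExistsUnique (s.blocks.map Prod.fst).toFinset
    (fun _ _ => subset_univ _)
    (fun i _ => by
      obtain ⟨b, hb, hi⟩ := s.cover i
      refine ⟨b.1, ⟨List.mem_toFinset.2 (List.mem_map_of_mem hb), hi⟩, ?_⟩
      rintro t ⟨ht, hit⟩
      obtain ⟨c, hc, rfl⟩ := List.mem_map.1 (List.mem_toFinset.1 ht)
      by_contra hne
      have hbc : b ≠ c := fun h => hne (h ▸ rfl)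
      exact Finset.disjoint_left.1 (s.disjoint_of_ne hb hc hbc) hi hit)
    (fun h => by
      obtain ⟨c, hc, h0⟩ := List.mem_map.1 (List.mem_toFinset.1 h)
      exact (s.nonempty c hc).ne_empty h0)

/-- The product of `Σ_n[G]`:
`st = ((S₁ ∩ T₁, h₁g₁), …, (S₁ ∩ T_l, h_l g₁), (S₂ ∩ T₁, h₁g₂), …, (S_k ∩ T_l, h_l g_k))`
with the empty intersections omitted. -/
instance {G : Type*} [Mul G] : Mul (SetComp n G) where
  mul s t :=
    { blocks := (s.blocks.flatMap fun b =>
        t.blocks.map fun c => (b.1 ∩ c.1, c.2 * b.2)).filter fun d => d.1.Nonempty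
      nonempty := by
        intro b hb
        simpa using (List.mem_filter.1 hb).2
      disjoint := by
        refine List.Pairwise.filter _ (List.pairwise_flatMap.2 ⟨fun b _ => ?_, ?_⟩)
        · refine List.pairwise_map.2 (t.disjoint.imp fun h => ?_)
          exact h.mono inter_subset_right inter_subset_right
        · refine s.disjoint.imp fun h => ?_
          intro x hx y hy
          obtain ⟨c, _, rfl⟩ := List.mem_map.1 hx
          obtain ⟨d, _, rfl⟩ := List.mem_map.1 hy
          exact h.mono inter_subset_left inter_subset_left
      cover := by
        intro i
        obtain ⟨b, hb, hib⟩ := s.cover i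
        obtain ⟨c, hc, hic⟩ := t.cover i
        have hi : i ∈ b.1 ∩ c.1 := mem_inter.2 ⟨hib, hic⟩
        refine ⟨(b.1 ∩ c.1, c.2 * b.2), List.mem_filter.2
          ⟨List.mem_flatMap.2 ⟨b, hb, List.mem_map.2 ⟨c, hc, rfl⟩⟩, ?_⟩, hi⟩
        simpa using ⟨i, hi⟩ }

/-- The action of `𝔖_n` on `Σ_n[L]`: it moves the blocks and keeps the labels. -/
def permute (w : Equiv.Perm (Fin n)) (s : SetComp n L) : SetComp n L where
  blocks := s.blocks.map fun b => (b.1.map w.toEmbedding, b.2)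
  nonempty := by
    intro b hb
    obtain ⟨c, hc, rfl⟩ := List.mem_map.1 hb
    exact (s.nonempty c hc).map
  disjoint := List.pairwise_map.2 (s.disjoint.imp fun h => (Finset.disjoint_map _).2 h)
  cover := fun i => by
    obtain ⟨b, hb, hi⟩ := s.cover (w.symm i)
    exact ⟨_, List.mem_map_of_mem hb, mem_map.2 ⟨w.symm i, hi, by simp⟩⟩

/-- Two `L`-compositions of `[n]` have the same support if they differ only in the order of
their blocks. -/
instance setoid (n : ℕ) (L : Type*) : Setoid (SetComp n L) where
  r s t := s.blocks.Perm t.blocks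
  iseqv := ⟨fun _ => List.Perm.refl _, List.Perm.symm, List.Perm.trans⟩

end SetComp

/-- `Π_n[L]`: the `L`-partitions `{(S₁,g₁),…,(S_k,g_k)}` of `[n]`. -/
abbrev SetPart (n : ℕ) (L : Type*) := Quotient (SetComp.setoid n L)

/-- `|Φ|`: the set partition underlying an `L`-partition of `[n]`. -/
def SetPart.under {n : ℕ} {L : Type*} (Φ : SetPart n L) :
    Finpartition (univ : Finset (Fin n)) :=
  Quotient.lift SetComp.part (fun s t h => by
    have h' : s.blocks.Perm t.blocks := h
    have h2 := List.toFinset_eq_of_perm _ _ (h'.map Prod.fst)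
    exact Finpartition.ext h2) Φ

/-! ### Labelled compositions and partitions of the integer `n` -/

/-- `Γ_n[L]`: the `L`-compositions of `n`, i.e. tuples `((a₁,g₁),…,(a_k,g_k))` with positive
integers `a_i` of sum `n` and `g_i ∈ L`. For `L` trivial this is the set `Γ_n` of compositions
of `n`. -/
@[ext]
structure IntComp (n : ℕ) (L : Type*) where
  blocks : List (ℕ × L)
  pos : ∀ b ∈ blocks, 0 < b.1
  sum_eq : (blocks.map Prod.fst).sum = n

namespace IntComp

variable {n : ℕ} {L M : Type*}

theorem length_le (p : IntComp n L) : p.blocks.length ≤ n := by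
  have h : ∀ l : List (ℕ × L), (∀ b ∈ l, 0 < b.1) → l.length ≤ (l.map Prod.fst).sum := by
    intro l
    induction l with
    | nil => simp
    | cons a l ih =>
      intro hl
      have h1 := hl a (by simp)
      have h2 := ih fun b hb => hl b (by simp [hb])
      simp only [List.length_cons, List.map_cons, List.sum_cons]
      omega
  exact (h _ p.pos).trans_eq p.sum_eq

theorem fst_le (p : IntComp n L) {b : ℕ × L} (hb : b ∈ p.blocks) : b.1 ≤ n :=
  (List.le_sum_of_mem (List.mem_map_of_mem hb)).trans_eq p.sum_eq

instance [Finite L] : Finite (IntComp n L) := by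
  have : Finite {l : List (Fin (n + 1) × L) // l.length ≤ n} :=
    (List.finite_length_le (Fin (n + 1) × L) n).to_subtype
  refine Finite.of_injective (fun p : IntComp n L =>
    (⟨p.blocks.map fun b => (Fin.ofNat (n + 1) b.1, b.2), by
      simpa using p.length_le⟩ : {l : List (Fin (n + 1) × L) // l.length ≤ n})) ?_
  intro p q h
  have h' := congrArg (List.map fun c : Fin (n + 1) × L => ((c.1 : ℕ), c.2))
    (congrArg Subtype.val h)
  have key : ∀ r : IntComp n L, (r.blocks.map fun b => (Fin.ofNat (n + 1) b.1, b.2)).map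
      (fun c : Fin (n + 1) × L => ((c.1 : ℕ), c.2)) = r.blocks := by
    intro r
    rw [List.map_map]
    conv_rhs => rw [← List.map_id r.blocks]
    refine List.map_congr_left fun b hb => ?_
    have := r.fst_le hb
    ext
    · simp [Fin.ofNat, Nat.mod_eq_of_lt (Nat.lt_succ_of_le this)]
    · rfl
  exact IntComp.ext (by simpa only [key] using h')

instance [Finite L] : Fintype (IntComp n L) := Fintype.ofFinite _

/-- The number `ℓ(p)` of blocks. -/
def length (p : IntComp n L) : ℕ := p.blocks.length

/-- Relabelling of the blocks. -/
def relabel (f : L → M) (p : IntComp n L) : IntComp n M where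
  blocks := p.blocks.map fun b => (b.1, f b.2)
  pos := by
    intro b hb
    obtain ⟨c, hc, rfl⟩ := List.mem_map.1 hb
    exact p.pos c hc
  sum_eq := by simpa [List.map_map, Function.comp_def] using p.sum_eq

/-- `p ≤ q` iff `q` is a label-preserving refinement of `p`: each block `(a,g)` of `p` is
replaced by a sequence of blocks of total size `a`, all labelled `g`. -/
instance : LE (IntComp n L) where
  le p q := ∃ R : List (List (ℕ × L)), R.flatten = q.blocks ∧
    List.Forall₂ (fun (b : ℕ × L) (r : List (ℕ × L)) =>
      (r.map Prod.fst).sum = b.1 ∧ ∀ c ∈ r, c.2 = b.2) p.blocks R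

/-- Two `L`-compositions of `n` have the same support if they differ only in the order of
their blocks. -/
instance setoid (n : ℕ) (L : Type*) : Setoid (IntComp n L) where
  r p q := p.blocks.Perm q.blocks
  iseqv := ⟨fun _ => List.Perm.refl _, List.Perm.symm, List.Perm.trans⟩

end IntComp

/-- `Λ_n[L]`: the `L`-partitions of `n`, i.e. multisets `{(a₁,g₁),…,(a_k,g_k)}`. -/
abbrev IntPart (n : ℕ) (L : Type*) := Quotient (IntComp.setoid n L)

/-- The number `ℓ(λ)` of blocks. -/
def IntPart.length {n : ℕ} {L : Type*} (l : IntPart n L) : ℕ :=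
  Quotient.lift IntComp.length (fun _ _ h => List.Perm.length_eq h) l

section type

variable {n : ℕ} {L : Type*}

theorem SetComp.sum_card (s : SetComp n L) :
    ((s.blocks.map fun b => (b.1.card, b.2)).map Prod.fst).sum = n := by
  have h1 := Finset.card_biUnion (s := s.blocks.toFinset) (t := Prod.fst) (by
    intro a ha b hb hab
    exact s.disjoint_of_ne (List.mem_toFinset.1 ha) (List.mem_toFinset.1 hb) hab)
  have h2 : s.blocks.toFinset.biUnion Prod.fst = univ := by
    refine eq_univ_iff_forall.2 fun i => ?_
    obtain ⟨b, hb, hi⟩ := s.cover i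
    exact mem_biUnion.2 ⟨b, List.mem_toFinset.2 hb, hi⟩
  rw [h2, card_univ, Fintype.card_fin, List.sum_toFinset _ s.nodup_blocks] at h1
  rw [List.map_map]
  exact h1.symm

/-- `type : Σ_n[L] → Γ_n[L]`, which replaces each block by its size. Its fibres are the
`𝔖_n`-orbits. -/
def SetComp.type (s : SetComp n L) : IntComp n L where
  blocks := s.blocks.map fun b => (b.1.card, b.2)
  pos := by
    intro b hb
    obtain ⟨c, hc, rfl⟩ := List.mem_map.1 hb
    exact (s.nonempty c hc).card_pos
  sum_eq := s.sum_card

/-- `type : Π_n[L] → Λ_n[L]`. -/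
def SetPart.type (Φ : SetPart n L) : IntPart n L :=
  Quotient.map SetComp.type (fun _ _ h => List.Perm.map _ h) Φ

end type

/-! ### Hsiao's algebra `ℂΣ_n[G]` and its bases for the uniform section -/

/-- The semigroup algebra `ℂΣ_n[G]`. -/
abbrev HAlg (n : ℕ) (G : Type*) := MonoidAlgebra ℂ (SetComp n G)

section bases

variable {n : ℕ} {G : Type*}

/-- The canonical basis element `H_s`. -/
def H (s : SetComp n G) : HAlg n G := MonoidAlgebra.single s 1

/-- The invariants `(ℂΣ_n[G])^{𝔖_n}`. -/
def invariants (n : ℕ) (G : Type*) : Submodule ℂ (HAlg n G) :=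
  ⨅ w : Equiv.Perm (Fin n),
    LinearMap.eqLocus (MonoidAlgebra.mapDomainLinearMap ℂ ℂ (SetComp.permute w)) LinearMap.id

/-- `𝓗_p`, the sum of the `H_s` over all `s` of type `p`. -/
def symH [Finite G] (p : IntComp n G) : HAlg n G :=
  ∑ s : SetComp n G with s.type = p, H s

theorem symH_mem [Finite G] (p : IntComp n G) : symH p ∈ invariants n G := by
  have ht : ∀ (w : Equiv.Perm (Fin n)) (s : SetComp n G), (s.permute w).type = s.type := by
    intro w s
    ext1
    simp [SetComp.type, SetComp.permute, Function.comp_def]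
  have hc : ∀ (v w : Equiv.Perm (Fin n)) (s : SetComp n G), (∀ i, v (w i) = i) →
      (s.permute w).permute v = s := by
    intro v w s hvw
    ext1
    simp only [SetComp.permute, List.map_map]
    conv_rhs => rw [← List.map_id s.blocks]
    refine List.map_congr_left fun b _ => Prod.ext ?_ rfl
    ext i
    simp only [Function.comp_apply, mem_map, Equiv.toEmbedding_apply, id]
    constructor
    · rintro ⟨_, ⟨j, hj, rfl⟩, rfl⟩
      rwa [hvw]
    · exact fun hi => ⟨_, ⟨i, hi, rfl⟩, hvw i⟩
  rw [invariants, Submodule.mem_iInf]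
  intro w
  simp only [LinearMap.mem_eqLocus, LinearMap.id_apply, symH, map_sum, H,
    MonoidAlgebra.mapDomainLinearMap_single]
  refine Finset.sum_bij' (fun s _ => s.permute w) (fun s _ => s.permute w⁻¹) ?_ ?_ ?_ ?_ ?_
  · intro s hs
    simpa [ht] using hs
  · intro s hs
    simpa [ht] using hs
  · exact fun s _ => hc _ _ s (by simp)
  · exact fun s _ => hc _ _ s (by simp)
  · exact fun _ _ => rfl

variable [Group G]

/-- The uniform section: `u_X` is the average of the `H_x`, over the set compositions `x` with
support `X`. It lies in `ℂΣ_n ⊆ ℂΣ_n[G]`, where `Σ_n` is identified with the idempotents of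
`Σ_n[G]`. -/
def uSec (G : Type*) [Group G] (X : Finpartition (univ : Finset (Fin n))) : HAlg n G :=
  ((#{x : SetComp n Unit | x.part = X} : ℕ) : ℂ)⁻¹ •
    ∑ x : SetComp n Unit with x.part = X, H x.toIdem

/-- The idempotents `e°_X` of `ℂΣ_n ⊆ ℂΣ_n[G]`, by the recursion
`e°_X = u_X - ∑_{Y > X} u_X e°_Y`. Here `Y > X` means that `Y` strictly refines `X`, which is
`Y < X` in the order of `Finpartition`. -/
def eCirc (G : Type*) [Group G] (X : Finpartition (univ : Finset (Fin n))) : HAlg n G :=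
  uSec G X - ∑ Y : {Y : Finpartition (univ : Finset (Fin n)) // Y < X}, uSec G X * eCirc G Y.1
termination_by wellFounded_lt.wrap X
decreasing_by exact Y.2

/-- `Q°_x = H_x e°_{supp x}` for a set composition `x`. -/
def QCirc (G : Type*) [Group G] (x : SetComp n Unit) : HAlg n G :=
  H x.toIdem * eCirc G x.part

/-- `R_s = H_s Q°_{|s|}`. -/
def R (s : SetComp n G) : HAlg n G := H s * QCirc G s.under

/-- `𝓡_p`, the sum of the `R_s` over all `s` of type `p`. -/
def symR [Finite G] (p : IntComp n G) : HAlg n G :=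
  ∑ s : SetComp n G with s.type = p, R s

end bases

section characters

variable {n : ℕ} {G : Type*} [CommGroup G] [Finite G]

/-- The dual group of complex characters. -/
abbrev Dual (G : Type*) [CommGroup G] := G →* ℂˣ

/-- The evaluation `φ(s) = φ₁(g₁)⋯φ_k(g_k)` of a `Ĝ`-composition of `[n]` on a `G`-composition
of `[n]` with the same underlying set composition; it is `0` on all other `G`-compositions. -/
def evalChar (φ : SetComp n (Dual G)) (s : SetComp n G) : ℂ :=
  if s.under = φ.under then
    (List.zipWith (fun b c => ((b.2 c.2 : ℂˣ) : ℂ)) φ.blocks s.blocks).prod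
  else 0

/-- `E_φ`, the isotypic projector of the character `φ` of the maximal subgroup
`{s : |s| = |φ|}`. -/
def E (φ : SetComp n (Dual G)) : HAlg n G :=
  ((#{s : SetComp n G | s.under = φ.under} : ℕ) : ℂ)⁻¹ •
    ∑ s : SetComp n G with s.under = φ.under, (starRingEnd ℂ (evalChar φ s)) • H s

/-- `Q_φ = E_φ Q°_{|φ|}`. -/
def Q (φ : SetComp n (Dual G)) : HAlg n G := E φ * QCirc G φ.under

/-- `𝓠_α`, the sum of the `Q_φ` over all `φ` of type `α`. -/
def symQ (α : IntComp n (Dual G)) : HAlg n G :=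
  ∑ φ : SetComp n (Dual G) with φ.type = α, Q φ

/-- `e_Φ = u_{|Φ|} Q_φ`, where `φ` is any `Ĝ`-composition with support `Φ`
(the product does not depend on its choice). -/
def ePart (Φ : SetPart n (Dual G)) : HAlg n G := uSec G Φ.under * Q Φ.out

/-- `e_λ`, the sum of the `e_Φ` over all `Φ` of type `λ`. -/
def eType (l : IntPart n (Dual G)) : HAlg n G :=
  ∑ Φ : SetPart n (Dual G) with Φ.type = l, ePart Φ

end characters

/-! ### The wreath product and the Mantaci--Reutenauer algebra -/

/-- The wreath product `𝔖_n[G]`, with elements `((σ₁,g₁),…,(σ_n,g_n))`. -/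
@[ext]
structure Wreath (n : ℕ) (G : Type*) where
  perm : Equiv.Perm (Fin n)
  col : Fin n → G

namespace Wreath

variable {n m : ℕ} {G : Type*} [Group G]

/-- `(σ,g)(τ,h) = ((σ_{τ₁}, g_{τ₁}h₁), …, (σ_{τ_n}, g_{τ_n}h_n))`. -/
instance : Group (Wreath n G) where
  mul a b := ⟨a.perm * b.perm, fun i => a.col (b.perm i) * b.col i⟩
  one := ⟨1, fun _ => 1⟩
  inv a := ⟨a.perm⁻¹, fun i => (a.col (a.perm⁻¹ i))⁻¹⟩
  mul_assoc _ _ _ := Wreath.ext (mul_assoc _ _ _) (funext fun _ => mul_assoc _ _ _)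
  one_mul _ := Wreath.ext (one_mul _) (funext fun _ => one_mul _)
  mul_one _ := Wreath.ext (mul_one _) (funext fun _ => mul_one _)
  inv_mul_cancel a := Wreath.ext (inv_mul_cancel _) (funext fun i => by
    change (a.col (a.perm⁻¹ (a.perm i)))⁻¹ * a.col i = 1
    simp)

instance [Finite G] : Finite (Wreath n G) :=
  Finite.of_injective (fun a : Wreath n G => (a.perm, a.col))
    (fun _ _ h => Wreath.ext (congrArg Prod.fst h) (congrArg Prod.snd h))

instance [Finite G] : Fintype (Wreath n G) := Fintype.ofFinite _

/-- The word `(σ₁,g₁),…,(σ_n,g_n)`. -/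
def word (a : Wreath n G) : List (Fin n × G) := List.ofFn fun i => (a.perm i, a.col i)

/-- The word of `a` is cut by `p = ((a₁,h₁),…,(a_k,h_k))` into consecutive pieces of lengths
`a₁,…,a_k` such that in the `i`-th piece the letters are increasing and all colours
are `h_i`. -/
def Compatible (a : Wreath n G) (p : IntComp n G) : Prop :=
  ∃ W : List (List (Fin n × G)), W.flatten = a.word ∧
    List.Forall₂ (fun (b : ℕ × G) (r : List (Fin n × G)) =>
      r.length = b.1 ∧ (r.Pairwise fun x y => x.1 < y.1) ∧ ∀ x ∈ r, x.2 = b.2) p.blocks W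

/-- `co(a) = p`: the coarsest `G`-composition of `n` compatible with `a` is `p`. -/
def IsCo (a : Wreath n G) (p : IntComp n G) : Prop :=
  a.Compatible p ∧ ∀ q, a.Compatible q → p ≤ q

/-- The inclusion `𝔖_n[G] × 𝔖_m[G] → 𝔖_{n+m}[G]`. -/
def prod (a : Wreath n G) (b : Wreath m G) : Wreath (n + m) G where
  perm := finSumFinEquiv.permCongr (Equiv.Perm.sumCongr a.perm b.perm)
  col := Fin.append a.col b.col

end Wreath

/-- The group algebra `ℂ𝔖_n[G]`. -/
abbrev WAlg (G : Type*) (n : ℕ) := MonoidAlgebra ℂ (Wreath n G)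

section MR

variable {n : ℕ} {G : Type*} [Group G] [Finite G]

/-- `Y_p`, the sum of all `a` with `co(a) = p`. -/
def Y (p : IntComp n G) : WAlg G n :=
  ∑ a : Wreath n G with a.IsCo p, MonoidAlgebra.single a 1

/-- `X_p = ∑_{q ≤ p} Y_q`. -/
def X (p : IntComp n G) : WAlg G n := ∑ q : IntComp n G with q ≤ p, Y q

/-- The Mantaci--Reutenauer algebra `MR_n[G]`, as a subspace of `ℂ𝔖_n[G]`. -/
def MR (n : ℕ) (G : Type*) [Group G] [Finite G] : Submodule ℂ (WAlg G n) :=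
  Submodule.span ℂ (Set.range (Y (n := n) (G := G)))

/-- `f` is the linear map `(ℂΣ_n[G])^{𝔖_n} → MR_n[G]` that sends `𝓗_p` to `X_p` for
all `p ∈ Γ_n[G]`. -/
def IsHsiaoMap (f : invariants n G →ₗ[ℂ] MR n G) : Prop :=
  ∀ p : IntComp n G, (f ⟨symH p, symH_mem p⟩ : WAlg G n) = X p

end MR

/-! ### The external product and Vazirani's elements -/

section star

/-- `ℂ𝔖[G] = ⨁_n ℂ𝔖_n[G]`; for `G = C₂` this is `ℂ𝔅 = ⨁_n ℂ𝔅_n`. -/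
abbrev WTot (G : Type*) [Group G] := DirectSum ℕ (WAlg G)

variable {G : Type*} [Group G]

/-- `Sh(n,m)`: permutations of `[n+m]` increasing on the first `n` and on the last `m`
positions. -/
def shuffles (n m : ℕ) : Finset (Equiv.Perm (Fin (n + m))) :=
  {w | StrictMono (fun i : Fin n => w (Fin.castAdd m i)) ∧
    StrictMono (fun j : Fin m => w (Fin.natAdd n j))}

/-- `u ⋆ v = ∑_{w ∈ Sh(n,m)} w (u × v)` for group elements `u` and `v`. -/
def starElt {n m : ℕ} (u : Wreath n G) (v : Wreath m G) : WAlg G (n + m) :=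
  ∑ w ∈ shuffles n m,
    MonoidAlgebra.single ((⟨w, fun _ => 1⟩ : Wreath (n + m) G) * u.prod v) 1

/-- The bilinear extension of `⋆` to `ℂ𝔖_n[G] × ℂ𝔖_m[G] → ℂ𝔖_{n+m}[G]`. -/
def starHom {n m : ℕ} (a : WAlg G n) (b : WAlg G m) : WAlg G (n + m) :=
  a.coeff.sum fun u x => b.coeff.sum fun v y => (x * y) • starElt u v

/-- The product `⋆` on `ℂ𝔖[G]`. -/
def extStar (a b : WTot G) : WTot G :=
  ∑ n ∈ DFinsupp.support a, ∑ m ∈ DFinsupp.support b,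
    DirectSum.of (WAlg G) (n + m) (starHom (a n) (b m))

/-- The unit of `⋆`: the empty word. -/
def starOne : WTot G := DirectSum.of (WAlg G) 0 1

/-- The iterated product `a₁ ⋆ a₂ ⋆ ⋯ ⋆ a_k`. -/
def starProd (l : List (WTot G)) : WTot G := l.foldr extStar starOne

end star

/-- `r_n` for `c = 1` and `r̄_n` for `c = -1`: the sum
`∑_{p ∈ Γ_n} (-1)^{ℓ(p)-1}/ℓ(p) X_{p^c}`, where `p^c` is `p` with all blocks labelled `c`. -/
def reutenauer (n : ℕ) (c : ℤˣ) : WAlg ℤˣ n :=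
  ∑ p : IntComp n Unit, ((-1 : ℂ) ^ (p.length - 1) / (p.length : ℂ)) • X (p.relabel fun _ => c)

/-- `r_p = r_{p₁} ⋆ ⋯ ⋆ r_{p_k}` for `p ∈ Γ_n[C₂]`. -/
def rProd {n : ℕ} (p : IntComp n ℤˣ) : WTot ℤˣ :=
  starProd (p.blocks.map fun b => DirectSum.of (WAlg ℤˣ) b.1 (reutenauer b.1 b.2))

/-- `I_(n) = (r_n + r̄_n)/2` for the trivial character and `I_(n̄) = (r_n - r̄_n)/2` for the
sign character. -/
def vazI (n : ℕ) (χ : Dual ℤˣ) : WAlg ℤˣ n :=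
  if χ = 1 then (1 / 2 : ℂ) • (reutenauer n 1 + reutenauer n (-1))
  else (1 / 2 : ℂ) • (reutenauer n 1 - reutenauer n (-1))

/-- `I_α = I_{α₁} ⋆ ⋯ ⋆ I_{α_k}` for `α ∈ Γ_n[Ĉ₂]`. -/
def vazIProd {n : ℕ} (α : IntComp n (Dual ℤˣ)) : WTot ℤˣ :=
  starProd (α.blocks.map fun b => DirectSum.of (WAlg ℤˣ) b.1 (vazI b.1 b.2))

/-- Vazirani's idempotents `g_λ = (1/ℓ(λ)!) ∑_{supp α = λ} I_α` for `λ ∈ Λ_n[Ĉ₂]`. -/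
def vazirani {n : ℕ} (l : IntPart n (Dual ℤˣ)) : WTot ℤˣ :=
  ((l.length.factorial : ℕ) : ℂ)⁻¹ •
    ∑ α : IntComp n (Dual ℤˣ) with (⟦α⟧ : IntPart n (Dual ℤˣ)) = l, vazIProd α

end HsiaoMR

end

/-! Both sides of the theorem are governed by one combinatorial matrix: the coefficients of `log (1
+ X)` spread over label-preserving refinements. A refinement of `p` that cuts its blocks into `i₁,
i₂, …` pieces has weight `∏ (-1)^(i_j - 1) / i_j`, and `refCoeff logCoeff` records this weight for
set compositions and for integer compositions alike.

On the semigroup side, `QCirc_eq_logSum` says that `Q°_x` is the weighted sum of the refinements of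
`x`. The matrices of `log` and `exp` are mutually inverse because `exp (log (1 + X)) = 1 + X`. The
recursion for `e°` amounts to inverting the `exp` matrix: `e°_Y` is the average of the `Q°_y` with
support `Y`, `H_x Q°_y = Q°_{xy}` when the support of `y` refines that of `x`, and the number of
such `y` with `xy = z` is a multinomial coefficient. Divided by `ℓ(z)!`, it leaves the product of
inverse factorials that is the `exp` weight. Multiplying by `H_s` inserts the labels, and summing
over a type gives `symR_eq_sum`.

On the Mantaci–Reutenauer side, `X_p` is the sum of all group elements compatible with `p`, and
unique factorisation through shuffles gives `X_p ⋆ X_q = X_{pq}` (`starHom_X`). Expanding `r_{p₁} ⋆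
⋯ ⋆ r_{p_k}` therefore produces the same coefficients in the `X_q` (`rProd_eq_sum`), and Hsiao's map
matches the two expansions.

The other two families follow by linearity. `Q_φ` and `I_α` are the same character sums over `R_s`
and `r_p`. Since `H_x Q_φ` is `Q` of a reordering of `φ`, the element `e_Φ` is an average over all
orders of the blocks, which is the shape of Vazirani's definition. Hsiao's map exists and is unique
because the fibres of `type` are the orbits of the symmetric group, so the `𝓗_p` form a basis of the
invariants. -/

noncomputable section

namespace HsiaoMR

open scoped Classical
open Finset

/-! ### Groupings of a list -/

section groupings

variable {A B V : Type*}

/-- Prepend a letter to the first piece of a list of pieces. -/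
def headCons (a : B) : List (List B) → List (List B)
  | [] => [[a]]
  | r :: R => (a :: r) :: R

/-- The ways to cut a list into consecutive nonempty pieces. -/
def groupings : List B → Finset (List (List B))
  | [] => {[]}
  | a :: l => (groupings l).image (fun R => [a] :: R) ∪ (groupings l).image (headCons a)

theorem mem_groupings {l : List B} {R : List (List B)} :
    R ∈ groupings l ↔ R.flatten = l ∧ [] ∉ R := by
  induction l generalizing R with
  | nil =>
    simp only [groupings, Finset.mem_singleton]
    constructor
    · rintro rfl
      simp
    · rintro ⟨h, h'⟩
      cases R with
      | nil => rfl
      | cons r R =>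
        simp only [List.flatten_cons, List.append_eq_nil_iff] at h
        simp [h.1] at h'
  | cons a l ih =>
    simp only [groupings, mem_union, Finset.mem_image, ih]
    constructor
    · rintro (⟨R', ⟨h1, h2⟩, rfl⟩ | ⟨R', ⟨h1, h2⟩, rfl⟩)
      · simp [h1, h2]
      · cases R' with
        | nil => simpa [headCons] using h1
        | cons r R' => simp_all [headCons]
    · rintro ⟨h, h'⟩
      rcases R with _ | ⟨r, R⟩
      · simp at h
      rcases r with _ | ⟨b, r⟩
      · simp at h'
      simp only [List.flatten_cons, List.cons_append, List.cons.injEq] at h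
      obtain ⟨rfl, h⟩ := h
      rcases r with _ | ⟨c, r⟩
      · left
        refine ⟨R, ⟨by simpa using h, ?_⟩, rfl⟩
        simpa using h'
      · right
        refine ⟨(c :: r) :: R, ⟨by simpa using h, ?_⟩, rfl⟩
        simpa using h'

/-- The recursion defining `groupings` peels off one letter; the inductions on series need a whole
first piece, here of length `i + 1`, to be peeled off. -/
theorem sum_groupings_cons [AddCommMonoid V] {l : List B} (hl : l ≠ [])
    (φ : List (List B) → V) :
    ∑ R ∈ groupings l, φ R = ∑ i ∈ range l.length,
      ∑ R ∈ groupings (l.drop (i + 1)), φ (l.take (i + 1) :: R) := by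
  rw [Finset.sum_sigma']
  symm
  refine Finset.sum_bij (fun x _ => l.take (x.1 + 1) :: x.2) ?_ ?_ ?_ ?_
  · rintro ⟨i, R⟩ h
    simp only [mem_sigma, Finset.mem_range, mem_groupings] at h ⊢
    refine ⟨by simp [h.2.1], ?_⟩
    simp only [List.mem_cons, not_or]
    refine ⟨?_, h.2.2⟩
    intro h0
    have := congrArg List.length h0
    simp only [List.length_take, List.length_nil] at this
    omega
  · rintro ⟨i, R⟩ h ⟨j, R'⟩ h' he
    simp only [mem_sigma, Finset.mem_range, List.cons.injEq] at h h' he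
    have := congrArg List.length he.1
    simp only [List.length_take] at this
    have hij : i = j := by omega
    subst hij
    rw [he.2]
  · intro R h
    rw [mem_groupings] at h
    obtain ⟨h1, h2⟩ := h
    rcases R with _ | ⟨r, R⟩
    · exact absurd h1.symm (by simpa using hl)
    rcases r with _ | ⟨a, r⟩
    · simp at h2
    refine ⟨⟨r.length, R⟩, ?_, ?_⟩
    · simp only [mem_sigma, Finset.mem_range, mem_groupings, ← h1]
      refine ⟨by simp, by simp, ?_⟩
      simpa using h2
    · simp [← h1]
  · intros
    rfl

/-- The product of `f (length r)` over the pieces `r`. -/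
def wt (f : ℕ → ℂ) (R : List (List B)) : ℂ := (R.map fun r => f r.length).prod

@[simp] theorem wt_nil (f : ℕ → ℂ) : wt f ([] : List (List B)) = 1 := rfl

@[simp] theorem wt_cons (f : ℕ → ℂ) (r : List B) (R : List (List B)) :
    wt f (r :: R) = f r.length * wt f R := by simp [wt]

theorem wt_append (f : ℕ → ℂ) (R S : List (List B)) : wt f (R ++ S) = wt f R * wt f S := by
  simp [wt]

theorem wt_map (f : ℕ → ℂ) (g : A → B) (R : List (List A)) :
    wt f (R.map (List.map g)) = wt f R := by
  simp [wt, Function.comp_def]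

/-- The coefficients of `log (1 + X)`. -/
def logCoeff (i : ℕ) : ℂ := (-1) ^ (i - 1) / i

/-- The coefficients of `exp X`. -/
def expCoeff (i : ℕ) : ℂ := ((i.factorial : ℕ) : ℂ)⁻¹

/-- The series `log (1 + X)`. -/
def logSeries : PowerSeries ℂ := PowerSeries.mk logCoeff

/-- Removing the first piece of a cut is one Cauchy multiplication by `logSeries`, so cuts into `k`
pieces compute the `k`-th power. -/
theorem sum_groupings_length_eq (k : ℕ) (l : List B) :
    ∑ R ∈ groupings l with R.length = k, wt logCoeff R =
      PowerSeries.coeff l.length (logSeries ^ k) := by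
  induction k generalizing l with
  | zero =>
    rw [Finset.sum_filter]
    rcases l with _ | ⟨a, l⟩
    · simp [groupings]
    · rw [sum_groupings_cons (by simp)]
      simp [PowerSeries.coeff_one]
  | succ k ih =>
    rcases eq_or_ne l [] with rfl | hl
    · simp [groupings, Finset.sum_filter, logSeries, logCoeff]
    · rw [pow_succ', PowerSeries.coeff_mul,
        Finset.Nat.sum_antidiagonal_eq_sum_range_succ (fun i j =>
          PowerSeries.coeff i logSeries * PowerSeries.coeff j (logSeries ^ k)),
        Finset.sum_range_succ', Finset.sum_filter, sum_groupings_cons hl]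
      -- `logCoeff 0` is a division by zero, hence `0`. This is the constant term wanted, since
      -- pieces are nonempty.
      have h0 : PowerSeries.coeff 0 logSeries = 0 := by simp [logSeries, logCoeff]
      rw [h0, zero_mul, add_zero]
      refine Finset.sum_congr rfl fun i hi => ?_
      have hi' := Finset.mem_range.1 hi
      have h1 := ih (l.drop (i + 1))
      rw [List.length_drop] at h1
      rw [← h1, Finset.sum_filter, Finset.mul_sum]
      refine Finset.sum_congr rfl fun R _ => ?_
      have h2 : min (i + 1) l.length = i + 1 := by omega
      simp [logSeries, h2]

theorem length_le_of_mem_groupings {l : List B} {R : List (List B)} (h : R ∈ groupings l) :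
    R.length ≤ l.length := by
  rw [mem_groupings] at h
  obtain ⟨rfl, h⟩ := h
  induction R with
  | nil => simp
  | cons r R ih =>
    simp only [List.mem_cons, not_or] at h
    have := ih h.2
    have h3 : r.length ≠ 0 := fun h0 => h.1 (List.length_eq_zero_iff.1 h0).symm
    simp only [List.length_cons, List.flatten_cons, List.length_append]
    omega

theorem one_add_X_mul_derivative_logSeries :
    (1 + PowerSeries.X) * PowerSeries.derivative ℂ logSeries = 1 := by
  ext m
  have h : ∀ i, PowerSeries.coeff i (PowerSeries.derivative ℂ logSeries) = (-1 : ℂ) ^ i := by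
    intro i
    rw [PowerSeries.coeff_derivative]
    have : (i : ℂ) + 1 ≠ 0 := Nat.cast_add_one_ne_zero i
    simp [logSeries, logCoeff]
    field_simp
  rw [add_mul, one_mul, map_add]
  cases m with
  | zero => simp [h]
  | succ m =>
    rw [PowerSeries.coeff_succ_X_mul, h, h, PowerSeries.coeff_one]
    simp [pow_succ]

/-- The truncated series `∑_{k ≤ N} log(1 + X)^k / k!`. -/
def expLogTrunc (N : ℕ) : PowerSeries ℂ := ∑ k ∈ range (N + 1), expCoeff k • logSeries ^ k

/-- Truncated form of the equation `(1 + X) y' = y` satisfied by `exp (log (1 + X))`. It avoids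
composing power series; differentiation lowers the truncation order by one. -/
theorem one_add_X_mul_derivative_expLogTrunc (N : ℕ) :
    (1 + PowerSeries.X) * PowerSeries.derivative ℂ (expLogTrunc (N + 1)) = expLogTrunc N := by
  rw [expLogTrunc, Finset.sum_range_succ', map_add, map_sum, expLogTrunc]
  simp only [pow_zero, Derivation.map_smul, Derivation.leibniz_pow, mul_add, Finset.mul_sum]
  rw [Derivation.map_one_eq_zero, smul_zero, mul_zero, add_zero]
  refine Finset.sum_congr rfl fun k _ => ?_
  have h : (1 + PowerSeries.X) * (expCoeff (k + 1) • (k + 1) • logSeries ^ (k + 1 - 1) •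
      PowerSeries.derivative ℂ logSeries) = (expCoeff (k + 1) * (k + 1)) • (logSeries ^ k *
      ((1 + PowerSeries.X) * PowerSeries.derivative ℂ logSeries)) := by
    rw [← Nat.cast_smul_eq_nsmul ℂ, smul_smul]
    simp only [Nat.add_sub_cancel, smul_eq_mul, mul_smul_comm]
    push_cast
    congr 1
    ring
  rw [h, one_add_X_mul_derivative_logSeries, mul_one]
  congr 1
  have : (k : ℂ) + 1 ≠ 0 := Nat.cast_add_one_ne_zero k
  simp only [expCoeff, Nat.factorial_succ]
  push_cast
  field_simp

/-- Fewer than `k` letters cannot be cut into `k` nonempty pieces. -/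
theorem coeff_logSeries_pow_of_lt {m k : ℕ} (h : m < k) :
    PowerSeries.coeff m (logSeries ^ k) = 0 := by
  have := sum_groupings_length_eq k (List.replicate m ())
  rw [List.length_replicate] at this
  rw [← this]
  refine Finset.sum_eq_zero fun R hR => ?_
  rw [Finset.mem_filter] at hR
  have := length_le_of_mem_groupings hR.1
  rw [List.length_replicate] at this
  omega

theorem coeff_expLogTrunc_of_le {m N : ℕ} (h : m ≤ N) :
    PowerSeries.coeff m (expLogTrunc N) = PowerSeries.coeff m (expLogTrunc m) := by
  induction N, h using Nat.le_induction with
  | base => rfl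
  | succ N hN ih =>
    rw [← ih]
    conv_lhs => rw [expLogTrunc, Finset.sum_range_succ]
    rw [map_add, PowerSeries.coeff_smul,
      coeff_logSeries_pow_of_lt (by omega : m < N + 1), smul_zero, add_zero]
    rfl

/-- The differential equation gives `(m + 1) a_{m+1} = (1 - m) a_m` with `a_0 = 1`. Hence `a_1 = 1`
and everything vanishes from `a_2` on: the series is `1 + X`. -/
theorem coeff_expLogTrunc (m : ℕ) :
    PowerSeries.coeff m (expLogTrunc m) = if m ≤ 1 then 1 else 0 := by
  induction m with
  | zero => simp [expLogTrunc, expCoeff]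
  | succ m ih =>
    have h := congrArg (PowerSeries.coeff m) (one_add_X_mul_derivative_expLogTrunc m)
    rw [add_mul, one_mul, map_add] at h
    have hm : (m : ℂ) + 1 ≠ 0 := Nat.cast_add_one_ne_zero m
    cases m with
    | zero =>
      rw [PowerSeries.coeff_zero_X_mul, PowerSeries.coeff_derivative, ih] at h
      simpa using h
    | succ m =>
      rw [PowerSeries.coeff_succ_X_mul, PowerSeries.coeff_derivative,
        PowerSeries.coeff_derivative, coeff_expLogTrunc_of_le (by omega : m + 1 ≤ m + 1 + 1), ih]
        at h
      rw [if_neg (by omega)]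
      have h2 : PowerSeries.coeff (m + 1 + 1) (expLogTrunc (m + 1 + 1)) * (((m + 1 : ℕ) : ℂ) + 1)
          = 0 := by
        rcases m with _ | m
        · simp only [Nat.zero_add, le_refl, if_true] at h ⊢
          push_cast at h ⊢
          linear_combination h
        · rw [if_neg (by omega)] at h
          push_cast at h ⊢
          linear_combination h
      exact (mul_eq_zero.1 h2).resolve_right hm

/-- Sorted by the number of pieces, the sum is the coefficient of `X ^ l.length` in `exp (log (1 +
X)) = 1 + X`. The empty list is excluded because of the constant term `1`. -/
theorem sum_groupings_exp_log {l : List B} (hl : l ≠ []) :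
    ∑ R ∈ groupings l, expCoeff R.length * wt logCoeff R = if l.length = 1 then 1 else 0 := by
  have h1 : ∑ R ∈ groupings l, expCoeff R.length * wt logCoeff R =
      ∑ k ∈ range (l.length + 1), ∑ R ∈ groupings l with R.length = k,
        expCoeff R.length * wt logCoeff R := by
    refine (Finset.sum_fiberwise_of_maps_to (fun R hR => ?_) _).symm
    have := length_le_of_mem_groupings hR
    simp
    omega
  have h2 := coeff_expLogTrunc l.length
  rw [h1]
  rw [expLogTrunc, map_sum] at h2
  have h3 : l.length ≠ 0 := by simpa using hl
  have h4 : l.length ≤ 1 ↔ l.length = 1 := by omega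
  simp only [h4] at h2
  rw [← h2]
  refine Finset.sum_congr rfl fun k _ => ?_
  rw [PowerSeries.coeff_smul, ← sum_groupings_length_eq, smul_eq_mul, Finset.mul_sum]
  refine Finset.sum_congr rfl fun R hR => ?_
  rw [(Finset.mem_filter.1 hR).2]

/-- The ways to cut each piece of a list of pieces further. -/
def regroupings : List (List B) → Finset (List (List (List B)))
  | [] => {[]}
  | c :: C => (groupings c ×ˢ regroupings C).image fun x => x.1 :: x.2

theorem sum_regroupings_cons [AddCommMonoid V] (c : List B) (C : List (List B))
    (φ : List (List (List B)) → V) :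
    ∑ S ∈ regroupings (c :: C), φ S =
      ∑ R ∈ groupings c, ∑ S ∈ regroupings C, φ (R :: S) := by
  rw [regroupings, Finset.sum_image, Finset.sum_product]
  rintro ⟨a, b⟩ _ ⟨c, d⟩ _ h
  simpa using h

theorem mem_regroupings {C : List (List B)} {S : List (List (List B))} :
    S ∈ regroupings C ↔ S.map List.flatten = C ∧ ∀ R ∈ S, [] ∉ R := by
  induction C generalizing S with
  | nil =>
    simp only [regroupings, Finset.mem_singleton, List.map_eq_nil_iff]
    constructor
    · rintro rfl
      simp
    · exact fun h => h.1
  | cons c C ih =>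
    simp only [regroupings, Finset.mem_image, Finset.mem_product, ih, mem_groupings, Prod.exists]
    constructor
    · rintro ⟨a, b, ⟨⟨h1, h2⟩, h3, h4⟩, rfl⟩
      simp_all
    · rintro ⟨h1, h2⟩
      rcases S with _ | ⟨R, S⟩
      · simp at h1
      · simp at h1 h2
        exact ⟨R, S, ⟨⟨h1.1, h2.1⟩, h1.2, h2.2⟩, rfl⟩

theorem sum_regroupings_exp_log {C : List (List B)} (hC : [] ∉ C) :
    ∑ S ∈ regroupings C, wt logCoeff S.flatten * wt expCoeff S =
      if ∀ c ∈ C, c.length = 1 then 1 else 0 := by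
  induction C with
  | nil => simp [regroupings]
  | cons c C ih =>
    simp only [List.mem_cons, not_or] at hC
    rw [sum_regroupings_cons]
    have : ∀ R ∈ groupings c, ∑ S ∈ regroupings C,
        wt logCoeff (R :: S).flatten * wt expCoeff (R :: S) =
        (expCoeff R.length * wt logCoeff R) *
          ∑ S ∈ regroupings C, wt logCoeff S.flatten * wt expCoeff S := by
      intro R _
      rw [Finset.mul_sum]
      refine Finset.sum_congr rfl fun S _ => ?_
      rw [List.flatten_cons, wt_append, wt_cons]
      ring
    rw [Finset.sum_congr rfl this, ← Finset.sum_mul, sum_groupings_exp_log (Ne.symm hC.1),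
      ih hC.2]
    simp only [List.mem_cons, forall_eq_or_imp]
    split_ifs <;> simp_all

/-- The substitution `exp ∘ log`, as a statement about iterated groupings. -/
theorem sum_groupings_groupings [AddCommGroup V] [Module ℂ V] (Q : List B)
    (φ : List (List B) → V) :
    ∑ R ∈ groupings Q, ∑ S ∈ groupings R,
      (wt logCoeff R * wt expCoeff S) • φ (S.map List.flatten) = φ (Q.map fun a => [a]) := by
  -- A two-level cut `S` can be read in two ways: as a cut of the fine pieces `S.flatten`, or as a
  -- further cutting of each of the coarse pieces `S.map List.flatten`.
  have h1 : ∑ R ∈ groupings Q, ∑ S ∈ groupings R,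
      (wt logCoeff R * wt expCoeff S) • φ (S.map List.flatten) =
      ∑ C ∈ groupings Q, ∑ S ∈ regroupings C,
        (wt logCoeff S.flatten * wt expCoeff S) • φ (S.map List.flatten) := by
    rw [Finset.sum_sigma', Finset.sum_sigma']
    have hne : ∀ S : List (List (List B)), [] ∉ S.flatten → [] ∉ S →
        [] ∉ S.map List.flatten := by
      intro S h1 h2 h3
      obtain ⟨R, hR, h0⟩ := List.mem_map.1 h3
      rcases R with _ | ⟨r, R⟩
      · exact h2 hR
      · simp only [List.flatten_cons, List.append_eq_nil_iff] at h0
        exact h1 (List.mem_flatten.2 ⟨_, hR, by simp [h0.1]⟩)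
    refine Finset.sum_bij' (fun x _ => ⟨x.2.map List.flatten, x.2⟩)
      (fun x _ => ⟨x.2.flatten, x.2⟩) ?_ ?_ ?_ ?_ ?_
    · rintro ⟨R, S⟩ h
      simp only [mem_sigma, mem_groupings, mem_regroupings] at h ⊢
      obtain ⟨⟨rfl, h2⟩, rfl, h4⟩ := h
      refine ⟨⟨?_, hne S h2 h4⟩, by simp, ?_⟩
      · rw [List.flatten_flatten]
      · exact fun R hR h0 => h2 (List.mem_flatten.2 ⟨R, hR, h0⟩)
    · rintro ⟨R, S⟩ h
      simp only [mem_sigma, mem_groupings, mem_regroupings] at h ⊢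
      obtain ⟨⟨rfl, h2⟩, rfl, h4⟩ := h
      refine ⟨⟨?_, ?_⟩, by simp, ?_⟩
      · rw [List.flatten_flatten]
      · intro h0
        obtain ⟨R, hR, h0⟩ := List.mem_flatten.1 h0
        exact h4 R hR h0
      · exact fun h0 => h2 (List.mem_map.2 ⟨_, h0, rfl⟩)
    · rintro ⟨R, S⟩ h
      simp only [mem_sigma, mem_groupings] at h
      simp [h.2.1]
    · rintro ⟨R, S⟩ h
      simp only [mem_sigma, mem_regroupings] at h
      simp [h.2.1]
    · rintro ⟨R, S⟩ h
      simp only [mem_sigma, mem_groupings] at h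
      simp [h.2.1]
  -- For fixed coarse pieces the weights factor over the pieces, and each factor vanishes unless its
  -- piece is a single letter.
  have h2 : ∀ C ∈ groupings Q, ∑ S ∈ regroupings C,
      (wt logCoeff S.flatten * wt expCoeff S) • φ (S.map List.flatten) =
      if C = Q.map fun a => [a] then φ C else 0 := by
    intro C hC
    rw [mem_groupings] at hC
    have : ∀ S ∈ regroupings C,
        (wt logCoeff S.flatten * wt expCoeff S) • φ (S.map List.flatten) =
        (wt logCoeff S.flatten * wt expCoeff S) • φ C := by
      intro S hS
      rw [(mem_regroupings.1 hS).1]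
    rw [Finset.sum_congr rfl this, ← Finset.sum_smul, sum_regroupings_exp_log hC.2]
    have hiff : (∀ c ∈ C, c.length = 1) ↔ C = Q.map fun a => [a] := by
      rw [← hC.1]
      constructor
      · intro h
        clear hC this
        induction C with
        | nil => rfl
        | cons c C ih =>
          obtain ⟨a, rfl⟩ := List.length_eq_one_iff.1 (h c (by simp))
          simp only [List.flatten_cons, List.singleton_append, List.map_cons]
          rw [← ih fun c hc => h c (by simp [hc])]
      · intro h c hc
        rw [h] at hc
        obtain ⟨a, _, rfl⟩ := List.mem_map.1 hc
        rfl
    simp only [hiff, ite_smul, one_smul, zero_smul]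
  rw [h1, Finset.sum_congr rfl h2, Finset.sum_ite_eq', if_pos]
  rw [mem_groupings]
  constructor
  · simp [← List.flatMap_def]
  · simp

end groupings

/-! ### Shuffles of lists -/

/-- The lists whose sublists of the letters in relation to each `k ∈ S` are prescribed lists
`L k` are counted by a multinomial coefficient. -/
theorem exists_shuffles {κ B : Type*} (P : B → κ → Prop) [∀ c k, Decidable (P c k)] (S : Finset κ) (m : ℕ)
    (L : κ → List B) (hL : ∀ k ∈ S, ∀ c ∈ L k, ∀ j ∈ S, P c j ↔ j = k)
    (hm : ∑ k ∈ S, (L k).length = m) :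
    ∃ T : Finset (List B),
      (∀ y, y ∈ T ↔ (∀ c ∈ y, ∃ k ∈ S, P c k) ∧ ∀ k ∈ S, y.filter (fun c => P c k) = L k) ∧
      T.card * ∏ k ∈ S, (L k).length.factorial = m.factorial := by
  induction m generalizing L with
  | zero =>
    have h0 : ∀ k ∈ S, L k = [] := by
      intro k hk
      have := (Finset.sum_eq_zero_iff.1 hm) k hk
      simpa using this
    refine ⟨{[]}, ?_, ?_⟩
    · intro y
      rw [Finset.mem_singleton]
      constructor
      · rintro rfl
        exact ⟨by simp, fun k hk => by simp [h0 k hk]⟩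
      · rintro ⟨h1, h2⟩
        rcases y with _ | ⟨c, y⟩
        · rfl
        · obtain ⟨k, hk, hc⟩ := h1 c (by simp)
          have := h2 k hk
          rw [h0 k hk] at this
          simp [hc] at this
    · rw [Finset.prod_eq_one fun k hk => by rw [h0 k hk]; rfl]
      simp
  | succ m ih =>
    -- The first letter of a shuffle is the head of one of the nonempty lists; what remains is a
    -- shuffle with that list replaced by its tail.
    let S' := S.filter fun k => L k ≠ []
    have hS' : ∀ k, k ∈ S' ↔ k ∈ S ∧ L k ≠ [] := fun k => Finset.mem_filter
    have key : ∀ k : S', ∃ T : Finset (List B),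
      (∀ y, y ∈ T ↔ (∀ c ∈ y, ∃ k ∈ S, P c k) ∧
        ∀ j ∈ S, y.filter (fun c => P c j) = Function.update L k (L k).tail j) ∧
      T.card * ∏ j ∈ S, (Function.update L k (L k).tail j).length.factorial = m.factorial := by
      rintro ⟨k, hk⟩
      obtain ⟨hkS, hk0⟩ := (hS' k).1 hk
      refine ih _ ?_ ?_
      · intro j hj c hc i hi
        by_cases hjk : j = k
        · subst hjk
          simp only [Function.update_self] at hc
          exact hL j hj c (List.mem_of_mem_tail hc) i hi
        · rw [Function.update_of_ne hjk] at hc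
          exact hL j hj c hc i hi
      · rw [← Finset.add_sum_erase _ _ hkS] at hm ⊢
        rw [Finset.sum_congr rfl (g := fun j => (L j).length)]
        · have : (L k).length ≠ 0 := by simpa using hk0
          simp
          omega
        · intro j hj
          rw [Function.update_of_ne (Finset.ne_of_mem_erase hj)]
    choose T hT1 hT2 using key
    let hd : S' → B := fun k => (L k).head ((hS' k).1 k.2).2
    have hhd : ∀ k : S', L k = hd k :: (L k).tail := fun k => (List.cons_head_tail _).symm
    have hP : ∀ (k : S') (j : κ), j ∈ S → (P (hd k) j ↔ j = k) := fun k j hj =>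
      hL k ((hS' k).1 k.2).1 _ (List.head_mem _) j hj
    refine ⟨S'.attach.biUnion fun k => (T k).image (List.cons (hd k)), ?_, ?_⟩
    · intro y
      simp only [Finset.mem_biUnion, Finset.mem_attach, true_and, Finset.mem_image, hT1]
      constructor
      · rintro ⟨k, y, ⟨h1, h2⟩, rfl⟩
        have hk := ((hS' k).1 k.2).1
        refine ⟨?_, ?_⟩
        · intro c hc
          rcases List.mem_cons.1 hc with rfl | hc
          · exact ⟨k, hk, (hP k k hk).2 rfl⟩
          · exact h1 c hc
        · intro j hj
          rw [List.filter_cons, h2 j hj]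
          by_cases hjk : j = k
          · subst hjk
            rw [if_pos (by simpa using (hP k k hk).2 rfl), Function.update_self]
            exact (hhd k).symm
          · rw [if_neg (by simpa using fun h => hjk ((hP k j hj).1 h)),
              Function.update_of_ne hjk]
      · rintro ⟨h1, h2⟩
        rcases y with _ | ⟨c, y⟩
        · exfalso
          have : ∑ k ∈ S, (L k).length = 0 :=
            Finset.sum_eq_zero fun k hk => by rw [← h2 k hk]; rfl
          omega
        · obtain ⟨k, hk, hc⟩ := h1 c (by simp)
          have h3 := h2 k hk
          rw [List.filter_cons, if_pos (by simpa using hc)] at h3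
          have hk' : k ∈ S' := (hS' k).2 ⟨hk, by rw [← h3]; simp⟩
          have h4 := hhd ⟨k, hk'⟩
          simp only at h4
          have h5 := h3.trans h4
          rw [List.cons.injEq] at h5
          refine ⟨⟨k, hk'⟩, y, ⟨fun d hd => h1 d (by simp [hd]), ?_⟩, by rw [← h5.1]⟩
          intro j hj
          by_cases hjk : j = k
          · subst hjk
            rw [Function.update_self]
            exact h5.2
          · rw [Function.update_of_ne hjk, ← h2 j hj, List.filter_cons, if_neg]
            have := (hP ⟨k, hk'⟩ j hj).not.2 hjk
            rw [← h5.1] at this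
            simpa using this
    · rw [Finset.card_biUnion]
      · rw [Finset.sum_mul]
        -- The shuffles starting in `L k` contribute `(L k).length * m!`. Since the lengths add up
        -- to `m + 1`, the total is `(m + 1)!`.
        have h1 : ∀ k : S', ((T k).image (List.cons (hd k))).card *
            ∏ j ∈ S, (L j).length.factorial = (L k).length * m.factorial := by
          intro k
          have hk := ((hS' k).1 k.2).1
          rw [Finset.card_image_of_injective _ List.cons_injective, ← hT2 k,
            ← Finset.mul_prod_erase _ _ hk, ← Finset.mul_prod_erase _ (fun j =>
              (Function.update L k (L k).tail j).length.factorial) hk]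
          rw [Finset.prod_congr rfl (g := fun j => (L j).length.factorial)
            (s₁ := S.erase k) (f := fun j => (Function.update L k (L k).tail j).length.factorial)]
          · have h0 : (L k).length ≠ 0 := by simpa using ((hS' k).1 k.2).2
            have : (L k).length.factorial = (L k).length * ((L k).length - 1).factorial :=
              (Nat.mul_factorial_pred h0).symm
            simp only [Function.update_self, List.length_tail]
            rw [this]
            ring
          · intro j hj
            rw [Function.update_of_ne (Finset.ne_of_mem_erase hj)]
        rw [Finset.sum_congr rfl fun k _ => h1 k, ← Finset.sum_mul,
          Finset.sum_attach S' (fun k => (L k).length)]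
        have h2 : ∑ k ∈ S', (L k).length = ∑ k ∈ S, (L k).length := by
          refine Finset.sum_subset (Finset.filter_subset _ _) fun k hk hk' => ?_
          rw [hS'] at hk'
          push Not at hk'
          simp [hk' hk]
        rw [h2, hm, Nat.factorial_succ]
      · intro i _ j _ hij
        rw [Function.onFun, Finset.disjoint_left]
        intro y hy hy'
        obtain ⟨y1, _, rfl⟩ := Finset.mem_image.1 hy
        obtain ⟨y2, _, h⟩ := Finset.mem_image.1 hy'
        rw [List.cons.injEq] at h
        have h1 := (hP i j ((hS' j).1 j.2).1).1 (by
          rw [← h.1]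
          exact (hP j j ((hS' j).1 j.2).1).2 rfl)
        exact hij (Subtype.ext h1.symm)

/-! ### Refinement coefficients and unions of blocks -/

section lists

variable {A B C M L V : Type*}

theorem _root_.List.Forall₂.exists_mem_left {r : A → B → Prop} {l : List A} {m : List B}
    (h : List.Forall₂ r l m) {a : A} (ha : a ∈ l) : ∃ b ∈ m, r a b := by
  induction h with
  | nil => simp at ha
  | cons hab _ ih =>
    rcases List.mem_cons.1 ha with rfl | ha
    · exact ⟨_, by simp, hab⟩
    · obtain ⟨b, hb, h⟩ := ih ha
      exact ⟨b, by simp [hb], h⟩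

theorem _root_.List.Forall₂.exists_mem_right {r : A → B → Prop} {l : List A} {m : List B}
    (h : List.Forall₂ r l m) {b : B} (hb : b ∈ m) : ∃ a ∈ l, r a b :=
  h.flip.exists_mem_left hb

theorem sum_groupings_map [AddCommMonoid V] (f : A → B) (l : List A) (φ : List (List B) → V) :
    ∑ R ∈ groupings (l.map f), φ R = ∑ R ∈ groupings l, φ (R.map (List.map f)) := by
  induction h : l.length using Nat.strong_induction_on generalizing l φ with
  | _ m ih =>
    rcases eq_or_ne l [] with rfl | hl
    · simp [groupings]
    · rw [sum_groupings_cons (by simpa using hl), sum_groupings_cons hl, List.length_map]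
      refine Finset.sum_congr rfl fun i hi => ?_
      rw [Finset.mem_range] at hi
      rw [← List.map_drop, ih _ (by rw [List.length_drop]; omega) _ _ rfl]
      simp

/-- `R` is a list of label-preserving decompositions of the blocks of `p`, where `σ` joins a list
of unlabelled blocks. -/
def IsGrp (σ : List M → M) (p : List (M × L)) (R : List (List (M × L))) : Prop :=
  List.Forall₂ (fun b r => σ (r.map Prod.fst) = b.1 ∧ ∀ c ∈ r, c.2 = b.2) p R

/-- The sum of `wt f R` over the groupings of `q` that join to `p`. -/
def refCoeff (f : ℕ → ℂ) (σ : List M → M) (p q : List (M × L)) : ℂ :=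
  ∑ R ∈ groupings q, if IsGrp σ p R then wt f R else 0

/-- The union of a list of finite sets. -/
def union (l : List (Finset A)) : Finset A := l.foldr (· ∪ ·) ∅

@[simp] theorem mem_union_list {l : List (Finset A)} {i : A} : i ∈ union l ↔ ∃ S ∈ l, i ∈ S := by
  induction l with
  | nil => simp [union]
  | cons a l ih =>
    have : union (a :: l) = a ∪ union l := rfl
    simp [this, ih]

/-- Every letter lies in exactly one class, so sorting by classes preserves multiplicities. This is
why left multiplication by a coarser composition only reorders blocks. -/
theorem perm_flatMap_filter (P : B → A → Prop) [∀ c a, Decidable (P c a)] (l : List A) (hl : l.Nodup) (y : List B)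
    (h : ∀ c ∈ y, ∃ a ∈ l, P c a) (h' : ∀ c ∈ y, ∀ a ∈ l, ∀ b ∈ l, P c a → P c b → a = b) :
    (l.flatMap fun a => y.filter fun c => P c a).Perm y := by
  rw [List.perm_iff_count]
  intro c
  rw [List.count_flatMap, ← List.sum_toFinset _ hl]
  by_cases hc : c ∈ y
  · obtain ⟨a, ha, hca⟩ := h c hc
    rw [Finset.sum_eq_single a]
    · exact List.count_filter (by simpa using hca)
    · intro b hb hba
      rw [List.mem_toFinset] at hb
      rw [Function.comp_apply, List.count_eq_zero, List.mem_filter]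
      exact fun h2 => hba (h' c hc b hb a ha (by simpa using h2.2) hca)
    · intro h0
      exact absurd (List.mem_toFinset.2 ha) h0
  · rw [List.count_eq_zero_of_not_mem hc]
    refine Finset.sum_eq_zero fun a _ => ?_
    rw [Function.comp_apply, List.count_eq_zero, List.mem_filter]
    exact fun h2 => hc h2.1

end lists

/-! ### The product of set compositions and its effect on supports -/

namespace SetComp

variable {n : ℕ} {L M G : Type*}

theorem mul_blocks [Mul G] (s t : SetComp n G) :
    (s * t).blocks = (s.blocks.flatMap fun b =>
        t.blocks.map fun c => (b.1 ∩ c.1, c.2 * b.2)).filter fun d => d.1.Nonempty := rfl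

theorem mem_part {s : SetComp n L} {S : Finset (Fin n)} :
    S ∈ s.part.parts ↔ ∃ b ∈ s.blocks, b.1 = S := by
  simp [part, Finpartition.ofExistsUnique]

theorem part_le_iff {s : SetComp n L} {t : SetComp n M} :
    s.part ≤ t.part ↔ ∀ b ∈ s.blocks, ∃ c ∈ t.blocks, b.1 ⊆ c.1 := by
  constructor
  · intro h b hb
    obtain ⟨S, hS, h⟩ := h (mem_part.2 ⟨b, hb, rfl⟩)
    obtain ⟨c, hc, rfl⟩ := mem_part.1 hS
    exact ⟨c, hc, h⟩
  · intro h S hS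
    obtain ⟨b, hb, rfl⟩ := mem_part.1 hS
    obtain ⟨c, hc, h⟩ := h b hb
    exact ⟨_, mem_part.2 ⟨c, hc, rfl⟩, h⟩

theorem nodup_map_fst (s : SetComp n L) : (s.blocks.map Prod.fst).Nodup := by
  refine List.pairwise_map.2 (List.Pairwise.imp_of_mem ?_ s.disjoint)
  intro a b ha _ h he
  rw [← he] at h
  exact (s.nonempty a ha).ne_empty (by simpa using h)

theorem part_eq_iff {s : SetComp n L} {t : SetComp n M} :
    s.part = t.part ↔ (s.blocks.map Prod.fst).Perm (t.blocks.map Prod.fst) := by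
  constructor
  · intro h
    have := congrArg Finpartition.parts h
    exact List.perm_of_nodup_nodup_toFinset_eq s.nodup_map_fst t.nodup_map_fst this
  · intro h
    exact Finpartition.ext (List.toFinset_eq_of_perm _ _ h)

theorem card_parts (s : SetComp n L) : #s.part.parts = s.length := by
  have : s.part.parts = (s.blocks.map Prod.fst).toFinset := rfl
  rw [this, List.toFinset_card_of_nodup s.nodup_map_fst, List.length_map, length]

theorem eq_of_subset (s : SetComp n L) {b c : Finset (Fin n) × L} (hb : b ∈ s.blocks)
    (hc : c ∈ s.blocks) {S : Finset (Fin n)} (hS : S.Nonempty) (h1 : S ⊆ b.1) (h2 : S ⊆ c.1) :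
    b = c := by
  by_contra h
  obtain ⟨i, hi⟩ := hS
  exact Finset.disjoint_left.1 (s.disjoint_of_ne hb hc h) (h1 hi) (h2 hi)

/-- A block of `t` meets only the block of `s` that contains it, so no block is cut: the product
sorts the blocks of `t` by those of `s` and multiplies labels. -/
theorem mul_blocks_of_part_le [Mul G] {s t : SetComp n G} (h : t.part ≤ s.part) :
    (s * t).blocks = s.blocks.flatMap fun b =>
      (t.blocks.filter fun c => c.1 ⊆ b.1).map fun c => (c.1, c.2 * b.2) := by
  rw [part_le_iff] at h
  rw [mul_blocks, List.filter_flatMap]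
  refine List.flatMap_congr fun b hb => ?_
  rw [List.filter_map]
  have key : ∀ c ∈ t.blocks, (b.1 ∩ c.1).Nonempty ↔ c.1 ⊆ b.1 := by
    intro c hc
    obtain ⟨b', hb', hcb⟩ := h c hc
    constructor
    · rintro ⟨i, hi⟩
      rw [mem_inter] at hi
      rwa [s.eq_of_subset hb hb' (S := {i}) (by simp) (by simpa using hi.1)
        (by simpa using hcb hi.2)]
    · intro hs
      rw [inter_eq_right.2 hs]
      exact t.nonempty c hc
  rw [List.filter_congr (q := fun c : Finset (Fin n) × G => decide (c.1 ⊆ b.1))]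
  · refine List.map_congr_left fun c hc => ?_
    rw [List.mem_filter] at hc
    rw [inter_eq_right.2 (by simpa using hc.2)]
  · intro c hc
    simp [key c hc]

theorem mul_blocks_unit {x y : SetComp n Unit} (h : y.part ≤ x.part) :
    (x * y).blocks = x.blocks.flatMap fun b => y.blocks.filter fun c => c.1 ⊆ b.1 := by
  rw [mul_blocks_of_part_le h]
  refine List.flatMap_congr fun b _ => ?_
  exact List.map_id _

theorem mul_blocks_perm {x y : SetComp n Unit} (h : y.part ≤ x.part) :
    (x * y).blocks.Perm y.blocks := by
  rw [mul_blocks_unit h]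
  refine perm_flatMap_filter (fun (c b : Finset (Fin n) × Unit) => c.1 ⊆ b.1) _ x.nodup_blocks _ (part_le_iff.1 h) ?_
  intro c hc a ha b hb
  exact x.eq_of_subset ha hb (y.nonempty c hc)

theorem part_mul {x y : SetComp n Unit} (h : y.part ≤ x.part) : (x * y).part = y.part :=
  part_eq_iff.2 ((mul_blocks_perm h).map _)

theorem length_mul {x y : SetComp n Unit} (h : y.part ≤ x.part) : (x * y).length = y.length :=
  (mul_blocks_perm h).length_eq

/-- The blocks of a pairwise disjoint list of blocks are recovered by inclusion. -/
theorem eq_map_filter {M : Type*} (p : List (Finset (Fin n) × L))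
    (R : List (List (Finset (Fin n) × M))) (hp : p.Pairwise fun a b => Disjoint a.1 b.1)
    (hR : ∀ c ∈ R.flatten, c.1.Nonempty)
    (h : List.Forall₂ (fun b r => union (r.map Prod.fst) = b.1) p R) :
    R = p.map fun b => R.flatten.filter fun c => c.1 ⊆ b.1 := by
  induction h with
  | nil => rfl
  | @cons b r p R hbr h ih =>
    rw [List.pairwise_cons] at hp
    have hsub : ∀ c ∈ r, c.1 ⊆ b.1 := by
      intro c hc i hi
      rw [← hbr, mem_union_list]
      exact ⟨c.1, List.mem_map_of_mem hc, hi⟩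
    have hsub' : ∀ c ∈ R.flatten, ∃ b' ∈ p, c.1 ⊆ b'.1 := by
      intro c hc
      obtain ⟨r', hr', hc⟩ := List.mem_flatten.1 hc
      obtain ⟨b', hb', hu⟩ := h.exists_mem_right hr'
      refine ⟨b', hb', fun i hi => ?_⟩
      rw [← hu, mem_union_list]
      exact ⟨c.1, List.mem_map_of_mem hc, hi⟩
    have hd : ∀ (c : Finset (Fin n) × M) (b b' : Finset (Fin n) × L), c.1.Nonempty → c.1 ⊆ b.1 →
        c.1 ⊆ b'.1 → ¬ Disjoint b.1 b'.1 := by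
      rintro c b b' ⟨i, hi⟩ h1 h2 hd
      exact Finset.disjoint_left.1 hd (h1 hi) (h2 hi)
    simp only [List.flatten_cons, List.mem_append] at hR
    rw [List.map_cons, List.flatten_cons]
    congr 1
    · rw [List.filter_append, List.filter_eq_self.2 (by simpa using fun a b => hsub (a, b)),
        List.filter_eq_nil_iff.2, List.append_nil]
      intro c hc hcb
      obtain ⟨b', hb', hc'⟩ := hsub' c hc
      exact hd c b b' (hR c (Or.inr hc)) (by simpa using hcb) hc' (hp.1 b' hb')
    · conv_lhs => rw [ih hp.2 fun c hc => hR c (Or.inr hc)]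
      refine List.map_congr_left fun b' hb' => ?_
      rw [List.filter_append, (List.filter_eq_nil_iff (l := r)).2, List.nil_append]
      intro c hc hcb
      exact hd c b b' (hR c (Or.inl hc)) (hsub c hc) (by simpa using hcb) (hp.1 b' hb')

/-- The label-preserving groupings of a set composition are determined by what they join to. -/
theorem eq_map_filter_of_isGrp {s : SetComp n L} {t : SetComp n M}
    {R : List (List (Finset (Fin n) × M))} (hR : R.flatten = t.blocks)
    (h : List.Forall₂ (fun b r => union (r.map Prod.fst) = b.1) s.blocks R) :
    R = s.blocks.map fun b => t.blocks.filter fun c => c.1 ⊆ b.1 := by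
  rw [← hR]
  exact eq_map_filter _ _ s.disjoint (fun c hc => t.nonempty c (hR ▸ hc)) h

theorem part_le_of_isGrp {s : SetComp n L} {t : SetComp n M}
    {R : List (List (Finset (Fin n) × M))} (hR : R.flatten = t.blocks)
    (h : List.Forall₂ (fun b r => union (r.map Prod.fst) = b.1) s.blocks R) :
    t.part ≤ s.part := by
  rw [part_le_iff]
  intro c hc
  rw [← hR] at hc
  obtain ⟨r, hr, hc⟩ := List.mem_flatten.1 hc
  obtain ⟨b, hb, hu⟩ := h.exists_mem_right hr
  refine ⟨b, hb, fun i hi => ?_⟩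
  rw [← hu, mem_union_list]
  exact ⟨c.1, List.mem_map_of_mem hc, hi⟩

theorem union_filter {s : SetComp n L} {t : SetComp n M} (h : t.part ≤ s.part)
    {b : Finset (Fin n) × L} (hb : b ∈ s.blocks) :
    union ((t.blocks.filter fun c => c.1 ⊆ b.1).map Prod.fst) = b.1 := by
  ext i
  simp only [mem_union_list, List.mem_map, List.mem_filter, decide_eq_true_eq]
  constructor
  · rintro ⟨S, ⟨c, ⟨_, hc⟩, rfl⟩, hi⟩
    exact hc hi
  · intro hi
    obtain ⟨c, hc, hic⟩ := t.cover i
    obtain ⟨b', hb', hcb⟩ := part_le_iff.1 h c hc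
    refine ⟨_, ⟨c, ⟨hc, ?_⟩, rfl⟩, hic⟩
    rwa [s.eq_of_subset hb hb' (S := {i}) (by simp) (by simpa using hi) (by simpa using hcb hic)]

theorem filter_ne_nil {s : SetComp n L} {t : SetComp n M} (h : t.part ≤ s.part) :
    [] ∉ s.blocks.map fun b => t.blocks.filter fun c => c.1 ⊆ b.1 := by
  intro h0
  obtain ⟨b, hb, h0⟩ := List.mem_map.1 h0
  have := union_filter h hb
  rw [h0] at this
  exact (s.nonempty b hb).ne_empty this.symm

/-- Joining the blocks of a set composition along a grouping gives a set composition. -/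
theorem exists_of_isGrp {t : SetComp n L} {R : List (List (Finset (Fin n) × L))}
    (hR : R ∈ groupings t.blocks) {z : List (Finset (Fin n) × L)} (h : IsGrp union z R) :
    ∃ s : SetComp n L, s.blocks = z := by
  rw [mem_groupings] at hR
  refine ⟨⟨z, ?_, ?_, ?_⟩, rfl⟩
  · intro b hb
    obtain ⟨r, hr, hu, -⟩ := h.exists_mem_left hb
    have hr0 : r ≠ [] := fun h0 => hR.2 (h0 ▸ hr)
    obtain ⟨c, hc⟩ := List.exists_mem_of_ne_nil r hr0
    obtain ⟨i, hi⟩ := t.nonempty c (hR.1 ▸ List.mem_flatten.2 ⟨r, hr, hc⟩)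
    refine ⟨i, ?_⟩
    rw [← hu, mem_union_list]
    exact ⟨c.1, List.mem_map_of_mem hc, hi⟩
  · have hd := t.disjoint
    rw [← hR.1, List.pairwise_flatten] at hd
    replace hd := hd.2
    clear hR
    induction h with
    | nil => exact List.Pairwise.nil
    | @cons b r z R hbr h ih =>
      rw [List.pairwise_cons] at hd ⊢
      refine ⟨fun b' hb' => ?_, ih hd.2⟩
      obtain ⟨r', hr', hu, -⟩ := h.exists_mem_left hb'
      rw [← hbr.1, ← hu, Finset.disjoint_left]
      intro i hi hi'
      simp only [mem_union_list, List.mem_map] at hi hi'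
      obtain ⟨_, ⟨c, hc, rfl⟩, hi⟩ := hi
      obtain ⟨_, ⟨c', hc', rfl⟩, hi'⟩ := hi'
      exact Finset.disjoint_left.1 (hd.1 r' hr' c hc c' hc') hi hi'
  · intro i
    obtain ⟨c, hc, hi⟩ := t.cover i
    rw [← hR.1] at hc
    obtain ⟨r, hr, hc⟩ := List.mem_flatten.1 hc
    obtain ⟨b, hb, hu, -⟩ := h.exists_mem_right hr
    refine ⟨b, hb, ?_⟩
    rw [← hu, mem_union_list]
    exact ⟨c.1, List.mem_map_of_mem hc, hi⟩

/-- An empty block only produces empty intersections. Discarding can thus be postponed to the end,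
which reduces associativity to unfiltered lists. -/
theorem filter_flatMap_filter_left [Mul G] (l u : List (Finset (Fin n) × G)) :
    (((l.filter fun d => d.1.Nonempty).flatMap fun b =>
        u.map fun c => (b.1 ∩ c.1, c.2 * b.2)).filter fun d => d.1.Nonempty) =
      (l.flatMap fun b => u.map fun c => (b.1 ∩ c.1, c.2 * b.2)).filter
        fun d => d.1.Nonempty := by
  induction l with
  | nil => rfl
  | cons a l ih =>
    rw [List.filter_cons, List.flatMap_cons, List.filter_append, ← ih]
    split_ifs with h
    · rw [List.flatMap_cons, List.filter_append]
    · rw [(List.filter_eq_nil_iff (l := u.map _)).2, List.nil_append]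
      intro d hd
      obtain ⟨c, _, rfl⟩ := List.mem_map.1 hd
      have : a.1 = ∅ := by simpa using h
      simp [this]

theorem filter_flatMap_filter_right [Mul G] (l u : List (Finset (Fin n) × G)) :
    ((l.flatMap fun b => (u.filter fun d => d.1.Nonempty).map
        fun c => (b.1 ∩ c.1, c.2 * b.2)).filter fun d => d.1.Nonempty) =
      (l.flatMap fun b => u.map fun c => (b.1 ∩ c.1, c.2 * b.2)).filter
        fun d => d.1.Nonempty := by
  rw [List.filter_flatMap, List.filter_flatMap]
  refine List.flatMap_congr fun b _ => ?_
  rw [List.filter_map, List.filter_map, List.filter_filter]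
  congr 1
  refine List.filter_congr fun c _ => ?_
  by_cases h : (b.1 ∩ c.1).Nonempty
  · have := h.mono inter_subset_right
    simp [h, this]
  · simp [h]

instance {G : Type*} [Semigroup G] : Semigroup (SetComp n G) where
  mul_assoc s t u := by
    apply SetComp.ext
    rw [mul_blocks (s * t), mul_blocks s (t * u), mul_blocks s t, mul_blocks t u,
      filter_flatMap_filter_left, filter_flatMap_filter_right]
    congr 1
    simp only [List.flatMap_assoc, List.flatMap_map, List.map_flatMap, List.map_map]
    refine List.flatMap_congr fun b _ => List.flatMap_congr fun c _ =>
      List.map_congr_left fun d _ => ?_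
    simp [inter_assoc, mul_assoc]

theorem relabel_mul {K : Type*} [Mul G] [Mul K] (f : G → K) (hf : ∀ a b, f (a * b) = f a * f b)
    (s t : SetComp n G) : (s * t).relabel f = s.relabel f * t.relabel f := by
  apply SetComp.ext
  simp only [relabel, mul_blocks, List.flatMap_map, List.map_map]
  rw [List.filter_flatMap, List.filter_flatMap, List.map_flatMap]
  refine List.flatMap_congr fun b _ => ?_
  rw [List.filter_map, List.filter_map, List.map_map]
  simp [Function.comp_def, hf]

theorem toIdem_mul [Group G] (x y : SetComp n Unit) :
    ((x * y).toIdem : SetComp n G) = x.toIdem * y.toIdem :=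
  relabel_mul _ (by simp) x y

theorem under_mul [Mul G] (s t : SetComp n G) : (s * t).under = s.under * t.under :=
  relabel_mul _ (by simp) s t

@[simp] theorem under_toIdem [One G] (x : SetComp n Unit) :
    (x.toIdem : SetComp n G).under = x := by
  apply SetComp.ext
  simp only [under, toIdem, relabel, List.map_map]
  exact List.map_id _

@[simp] theorem part_relabel (f : L → M) (s : SetComp n L) : (s.relabel f).part = s.part := by
  rw [part_eq_iff]
  simp [relabel, Function.comp_def]

@[simp] theorem part_under (s : SetComp n L) : s.under.part = s.part := part_relabel _ s

@[simp] theorem part_toIdem [One G] (x : SetComp n Unit) :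
    (x.toIdem : SetComp n G).part = x.part := part_relabel _ x

/-- With equal supports, the only block of `y` inside a block of `x` is that block itself, so the
order of `x` prevails. -/
theorem mul_eq_left {x y : SetComp n Unit} (h : y.part = x.part) : x * y = x := by
  apply SetComp.ext
  rw [mul_blocks_unit h.le]
  conv_rhs => rw [← List.flatMap_singleton' x.blocks]
  refine List.flatMap_congr fun b hb => ?_
  have hu := union_filter h.le hb
  have hby : b ∈ y.blocks := by
    obtain ⟨c, hc, hcb⟩ := mem_part.1 (h.symm ▸ mem_part.2 ⟨b, hb, rfl⟩ : b.1 ∈ y.part.parts)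
    rwa [← Prod.ext hcb rfl]
  have hlen : ∀ c ∈ y.blocks.filter (fun c => c.1 ⊆ b.1), c = b := by
    intro c hc
    rw [List.mem_filter] at hc
    exact y.eq_of_subset hc.1 hby (y.nonempty c hc.1) subset_rfl (by simpa using hc.2)
  rw [List.eq_replicate_of_mem hlen]
  have h1 : (y.blocks.filter (fun c => c.1 ⊆ b.1)).length = 1 := by
    have h2 := (y.nodup_blocks.filter (fun c => c.1 ⊆ b.1))
    rw [List.eq_replicate_of_mem hlen, List.nodup_replicate] at h2
    have h3 : (y.blocks.filter (fun c => c.1 ⊆ b.1)).length ≠ 0 := by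
      intro h0
      have hm : b ∈ y.blocks.filter (fun c => c.1 ⊆ b.1) := by simp [hby]
      rw [List.length_eq_zero_iff.1 h0] at hm
      simp at hm
    omega
  rw [h1]
  rfl

/-- The number of set compositions with given support. -/
theorem card_filter_part_eq (x : SetComp n Unit) :
    #{y : SetComp n Unit | y.part = x.part} = x.length.factorial := by
  have h1 : #{y : SetComp n Unit | y.part = x.part} = #(x.blocks.permutations.toFinset) := by
    refine Finset.card_bij (fun y _ => y.blocks) ?_ ?_ ?_
    · intro y hy
      rw [Finset.mem_filter, part_eq_iff] at hy
      rw [List.mem_toFinset, List.mem_permutations]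
      have := hy.2.map (fun S => (S, ()))
      simpa [Function.comp_def] using this
    · exact fun _ _ _ _ h => SetComp.ext h
    · intro l hl
      rw [List.mem_toFinset, List.mem_permutations] at hl
      have hsym : ∀ {a b : Finset (Fin n) × Unit}, Disjoint a.1 b.1 → Disjoint b.1 a.1 :=
        fun h => h.symm
      refine ⟨⟨l, fun b hb => x.nonempty b (hl.mem_iff.1 hb),
        (hl.pairwise_iff hsym).2 x.disjoint, fun i => ?_⟩, ?_, rfl⟩
      · obtain ⟨b, hb, hi⟩ := x.cover i
        exact ⟨b, hl.mem_iff.2 hb, hi⟩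
      · rw [Finset.mem_filter, part_eq_iff]
        exact ⟨Finset.mem_univ _, hl.map _⟩
  rw [h1, List.toFinset_card_of_nodup (List.nodup_permutations _ x.nodup_blocks),
    List.length_permutations, length]

end SetComp

/-! ### The logarithmic expansion of `Q°_x` -/

section QCirc

variable {n : ℕ} {L M G : Type*}

theorem isGrp_unit {σ : List M → M} {p : List (M × Unit)} {R : List (List (M × Unit))} :
    IsGrp σ p R ↔ List.Forall₂ (fun b r => σ (r.map Prod.fst) = b.1) p R := by
  simp [IsGrp]

theorem IsGrp.forall₂ {σ : List M → M} {p : List (M × L)} {R : List (List (M × L))}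
    (h : IsGrp σ p R) : List.Forall₂ (fun b r => σ (r.map Prod.fst) = b.1) p R :=
  h.imp fun _ _ h => h.1

/-- The grouping of the blocks of `t` according to the blocks of `s` that contain them. -/
def SetComp.restrict (s : SetComp n L) (t : SetComp n M) : List (List (Finset (Fin n) × M)) :=
  s.blocks.map fun b => t.blocks.filter fun c => c.1 ⊆ b.1

theorem SetComp.forall₂_restrict {s : SetComp n L} {t : SetComp n M} (h : t.part ≤ s.part) :
    List.Forall₂ (fun b r => union (r.map Prod.fst) = b.1) s.blocks (s.restrict t) := by
  rw [SetComp.restrict, List.forall₂_map_right_iff, List.forall₂_same]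
  exact fun b hb => SetComp.union_filter h hb

theorem SetComp.flatten_restrict {x y : SetComp n Unit} (h : y.part ≤ x.part) :
    (x.restrict y).flatten = (x * y).blocks := by
  rw [SetComp.mul_blocks_unit h, SetComp.restrict, List.flatMap_def]

/-- Disjointness leaves a single grouping of `z` that joins to `x`, namely `x.restrict z`, so the
sum has one nonzero term. -/
theorem refCoeff_eq_wt {f : ℕ → ℂ} {x z : SetComp n Unit} (h : z.part ≤ x.part)
    (hz : x * z = z) : refCoeff f union x.blocks z.blocks = wt f (x.restrict z) := by
  rw [refCoeff, Finset.sum_eq_single_of_mem (x.restrict z), if_pos]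
  · exact isGrp_unit.2 (SetComp.forall₂_restrict h)
  · rw [mem_groupings]
    exact ⟨by rw [SetComp.flatten_restrict h, hz], SetComp.filter_ne_nil h⟩
  · intro R hR hne
    rw [if_neg]
    intro hg
    exact hne (SetComp.eq_map_filter_of_isGrp (mem_groupings.1 hR).1 hg.forall₂)

theorem refCoeff_eq_zero {f : ℕ → ℂ} {x z : SetComp n Unit}
    (h : ¬ (z.part ≤ x.part ∧ x * z = z)) : refCoeff f union x.blocks z.blocks = 0 := by
  refine Finset.sum_eq_zero fun R hR => if_neg fun hg => h ?_
  have hle := SetComp.part_le_of_isGrp (mem_groupings.1 hR).1 hg.forall₂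
  refine ⟨hle, SetComp.ext ?_⟩
  rw [← SetComp.flatten_restrict hle, ← (mem_groupings.1 hR).1]
  exact congrArg List.flatten
    (SetComp.eq_map_filter_of_isGrp (mem_groupings.1 hR).1 hg.forall₂).symm

theorem restrict_eq_restrict {x y z : SetComp n Unit} (hy : y.part ≤ x.part)
    (h : x * y = z) : x.restrict y = x.restrict z := by
  refine SetComp.eq_map_filter_of_isGrp ?_ (SetComp.forall₂_restrict hy)
  rw [SetComp.flatten_restrict hy, h]

/-- The `y` counted are the shuffles of the lists of blocks of `z` inside the various blocks of `x`,
so their number is a multinomial coefficient with numerator `ℓ(z)!`. The factor `expCoeff z.length`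
cancels this numerator. -/
theorem card_filter_mul_eq (x z : SetComp n Unit) :
    (#{y : SetComp n Unit | y.part ≤ x.part ∧ x * y = z} : ℂ) * expCoeff z.length =
      refCoeff expCoeff union x.blocks z.blocks := by
  by_cases h : z.part ≤ x.part ∧ x * z = z
  · rw [refCoeff_eq_wt h.1 h.2]
    obtain ⟨h1, h2⟩ := h
    have hlen : ∑ b ∈ x.blocks.toFinset, (z.blocks.filter fun c => c.1 ⊆ b.1).length =
        z.length := by
      rw [List.sum_toFinset _ x.nodup_blocks, SetComp.length]
      conv_rhs => rw [← h2, SetComp.mul_blocks_unit h1, List.length_flatMap]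
    obtain ⟨T, hT1, hT2⟩ := exists_shuffles
      (fun (c : Finset (Fin n) × Unit) (b : Finset (Fin n) × Unit) => c.1 ⊆ b.1)
      x.blocks.toFinset z.length (fun b => z.blocks.filter fun c => c.1 ⊆ b.1) (by
        intro b hb c hc b' hb'
        rw [List.mem_toFinset] at hb hb'
        rw [List.mem_filter] at hc
        have hcb : c.1 ⊆ b.1 := by simpa using hc.2
        exact ⟨fun h => x.eq_of_subset hb' hb (z.nonempty c hc.1) h hcb, fun h => h ▸ hcb⟩) hlen
    have hcard : #{y : SetComp n Unit | y.part ≤ x.part ∧ x * y = z} = #T := by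
      refine Finset.card_bij (fun y _ => y.blocks) ?_ ?_ ?_
      · intro y hy
        rw [Finset.mem_filter] at hy
        rw [hT1]
        refine ⟨fun c hc => by simpa using SetComp.part_le_iff.1 hy.2.1 c hc, fun b hb => ?_⟩
        have := restrict_eq_restrict hy.2.1 hy.2.2
        exact (List.map_inj_left.1 this) b (List.mem_toFinset.1 hb)
      · exact fun _ _ _ _ h => SetComp.ext h
      · intro l hl
        rw [hT1] at hl
        obtain ⟨hl1, hl2⟩ := hl
        have hfl : (x.blocks.flatMap fun b => l.filter fun c => c.1 ⊆ b.1) = z.blocks := by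
          conv_rhs => rw [← h2, SetComp.mul_blocks_unit h1]
          exact List.flatMap_congr fun b hb => hl2 b (List.mem_toFinset.2 hb)
        have hmem : ∀ c ∈ l, c ∈ z.blocks := by
          intro c hc
          obtain ⟨b, hb, hcb⟩ := hl1 c hc
          rw [← hfl, List.mem_flatMap]
          exact ⟨b, List.mem_toFinset.1 hb, List.mem_filter.2 ⟨hc, by simpa using hcb⟩⟩
        have hp : l.Perm z.blocks := by
          rw [← hfl]
          refine (perm_flatMap_filter (fun (c b : Finset (Fin n) × Unit) => c.1 ⊆ b.1) _
            x.nodup_blocks _ (by simpa using hl1) ?_).symm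
          intro c hc a ha b hb
          exact x.eq_of_subset ha hb (z.nonempty c (hmem c hc))
        have hsym : ∀ {a b : Finset (Fin n) × Unit}, Disjoint a.1 b.1 → Disjoint b.1 a.1 :=
          fun h => h.symm
        refine ⟨⟨l, fun b hb => z.nonempty b (hp.mem_iff.1 hb),
          (hp.pairwise_iff hsym).2 z.disjoint, fun i => ?_⟩, ?_, rfl⟩
        · obtain ⟨b, hb, hi⟩ := z.cover i
          exact ⟨b, hp.mem_iff.2 hb, hi⟩
        · rw [Finset.mem_filter]
          have hle : SetComp.part ⟨l, fun b hb => z.nonempty b (hp.mem_iff.1 hb),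
              (hp.pairwise_iff hsym).2 z.disjoint, fun i => by
                obtain ⟨b, hb, hi⟩ := z.cover i
                exact ⟨b, hp.mem_iff.2 hb, hi⟩⟩ ≤ x.part := by
            rw [SetComp.part_le_iff]
            simpa using hl1
          refine ⟨Finset.mem_univ _, hle, SetComp.ext ?_⟩
          rw [SetComp.mul_blocks_unit hle]
          exact hfl
    have hwt : wt expCoeff (x.restrict z) =
        ((∏ b ∈ x.blocks.toFinset, (z.blocks.filter fun c => c.1 ⊆ b.1).length.factorial : ℕ) :
          ℂ)⁻¹ := by
      rw [List.prod_toFinset _ x.nodup_blocks, wt, SetComp.restrict, List.map_map,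
        Nat.cast_list_prod, List.map_map, List.prod_inv, List.map_map]
      rfl
    have hz0 : ((z.length.factorial : ℕ) : ℂ) ≠ 0 := Nat.cast_ne_zero.2 (Nat.factorial_ne_zero _)
    have hP0 : ((∏ b ∈ x.blocks.toFinset,
        (z.blocks.filter fun c => c.1 ⊆ b.1).length.factorial : ℕ) : ℂ) ≠ 0 :=
      Nat.cast_ne_zero.2 (Finset.prod_ne_zero_iff.2 fun _ _ => Nat.factorial_ne_zero _)
    rw [hwt, hcard, expCoeff, ← hT2]
    rw [← hT2] at hz0
    push_cast at hz0 hP0 ⊢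
    field_simp
    exact div_self (left_ne_zero_of_mul hz0)
  · rw [refCoeff_eq_zero h, Finset.card_eq_zero.2, Nat.cast_zero, zero_mul]
    rw [Finset.filter_eq_empty_iff]
    -- A solution `y` of `x * y = z` forces `x * z = z`, by `x * x = x`, and `z` then refines `x`.
    rintro y - ⟨hy, rfl⟩
    refine h ⟨(SetComp.part_mul hy).le.trans hy, ?_⟩
    rw [← mul_assoc, SetComp.mul_eq_left rfl]

variable [Group G]

/-- The refinements of `x`, weighted by the coefficients of the logarithm. -/
def logSum (G : Type*) [Group G] (x : SetComp n Unit) : HAlg n G :=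
  ∑ t : SetComp n Unit, refCoeff logCoeff union x.blocks t.blocks • H t.toIdem

theorem union_map_union (l : List (List (Finset (Fin n)))) :
    union (l.map union) = union l.flatten := by
  ext i
  simp only [mem_union_list, List.mem_map, List.mem_flatten]
  constructor
  · rintro ⟨_, ⟨r, hr, rfl⟩, hi⟩
    obtain ⟨S, hS, hi⟩ := mem_union_list.1 hi
    exact ⟨S, ⟨r, hr, hS⟩, hi⟩
  · rintro ⟨S, ⟨r, hr, hS⟩, hi⟩
    exact ⟨_, ⟨r, hr, rfl⟩, mem_union_list.2 ⟨S, hS, hi⟩⟩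

/-- The `exp` matrix inverts the `log` matrix: the coefficient of each `H_t` is a sum over two-level
cuts of the blocks of `t`, evaluated by `sum_groupings_groupings`. -/
theorem sum_refCoeff_expCoeff_smul_logSum (x : SetComp n Unit) :
    ∑ z : SetComp n Unit, refCoeff expCoeff union x.blocks z.blocks • logSum G z =
      H x.toIdem := by
  let mg : List (Finset (Fin n) × Unit) → Finset (Fin n) × Unit :=
    fun r => (union (r.map Prod.fst), ())
  have hmg : ∀ (z : SetComp n Unit) R, IsGrp union z.blocks R ↔ z.blocks = R.map mg := by
    intro z R
    rw [isGrp_unit, ← List.forall₂_eq_eq_eq, List.forall₂_map_right_iff]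
    simp only [mg, Prod.ext_iff, and_true, eq_comm]
  have h1 : ∀ t : SetComp n Unit, ∑ z : SetComp n Unit,
      refCoeff expCoeff union x.blocks z.blocks * refCoeff logCoeff union z.blocks t.blocks =
      if x = t then 1 else 0 := by
    intro t
    have h2 : ∀ z : SetComp n Unit,
        refCoeff expCoeff union x.blocks z.blocks * refCoeff logCoeff union z.blocks t.blocks =
        ∑ R ∈ groupings t.blocks, if z.blocks = R.map mg then
          wt logCoeff R * refCoeff expCoeff union x.blocks (R.map mg) else 0 := by
      intro z
      conv_lhs => rw [refCoeff.eq_def logCoeff, Finset.mul_sum]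
      refine Finset.sum_congr rfl fun R _ => ?_
      rw [hmg]
      split_ifs with h
      · rw [h, mul_comm]
      · rw [mul_zero]
    simp only [h2]
    rw [Finset.sum_comm]
    have h3 : ∀ R ∈ groupings t.blocks, (∑ z : SetComp n Unit, if z.blocks = R.map mg then
          wt logCoeff R * refCoeff expCoeff union x.blocks (R.map mg) else 0) =
        ∑ S ∈ groupings R, (wt logCoeff R * wt expCoeff S) •
          (if IsGrp union x.blocks (S.map List.flatten) then (1 : ℂ) else 0) := by
      intro R hR
      -- Each cut `R` of `t` joins to exactly one intermediate composition `z`, so the sum over `z`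
      -- collapses.
      obtain ⟨z, hz⟩ := SetComp.exists_of_isGrp hR (z := R.map mg) (by
        rw [isGrp_unit, List.forall₂_map_left_iff, List.forall₂_same]
        exact fun _ _ => rfl)
      rw [Finset.sum_eq_single_of_mem z (Finset.mem_univ _), if_pos hz, refCoeff,
        sum_groupings_map, Finset.mul_sum]
      · refine Finset.sum_congr rfl fun S _ => ?_
        have : IsGrp union x.blocks (S.map (List.map mg)) ↔
            IsGrp union x.blocks (S.map List.flatten) := by
          simp only [isGrp_unit, List.forall₂_map_right_iff, mg, List.map_map,
            List.map_flatten, ← union_map_union]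
          rfl
        rw [this, wt_map]
        split_ifs <;> simp
      · intro z' _ hne
        exact if_neg fun h => hne (SetComp.ext (h.trans hz.symm))
    rw [Finset.sum_congr rfl h3, sum_groupings_groupings t.blocks
      (fun C => if IsGrp union x.blocks C then (1 : ℂ) else 0)]
    have h4 : IsGrp union x.blocks (t.blocks.map fun a => [a]) ↔ x = t := by
      rw [hmg, SetComp.ext_iff, List.map_map]
      have : (mg ∘ fun a : Finset (Fin n) × Unit => [a]) = id := by
        ext a : 1
        simp [mg, union]
      rw [this, List.map_id]
    simp only [h4]
  simp only [logSum, Finset.smul_sum, smul_smul]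
  rw [Finset.sum_comm]
  simp only [← Finset.sum_smul, h1, ite_smul, one_smul, zero_smul]
  simp

theorem H_mul_H (s t : SetComp n G) : H s * H t = H (s * t) := by
  simp [H, MonoidAlgebra.single_mul_single]

theorem H_toIdem_mul_uSec {x : SetComp n Unit} {X : Finpartition (univ : Finset (Fin n))}
    (hx : x.part = X) : H x.toIdem * uSec G X = H x.toIdem := by
  subst hx
  rw [uSec, mul_smul_comm, Finset.mul_sum, Finset.sum_congr rfl (g := fun _ => H x.toIdem)]
  · rw [Finset.sum_const, ← Nat.cast_smul_eq_nsmul ℂ, smul_smul, inv_mul_cancel₀, one_smul]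
    rw [SetComp.card_filter_part_eq]
    exact Nat.cast_ne_zero.2 (Nat.factorial_ne_zero _)
  · intro y hy
    rw [H_mul_H, ← SetComp.toIdem_mul, SetComp.mul_eq_left (Finset.mem_filter.1 hy).2]

theorem uSec_mul_uSec (X : Finpartition (univ : Finset (Fin n))) :
    uSec G X * uSec G X = uSec G X := by
  conv_lhs => rw [uSec.eq_def G X]
  rw [smul_mul_assoc, Finset.sum_mul, ← uSec]
  conv_rhs => rw [uSec]
  congr 1
  exact Finset.sum_congr rfl fun x hx => H_toIdem_mul_uSec (Finset.mem_filter.1 hx).2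

theorem uSec_mul_eCirc (X : Finpartition (univ : Finset (Fin n))) :
    uSec G X * eCirc G X = eCirc G X := by
  rw [eCirc, mul_sub, Finset.mul_sum, uSec_mul_uSec]
  simp only [← mul_assoc, uSec_mul_uSec]

/-- Since `u_X e°_X = e°_X`, the averaging in `u_X` can be carried out on `e°_X` itself. -/
theorem eCirc_eq_smul_sum (X : Finpartition (univ : Finset (Fin n))) :
    eCirc G X = ((#{x : SetComp n Unit | x.part = X} : ℕ) : ℂ)⁻¹ •
      ∑ x : SetComp n Unit with x.part = X, QCirc G x := by
  conv_lhs => rw [← uSec_mul_eCirc, uSec, smul_mul_assoc, Finset.sum_mul]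
  congr 1
  refine Finset.sum_congr rfl fun x hx => ?_
  rw [QCirc, (Finset.mem_filter.1 hx).2]

theorem SetComp.exists_part_eq (X : Finpartition (univ : Finset (Fin n))) :
    ∃ x : SetComp n Unit, x.part = X := by
  refine ⟨⟨X.parts.toList.map fun S => (S, ()), ?_, ?_, ?_⟩, ?_⟩
  · intro b hb
    obtain ⟨S, hS, rfl⟩ := List.mem_map.1 hb
    exact X.nonempty_of_mem_parts (by simpa using hS)
  · rw [List.pairwise_map]
    refine (Finset.nodup_toList X.parts).imp_of_mem ?_
    intro S T hS hT h
    exact X.disjoint (by simpa using hS) (by simpa using hT) h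
  · intro i
    obtain ⟨S, hS, hi⟩ := X.exists_mem (Finset.mem_univ i)
    exact ⟨(S, ()), by simpa using hS, hi⟩
  · ext S
    simp [SetComp.mem_part]

/-- `Q°_x` is the sum of the refinements of `x`, weighted by the coefficients of the logarithm. -/
theorem QCirc_eq_logSum (x : SetComp n Unit) : QCirc G x = logSum G x := by
  induction hX : x.part using WellFoundedLT.induction generalizing x with
  | _ X ih =>
    subst hX
    -- Here `e°_Y` is an average of the `Q°_y`, and `H_x Q°_y = Q°_{xy}` because `xy` has support
    -- `Y`; the induction hypothesis applies to `xy`.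
    have hterm : ∀ Y < x.part, H x.toIdem * eCirc G Y =
        ∑ y : SetComp n Unit with y.part = Y, expCoeff y.length • logSum G (x * y) := by
      intro Y hY
      obtain ⟨y₀, rfl⟩ := SetComp.exists_part_eq Y
      rw [eCirc_eq_smul_sum, SetComp.card_filter_part_eq, mul_smul_comm, Finset.mul_sum,
        Finset.smul_sum]
      refine Finset.sum_congr rfl fun y hy => ?_
      replace hy := (Finset.mem_filter.1 hy).2
      have hle : y.part ≤ x.part := hy ▸ hY.le
      rw [← ih _ hY _ ((SetComp.part_mul hle).trans hy), QCirc, QCirc, SetComp.part_mul hle,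
        ← mul_assoc, H_mul_H, ← SetComp.toIdem_mul, expCoeff, ← SetComp.card_parts,
        ← SetComp.card_parts, hy]
    have hself : ∑ y : SetComp n Unit with y.part = x.part, expCoeff y.length • logSum G (x * y) =
        logSum G x := by
      rw [Finset.sum_congr rfl (g := fun _ => expCoeff x.length • logSum G x)]
      · rw [Finset.sum_const, SetComp.card_filter_part_eq, ← Nat.cast_smul_eq_nsmul ℂ, smul_smul,
          expCoeff, mul_inv_cancel₀ (Nat.cast_ne_zero.2 (Nat.factorial_ne_zero _)), one_smul]
      · intro y hy
        replace hy := (Finset.mem_filter.1 hy).2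
        rw [SetComp.mul_eq_left hy, ← SetComp.card_parts, hy, SetComp.card_parts]
    -- Sorting the `y` by the value `z = x * y` turns the weights `1/ℓ(y)!` into the entries of the
    -- `exp` matrix.
    have hall : ∑ y : SetComp n Unit with y.part ≤ x.part, expCoeff y.length • logSum G (x * y) =
        H x.toIdem := by
      rw [← sum_refCoeff_expCoeff_smul_logSum,
        ← Finset.sum_fiberwise_of_maps_to (t := univ) (g := fun y => x * y)
          (fun _ _ => Finset.mem_univ _)]
      refine Finset.sum_congr rfl fun z _ => ?_
      rw [← card_filter_mul_eq, Finset.filter_filter,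
        Finset.sum_congr rfl (g := fun _ => expCoeff z.length • logSum G z)]
      · rw [Finset.sum_const, ← Nat.cast_smul_eq_nsmul ℂ, smul_smul]
      · intro y hy
        obtain ⟨hle, rfl⟩ := (Finset.mem_filter.1 hy).2
        rw [SetComp.length_mul hle]
    have hsplit : ∑ y : SetComp n Unit with y.part ≤ x.part,
        expCoeff y.length • logSum G (x * y) =
        logSum G x + ∑ Y : {Y : Finpartition (univ : Finset (Fin n)) // Y < x.part},
          H x.toIdem * eCirc G Y.1 := by
      rw [Finset.sum_congr rfl fun (Y : {Y // Y < x.part}) _ => hterm Y.1 Y.2, ← hself,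
        ← Finset.sum_subtype (univ.filter fun Y => Y < x.part) (by simp)
          (f := fun Y => ∑ y : SetComp n Unit with y.part = Y,
            expCoeff y.length • logSum G (x * y)),
        ← Finset.sum_fiberwise_of_maps_to (s := univ.filter fun y => y.part ≤ x.part)
          (t := univ.filter fun Y => Y ≤ x.part) (g := SetComp.part) (by simp)]
      have hins : (univ.filter fun Y => Y ≤ x.part) =
          insert x.part (univ.filter fun Y => Y < x.part) := by
        ext Y
        simp [le_iff_eq_or_lt]
      rw [hins, Finset.sum_insert (by simp)]
      congr 1
      · refine Finset.sum_congr ?_ fun _ _ => rfl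
        ext y
        simp +contextual
      · refine Finset.sum_congr rfl fun Y hY => Finset.sum_congr ?_ fun _ _ => rfl
        ext y
        have := (Finset.mem_filter.1 hY).2.le
        simp only [Finset.mem_filter, Finset.mem_univ, true_and, and_iff_right_iff_imp]
        rintro rfl
        exact this
    -- The recursion reads `Q°_x = H_x - ∑_{Y < X} H_x e°_Y`, with `<` meaning strictly finer, and
    -- `logSum G x` satisfies the same equation.
    rw [QCirc, eCirc, mul_sub, H_toIdem_mul_uSec rfl, Finset.mul_sum]
    simp only [← mul_assoc, H_toIdem_mul_uSec]
    rw [sub_eq_iff_eq_add, ← hsplit, hall]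

end QCirc

/-! ### Labelled refinements and the symmetrised elements -/

section symmetrized

variable {n : ℕ} {L M G : Type*}

namespace SetComp

theorem under_eq_iff {s : SetComp n L} {t : SetComp n M} :
    s.under = t.under ↔ s.blocks.map Prod.fst = t.blocks.map Prod.fst := by
  rw [SetComp.ext_iff]
  constructor
  · intro h
    simpa [under, relabel, Function.comp_def] using congrArg (List.map Prod.fst) h
  · intro h
    simpa [under, relabel, Function.comp_def] using congrArg (List.map fun S => (S, ())) h

/-- A set composition can be relabelled arbitrarily. -/
theorem exists_of_map_fst_eq (s : SetComp n L) {l : List (Finset (Fin n) × M)}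
    (h : l.map Prod.fst = s.blocks.map Prod.fst) : ∃ t : SetComp n M, t.blocks = l := by
  refine ⟨⟨l, ?_, ?_, ?_⟩, rfl⟩
  · intro b hb
    have : b.1 ∈ s.blocks.map Prod.fst := h ▸ List.mem_map_of_mem hb
    obtain ⟨c, hc, hcb⟩ := List.mem_map.1 this
    exact hcb ▸ s.nonempty c hc
  · have : (l.map Prod.fst).Pairwise Disjoint := by
      rw [h, List.pairwise_map]
      exact s.disjoint
    exact List.pairwise_map.1 this
  · intro i
    obtain ⟨b, hb, hi⟩ := s.cover i
    have : b.1 ∈ l.map Prod.fst := h ▸ List.mem_map_of_mem hb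
    obtain ⟨c, hc, hcb⟩ := List.mem_map.1 this
    exact ⟨c, hc, hcb ▸ hi⟩

theorem eq_of_fst_eq (s : SetComp n L) {b c : Finset (Fin n) × L} (hb : b ∈ s.blocks)
    (hc : c ∈ s.blocks) (h : b.1 = c.1) : b = c :=
  s.eq_of_subset hb hc (s.nonempty b hb) subset_rfl h.le

theorem eq_of_under_eq {s t : SetComp n L} (h : s.under = t.under)
    (h' : ∀ c ∈ s.blocks, c ∈ t.blocks) : s = t := by
  rw [under_eq_iff] at h
  have hlen : s.blocks.length = t.blocks.length := by simpa using congrArg List.length h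
  refine SetComp.ext (List.ext_getElem hlen fun i h1 h2 => ?_)
  refine t.eq_of_fst_eq (h' _ (List.getElem_mem h1)) (List.getElem_mem h2) ?_
  have h3 : (s.blocks.map Prod.fst)[i]'(by simpa using h1) =
      (t.blocks.map Prod.fst)[i]'(by simpa using h2) := by simp only [h]
  simpa using h3

theorem part_eq_of_under_eq {s : SetComp n L} {t : SetComp n M} (h : s.under = t.under) :
    s.part = t.part := by
  rw [← part_under s, h, part_under]

theorem length_eq_of_under_eq {s : SetComp n L} {t : SetComp n M} (h : s.under = t.under) :
    s.length = t.length := by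
  rw [← card_parts, ← card_parts, part_eq_of_under_eq h]

/-- The reordering of the blocks of `s` according to `x`. -/
def reorder [Group G] (x : SetComp n Unit) (s : SetComp n G) : SetComp n G := x.toIdem * s

theorem reorder_perm [Group G] {x : SetComp n Unit} {s : SetComp n G} (h : s.part ≤ x.part) :
    (x.reorder s).blocks.Perm s.blocks := by
  rw [reorder, mul_blocks_of_part_le (by simpa using h)]
  have : (x.toIdem : SetComp n G).blocks.flatMap (fun b =>
      (s.blocks.filter fun c => c.1 ⊆ b.1).map fun c => (c.1, c.2 * b.2)) =
      x.blocks.flatMap fun b => s.blocks.filter fun c => c.1 ⊆ b.1 := by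
    simp only [toIdem, relabel, List.flatMap_map, mul_one]
    refine List.flatMap_congr fun b _ => ?_
    exact List.map_id _
  rw [this]
  refine perm_flatMap_filter (fun (c : Finset (Fin n) × G) (b : Finset (Fin n) × Unit) =>
    c.1 ⊆ b.1) _ x.nodup_blocks _ (part_le_iff.1 h) ?_
  intro c hc a ha b hb
  exact x.eq_of_subset ha hb (s.nonempty c hc)

theorem under_reorder [Group G] {x : SetComp n Unit} {s : SetComp n G}
    (h : s.part = x.part) : (x.reorder s).under = x := by
  rw [reorder, under_mul, under_toIdem, mul_eq_left (by rwa [part_under])]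

theorem reorder_under [Group G] (s : SetComp n G) : s.under.reorder s = s := by
  refine eq_of_under_eq (under_reorder (by simp)) fun c hc => ?_
  exact (reorder_perm (by simp)).mem_iff.1 hc

theorem reorder_reorder [Group G] {x y : SetComp n Unit} (h : y.part = x.part)
    (s : SetComp n G) : x.reorder (y.reorder s) = x.reorder s := by
  rw [reorder, reorder, reorder, ← mul_assoc, ← toIdem_mul, mul_eq_left h]

theorem mul_toIdem_under [Group G] (s : SetComp n G) : s * s.under.toIdem = s := by
  refine eq_of_under_eq ?_ fun c hc => ?_
  · rw [under_mul, under_toIdem, mul_eq_left rfl]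
  · rw [mul_blocks_of_part_le (by simp)] at hc
    simp only [List.mem_flatMap, List.mem_map, List.mem_filter, decide_eq_true_eq] at hc
    obtain ⟨b, hb, c', ⟨hc', hcb⟩, rfl⟩ := hc
    simp only [toIdem, under, relabel, List.map_map, List.mem_map] at hc'
    obtain ⟨d, hd, rfl⟩ := hc'
    rw [s.eq_of_subset hb hd (s.nonempty d hd) hcb subset_rfl]
    simpa using hd

end SetComp

section R

variable [Group G]

/-- Multiplying `s` by the unlabelled copy of a refinement gives each block the label of the block
of `s` containing it. Label preservation thus becomes an equation in the semigroup. -/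
theorem isGrp_iff_mul_eq {s t : SetComp n G} {R : List (List (Finset (Fin n) × G))}
    (hR : R ∈ groupings t.blocks) :
    IsGrp union s.blocks R ↔ s * t.under.toIdem = t ∧
      IsGrp union s.under.blocks (R.map (List.map fun b => (b.1, ()))) := by
  rw [mem_groupings] at hR
  have hunit : IsGrp union s.under.blocks (R.map (List.map fun b => (b.1, ()))) ↔
      List.Forall₂ (fun b r => union (r.map Prod.fst) = b.1) s.blocks R := by
    simp only [isGrp_unit, SetComp.under, SetComp.relabel, List.forall₂_map_left_iff,
      List.forall₂_map_right_iff, List.map_map]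
    rfl
  rw [hunit]
  have hmul : t.part ≤ s.part → (s * t.under.toIdem).blocks =
      s.blocks.flatMap fun b => (t.blocks.filter fun c => c.1 ⊆ b.1).map fun c => (c.1, b.2) := by
    intro hle
    rw [SetComp.mul_blocks_of_part_le (by simpa using hle)]
    refine List.flatMap_congr fun b _ => ?_
    simp only [SetComp.under, SetComp.toIdem, SetComp.relabel, List.map_map, List.filter_map]
    simp [Function.comp_def]
  constructor
  · intro h
    have hle := SetComp.part_le_of_isGrp hR.1 h.forall₂
    have hres := SetComp.eq_map_filter_of_isGrp hR.1 h.forall₂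
    refine ⟨SetComp.ext ?_, h.forall₂⟩
    rw [hmul hle]
    conv_rhs => rw [← hR.1, hres, ← List.flatMap_def]
    refine List.flatMap_congr fun b hb => ?_
    rw [hres, IsGrp, List.forall₂_map_right_iff, List.forall₂_same] at h
    conv_rhs => rw [← List.map_id (t.blocks.filter fun c => c.1 ⊆ b.1)]
    refine List.map_congr_left fun c hc => ?_
    rw [← (h b hb).2 c hc]
    rfl
  · rintro ⟨h1, h2⟩
    have hle := SetComp.part_le_of_isGrp hR.1 h2
    have hres := SetComp.eq_map_filter_of_isGrp hR.1 h2
    have h3 := hmul hle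
    rw [h1] at h3
    rw [IsGrp, hres, List.forall₂_map_right_iff, List.forall₂_same]
    intro b hb
    refine ⟨SetComp.union_filter hle hb, fun c hc => ?_⟩
    rw [List.mem_filter, decide_eq_true_eq] at hc
    have hc' := hc.1
    rw [h3] at hc'
    simp only [List.mem_flatMap, List.mem_map, List.mem_filter, decide_eq_true_eq] at hc'
    obtain ⟨b', hb', c', ⟨hc1, hc2⟩, rfl⟩ := hc'
    rw [s.eq_of_subset hb hb' (t.nonempty c' hc1) hc.2 hc2]

theorem refCoeff_eq_ite {f : ℕ → ℂ} (s t : SetComp n G) :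
    refCoeff f union s.blocks t.blocks = if s * t.under.toIdem = t then
      refCoeff f union s.under.blocks t.under.blocks else 0 := by
  have : t.under.blocks = t.blocks.map fun b => (b.1, ()) := rfl
  rw [refCoeff, refCoeff, this, sum_groupings_map]
  split_ifs with h
  · refine Finset.sum_congr rfl fun R hR => ?_
    rw [isGrp_iff_mul_eq hR, wt_map]
    simp [h]
  · refine Finset.sum_eq_zero fun R hR => ?_
    rw [isGrp_iff_mul_eq hR, if_neg]
    exact fun h' => h h'.1

/-- `H_s` labels every refinement of `|s|` by the labels of `s`. No terms merge, since such a
refinement is recovered from the product by forgetting labels. -/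
theorem R_eq_sum [Finite G] (s : SetComp n G) :
    R s = ∑ t : SetComp n G, refCoeff logCoeff union s.blocks t.blocks • H t := by
  rw [R, QCirc_eq_logSum, logSum, Finset.mul_sum]
  simp only [mul_smul_comm, H_mul_H]
  rw [← Finset.sum_fiberwise_of_maps_to (t := (univ : Finset (SetComp n G)))
    (g := fun t => s * t.toIdem) (fun _ _ => Finset.mem_univ _)]
  refine Finset.sum_congr rfl fun t _ => ?_
  rw [refCoeff_eq_ite]
  have h0 : ∀ u : SetComp n Unit, s * u.toIdem = t → u ≠ t.under →
      refCoeff logCoeff union s.under.blocks u.blocks = 0 := by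
    intro u hu hne
    refine refCoeff_eq_zero fun h => hne ?_
    rw [← hu, SetComp.under_mul, SetComp.under_toIdem, h.2]
  split_ifs with h
  · rw [Finset.sum_eq_single_of_mem t.under (by simp [h]), h]
    intro u hu hne
    rw [h0 u (Finset.mem_filter.1 hu).2 hne, zero_smul]
  · rw [zero_smul]
    refine Finset.sum_eq_zero fun u hu => ?_
    replace hu := (Finset.mem_filter.1 hu).2
    rw [h0 u hu (fun he => h (he ▸ hu)), zero_smul]

theorem card_union {A : Type*} {l : List (Finset A)} (h : l.Pairwise Disjoint) :
    #(union l) = (l.map Finset.card).sum := by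
  induction l with
  | nil => rfl
  | cons S l ih =>
    rw [List.pairwise_cons] at h
    have : union (S :: l) = S ∪ union l := rfl
    rw [this, Finset.card_union_of_disjoint, ih h.2, List.map_cons, List.sum_cons]
    rw [Finset.disjoint_left]
    intro i hi hi'
    obtain ⟨T, hT, hi'⟩ := mem_union_list.1 hi'
    exact Finset.disjoint_left.1 (h.1 T hT) hi hi'

/-- The label of a joined block is read off from any element of its piece, which is why pieces must
be nonempty. -/
theorem IsGrp.eq_of_isGrp {σ : List M → M} {p p' : List (M × L)} {R : List (List (M × L))}
    (hR : [] ∉ R) (h : IsGrp σ p R) (h' : IsGrp σ p' R) : p = p' := by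
  induction h generalizing p' with
  | nil =>
    cases h'
    rfl
  | @cons b r p R hbr h ih =>
    rcases h' with _ | ⟨hbr', h'⟩
    simp only [List.mem_cons, not_or] at hR
    rw [ih hR.2 h']
    congr 1
    obtain ⟨c, hc⟩ := List.exists_mem_of_ne_nil r (Ne.symm hR.1)
    exact Prod.ext (hbr.1.symm.trans hbr'.1) ((hbr.2 c hc).symm.trans (hbr'.2 c hc))

/-- The map from labelled sets to labelled cardinalities. -/
def cardBlock (b : Finset (Fin n) × L) : ℕ × L := (b.1.card, b.2)

theorem isGrp_sum_of_union {z : List (Finset (Fin n) × L)} {R : List (List (Finset (Fin n) × L))}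
    (hd : R.flatten.Pairwise fun a b => Disjoint a.1 b.1) (h : IsGrp union z R) :
    IsGrp List.sum (z.map cardBlock) (R.map (List.map cardBlock)) := by
  rw [List.pairwise_flatten] at hd
  replace hd := hd.1
  induction h with
  | nil => exact List.Forall₂.nil
  | @cons b r z R hbr h ih =>
    simp only [List.mem_cons, forall_eq_or_imp] at hd
    refine List.Forall₂.cons ⟨?_, ?_⟩ (ih hd.2)
    · have := card_union (List.pairwise_map.2 hd.1)
      rw [hbr.1] at this
      simpa [cardBlock, Function.comp_def] using this.symm
    · intro c hc
      obtain ⟨c', hc', rfl⟩ := List.mem_map.1 hc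
      exact hbr.2 c' hc'

theorem exists_isGrp_union {p : List (ℕ × L)} {R : List (List (Finset (Fin n) × L))}
    (hd : R.flatten.Pairwise fun a b => Disjoint a.1 b.1)
    (h : IsGrp List.sum p (R.map (List.map cardBlock))) :
    ∃ z : List (Finset (Fin n) × L), IsGrp union z R ∧ z.map cardBlock = p := by
  rw [List.pairwise_flatten] at hd
  replace hd := hd.1
  rw [IsGrp, List.forall₂_map_right_iff] at h
  induction h with
  | nil => exact ⟨[], List.Forall₂.nil, rfl⟩
  | @cons b r p R hbr h ih =>
    simp only [List.mem_cons, forall_eq_or_imp] at hd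
    obtain ⟨z, hz, rfl⟩ := ih hd.2
    refine ⟨(union (r.map Prod.fst), b.2) :: z, List.Forall₂.cons ⟨rfl, ?_⟩ hz, ?_⟩
    · exact fun c hc => hbr.2 _ (List.mem_map_of_mem (f := cardBlock) hc)
    · have h1 := card_union (List.pairwise_map.2 hd.1)
      have h2 := hbr.1
      simp only [List.map_map, Function.comp_def, cardBlock] at h1 h2
      rw [List.map_cons, cardBlock, h1, h2]

/-- Cuts of `t` and of its type correspond. A cut whose sizes join to `p` joins to exactly one set
composition of type `p`, so the coefficient depends only on types. -/
theorem sum_refCoeff_type [Finite L] (f : ℕ → ℂ) (p : IntComp n L) (t : SetComp n L) :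
    ∑ s : SetComp n L with s.type = p, refCoeff f union s.blocks t.blocks =
      refCoeff f List.sum p.blocks t.type.blocks := by
  have : t.type.blocks = t.blocks.map cardBlock := rfl
  rw [refCoeff, this, sum_groupings_map]
  simp only [refCoeff]
  rw [Finset.sum_comm]
  refine Finset.sum_congr rfl fun R hR => ?_
  have hR' := mem_groupings.1 hR
  have hd : R.flatten.Pairwise fun a b => Disjoint a.1 b.1 := hR'.1 ▸ t.disjoint
  rw [wt_map]
  split_ifs with h
  · obtain ⟨z, hz, hzp⟩ := exists_isGrp_union hd h
    obtain ⟨s, rfl⟩ := SetComp.exists_of_isGrp hR hz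
    rw [Finset.sum_eq_single_of_mem s, if_pos hz]
    · rw [Finset.mem_filter]
      exact ⟨Finset.mem_univ _, IntComp.ext hzp⟩
    · intro s' _ hne
      exact if_neg fun h' => hne (SetComp.ext (h'.eq_of_isGrp hR'.2 hz))
  · refine Finset.sum_eq_zero fun s hs => if_neg fun hg => h ?_
    rw [← (Finset.mem_filter.1 hs).2]
    exact isGrp_sum_of_union hd hg

theorem symR_eq_sum [Finite G] (p : IntComp n G) :
    symR p = ∑ q : IntComp n G, refCoeff logCoeff List.sum p.blocks q.blocks • symH q := by
  simp only [symR, R_eq_sum]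
  rw [Finset.sum_comm, ← Finset.sum_fiberwise_of_maps_to (t := (univ : Finset (IntComp n G)))
    (g := SetComp.type) (fun _ _ => Finset.mem_univ _)]
  refine Finset.sum_congr rfl fun q _ => ?_
  rw [symH, Finset.smul_sum]
  refine Finset.sum_congr rfl fun t ht => ?_
  rw [← Finset.sum_smul, sum_refCoeff_type, (Finset.mem_filter.1 ht).2]

theorem R_eq_mul_eCirc (s : SetComp n G) : R s = H s * eCirc G s.part := by
  rw [R, QCirc, ← mul_assoc, H_mul_H, SetComp.mul_toIdem_under, SetComp.part_under]

/-- In `R_s = H_s e°_{supp}` the second factor sees only the support, so a reordering acts on `H_s`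
alone. -/
theorem H_toIdem_mul_R {x : SetComp n Unit} {s : SetComp n G} (h : s.part = x.part) :
    H x.toIdem * R s = R (x.reorder s) := by
  rw [R_eq_mul_eCirc, R_eq_mul_eCirc, ← mul_assoc, H_mul_H,
    ← SetComp.part_under (x.reorder s), SetComp.under_reorder h, h, SetComp.reorder]

end R

section characters

variable [CommGroup G] [Finite G]

theorem card_filter_under_eq {K : Type*} [Finite K] (φ : SetComp n L) :
    #{s : SetComp n K | s.under = φ.under} = Nat.card K ^ φ.length := by
  have := Fintype.ofFinite K
  rw [Nat.card_eq_fintype_card, ← card_vector φ.length, ← Finset.card_univ]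
  refine Finset.card_bij (fun s hs => ⟨s.blocks.map Prod.snd, ?_⟩) ?_ ?_ ?_
  · rw [List.length_map]
    exact SetComp.length_eq_of_under_eq (Finset.mem_filter.1 hs).2
  · intros
    exact Finset.mem_univ _
  · intro s hs t ht h
    replace hs := (Finset.mem_filter.1 hs).2
    replace ht := (Finset.mem_filter.1 ht).2
    have h1 := SetComp.under_eq_iff.1 (hs.trans ht.symm)
    have h2 := congrArg Subtype.val h
    simp only at h2
    refine SetComp.ext ?_
    rw [← List.zip_unzip s.blocks, ← List.zip_unzip t.blocks, List.unzip_eq_map,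
      List.unzip_eq_map, h1, h2]
  · rintro ⟨l, hl⟩ -
    have hl' : (φ.blocks.map Prod.fst).length = l.length := by
      rw [hl, List.length_map, SetComp.length]
    obtain ⟨t, ht⟩ := φ.exists_of_map_fst_eq (l := (φ.blocks.map Prod.fst).zip l)
      (List.map_fst_zip hl'.le)
    refine ⟨t, ?_, Subtype.ext ?_⟩
    · rw [Finset.mem_filter, SetComp.under_eq_iff, ht, List.map_fst_zip hl'.le]
      exact ⟨Finset.mem_univ _, rfl⟩
    · simp only [ht]
      exact List.map_snd_zip hl'.ge

theorem Q_eq_sum (φ : SetComp n (Dual G)) :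
    Q φ = ((Nat.card G : ℂ) ^ φ.length)⁻¹ •
      ∑ s : SetComp n G with s.under = φ.under, (starRingEnd ℂ (evalChar φ s)) • R s := by
  rw [Q, E, card_filter_under_eq, smul_mul_assoc, Finset.sum_mul, Nat.cast_pow]
  congr 1
  refine Finset.sum_congr rfl fun s hs => ?_
  rw [smul_mul_assoc, R, (Finset.mem_filter.1 hs).2]

/-- The evaluation of a composition labelled by characters on a list of labelled integers. -/
def evalInt (α : List (ℕ × Dual G)) (p : List (ℕ × G)) : ℂ :=
  (List.zipWith (fun b c => ((b.2 c.2 : ℂˣ) : ℂ)) α p).prod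

/-- In the double sum over `φ` and `s`, the composition `φ` is determined by `s` and `α`, and the
character value depends only on `α` and the type of `s`. The terms therefore collect into the `symR
p`. -/
theorem symQ_eq_sum (α : IntComp n (Dual G)) :
    symQ α = ((Nat.card G : ℂ) ^ α.length)⁻¹ •
      ∑ p : IntComp n G with p.blocks.map Prod.fst = α.blocks.map Prod.fst,
        (starRingEnd ℂ (evalInt α.blocks p.blocks)) • symR p := by
  have h1 : ∀ φ : SetComp n (Dual G), φ.type = α → φ.length = α.length := by
    rintro φ rfl
    simp [SetComp.length, IntComp.length, SetComp.type]
  have h2 : symQ α = ((Nat.card G : ℂ) ^ α.length)⁻¹ •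
      ∑ φ : SetComp n (Dual G) with φ.type = α,
        ∑ s : SetComp n G with s.under = φ.under, (starRingEnd ℂ (evalChar φ s)) • R s := by
    rw [symQ, Finset.smul_sum]
    refine Finset.sum_congr rfl fun φ hφ => ?_
    rw [Q_eq_sum, h1 φ (Finset.mem_filter.1 hφ).2]
  rw [h2]
  congr 1
  trans ∑ s : SetComp n G with s.type.blocks.map Prod.fst = α.blocks.map Prod.fst,
    (starRingEnd ℂ (evalInt α.blocks s.type.blocks)) • R s
  · trans ∑ s : SetComp n G, ∑ φ : SetComp n (Dual G) with φ.type = α ∧ s.under = φ.under,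
      (starRingEnd ℂ (evalChar φ s)) • R s
    · exact Finset.sum_comm' (by simp)
    rw [Finset.sum_filter]
    refine Finset.sum_congr rfl fun s _ => ?_
    have hfst : s.type.blocks.map Prod.fst = (s.blocks.map Prod.fst).map Finset.card := by
      simp [SetComp.type, Function.comp_def]
    have hev : ∀ φ : SetComp n (Dual G), φ.type = α → s.under = φ.under →
        evalChar φ s = evalInt α.blocks s.type.blocks := by
      rintro φ rfl h
      rw [evalChar, if_pos h, evalInt, SetComp.type, SetComp.type, List.zipWith_map]
    split_ifs with h
    · have hlen : s.blocks.length = α.blocks.length := by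
        simpa [SetComp.type] using congrArg List.length h
      -- The only possible `φ` takes its sets from `s` and its characters from `α`.
      have hz : ((s.blocks.map Prod.fst).zip (α.blocks.map Prod.snd)).map Prod.fst =
          s.blocks.map Prod.fst := List.map_fst_zip (by simp [hlen])
      obtain ⟨φ, hφ⟩ := s.exists_of_map_fst_eq hz
      have hs : s.under = φ.under := by
        rw [SetComp.under_eq_iff, hφ, hz]
      have hα : φ.type = α := by
        refine IntComp.ext ?_
        rw [← List.zip_unzip φ.type.blocks, ← List.zip_unzip α.blocks, List.unzip_eq_map,
          List.unzip_eq_map]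
        congr 1
        · simp only
          rw [← h, hfst, ← hz, ← hφ]
          simp [SetComp.type, Function.comp_def]
        · have : φ.type.blocks.map Prod.snd = φ.blocks.map Prod.snd := by
            simp [SetComp.type, Function.comp_def]
          simp only
          rw [this, hφ]
          exact List.map_snd_zip (by simp [hlen])
      rw [Finset.sum_eq_single_of_mem φ (by simp [hs, hα]), hev φ hα hs]
      intro ψ hψ hne
      simp only [Finset.mem_filter, Finset.mem_univ, true_and] at hψ
      refine absurd (SetComp.ext ?_) hne
      rw [← List.zip_unzip φ.blocks, ← List.zip_unzip ψ.blocks, List.unzip_eq_map,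
        List.unzip_eq_map]
      congr 1
      · exact SetComp.under_eq_iff.1 (hψ.2.symm.trans hs)
      · have : ∀ χ : SetComp n (Dual G), χ.type.blocks.map Prod.snd = χ.blocks.map Prod.snd :=
          fun χ => by simp [SetComp.type, Function.comp_def]
        simp only
        rw [← this φ, ← this ψ, hψ.1, hα]
    · refine Finset.sum_eq_zero fun φ hφ => absurd ?_ h
      simp only [Finset.mem_filter, Finset.mem_univ, true_and] at hφ ⊢
      rw [hfst, SetComp.under_eq_iff.1 hφ.2, ← hφ.1]
      simp [SetComp.type, Function.comp_def]
  · rw [← Finset.sum_fiberwise_of_maps_to (t := univ.filter fun p : IntComp n G =>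
      p.blocks.map Prod.fst = α.blocks.map Prod.fst) (g := SetComp.type) (by simp)]
    refine Finset.sum_congr rfl fun p hp => ?_
    rw [symR, Finset.smul_sum]
    refine Finset.sum_congr ?_ ?_
    · ext s
      have := (Finset.mem_filter.1 hp).2
      simp only [Finset.mem_filter, Finset.mem_univ, true_and, and_iff_right_iff_imp]
      rintro rfl
      exact this
    · intro s hs
      rw [(Finset.mem_filter.1 hs).2]

/-- The factors are indexed by pairs of blocks over a common set. The set determines the pair, so
simultaneous reordering merely permutes the factors. -/
theorem evalChar_eq_of_perm {K : Type*} [CommGroup K] {φ φ' : SetComp n (Dual K)}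
    {s s' : SetComp n K}
    (hφ : φ'.blocks.Perm φ.blocks) (hs : s'.blocks.Perm s.blocks) (h : s.under = φ.under)
    (h' : s'.under = φ'.under) : evalChar φ' s' = evalChar φ s := by
  rw [evalChar, evalChar, if_pos h, if_pos h']
  have key : ∀ (φ : SetComp n (Dual K)) (s : SetComp n K), s.under = φ.under →
      (φ.blocks.zip s.blocks).Nodup ∧ ∀ b c, (b, c) ∈ φ.blocks.zip s.blocks ↔
        b ∈ φ.blocks ∧ c ∈ s.blocks ∧ b.1 = c.1 := by
    intro φ s h
    have hlen : s.length = φ.length := SetComp.length_eq_of_under_eq h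
    rw [SetComp.length, SetComp.length] at hlen
    rw [SetComp.under_eq_iff] at h
    have hfst : ∀ i (h1 : i < s.blocks.length) (h2 : i < φ.blocks.length),
        (φ.blocks[i]).1 = (s.blocks[i]).1 := by
      intro i h1 h2
      have h3 : (s.blocks.map Prod.fst)[i]'(by simpa using h1) =
        (φ.blocks.map Prod.fst)[i]'(by simpa using h2) := by simp only [h]
      simpa using h3.symm
    refine ⟨?_, ?_⟩
    · refine List.Nodup.of_map Prod.fst ?_
      rw [List.map_fst_zip hlen.ge]
      exact φ.nodup_blocks
    · intro b c
      constructor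
      · intro hbc
        obtain ⟨h1, h2⟩ := List.of_mem_zip hbc
        refine ⟨h1, h2, ?_⟩
        obtain ⟨i, hi, hbc⟩ := List.getElem_of_mem hbc
        rw [List.getElem_zip, Prod.mk.injEq] at hbc
        rw [← hbc.1, ← hbc.2, hfst]
      · rintro ⟨hb, hc, hbc⟩
        obtain ⟨i, hi, rfl⟩ := List.getElem_of_mem hb
        have : s.blocks[i]'(hlen ▸ hi) = c :=
          s.eq_of_fst_eq (List.getElem_mem _) hc ((hfst i _ hi).symm.trans hbc)
        rw [← this, List.mem_iff_getElem]
        exact ⟨i, by simp [hlen, hi], List.getElem_zip⟩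
  obtain ⟨h1, h2⟩ := key φ s h
  obtain ⟨h1', h2'⟩ := key φ' s' h'
  have hp : (φ'.blocks.zip s'.blocks).Perm (φ.blocks.zip s.blocks) := by
    rw [List.perm_ext_iff_of_nodup h1' h1]
    rintro ⟨b, c⟩
    rw [h2, h2', hφ.mem_iff, hs.mem_iff]
  have hzip : ∀ (l : List (Finset (Fin n) × Dual K)) (m : List (Finset (Fin n) × K)),
      List.zipWith (fun b c => ((b.2 c.2 : ℂˣ) : ℂ)) l m =
        (l.zip m).map fun x => ((x.1.2 x.2.2 : ℂˣ) : ℂ) := by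
    intro l m
    rw [List.zip, List.map_zipWith]
  rw [hzip, hzip]
  exact (hp.map _).prod_eq

/-- Each `R_s` is reordered like `φ` and keeps its character value. Reordering back along `φ.under`
gives the inverse bijection on the summation indices. -/
theorem H_toIdem_mul_Q {x : SetComp n Unit} {φ : SetComp n (Dual G)} (h : φ.part = x.part) :
    H x.toIdem * Q φ = Q (x.reorder φ) := by
  have hu := SetComp.under_reorder h
  have hpart : ∀ s : SetComp n G, s.under = φ.under → s.part = x.part := fun s hs =>
    (SetComp.part_eq_of_under_eq hs).trans h
  rw [Q_eq_sum, Q_eq_sum, mul_smul_comm, Finset.mul_sum]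
  congr 1
  · congr 2
    rw [← SetComp.card_parts, ← SetComp.card_parts, ← SetComp.part_under (x.reorder φ), hu, h]
  · refine Finset.sum_bij' (fun s _ => x.reorder s) (fun s _ => φ.under.reorder s)
      ?_ ?_ ?_ ?_ ?_
    · intro s hs
      replace hs := (Finset.mem_filter.1 hs).2
      rw [Finset.mem_filter, hu, SetComp.under_reorder (hpart s hs)]
      exact ⟨Finset.mem_univ _, rfl⟩
    · intro s hs
      replace hs := (Finset.mem_filter.1 hs).2
      rw [Finset.mem_filter, SetComp.under_reorder]
      · exact ⟨Finset.mem_univ _, rfl⟩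
      · rw [← SetComp.part_under s, hs, hu, SetComp.part_under, h]
    · intro s hs
      replace hs := (Finset.mem_filter.1 hs).2
      rw [SetComp.reorder_reorder (by simp [h]), ← hs, SetComp.reorder_under]
    · intro s hs
      replace hs := (Finset.mem_filter.1 hs).2
      rw [SetComp.reorder_reorder (by simp [h]), ← hu, ← hs, SetComp.reorder_under]
    · intro s hs
      replace hs := (Finset.mem_filter.1 hs).2
      rw [mul_smul_comm, H_toIdem_mul_R (hpart s hs), evalChar_eq_of_perm
        (SetComp.reorder_perm h.le) (SetComp.reorder_perm (hpart s hs).le) hs]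
      rw [hu, SetComp.under_reorder (hpart s hs)]

/-- As `x` runs over the orders averaged by the uniform section, `H_x Q_φ` meets each composition
with support `Φ` exactly once. In particular the chosen representative is immaterial. -/
theorem ePart_eq_sum (Φ : SetPart n (Dual G)) (φ₀ : SetComp n (Dual G)) (h₀ : ⟦φ₀⟧ = Φ) :
    ePart Φ = expCoeff φ₀.length •
      ∑ φ : SetComp n (Dual G) with (⟦φ⟧ : SetPart n (Dual G)) = Φ, Q φ := by
  have hperm : φ₀.blocks.Perm Φ.out.blocks := by
    have : (⟦φ₀⟧ : SetPart n (Dual G)) = ⟦Φ.out⟧ := by rw [h₀, Quotient.out_eq]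
    exact Quotient.exact this
  have hunder : Φ.under = Φ.out.part := by
    conv_lhs => rw [← Quotient.out_eq Φ]
    rfl
  have hlen : φ₀.length = Φ.out.length := hperm.length_eq
  have hcard := SetComp.card_filter_part_eq Φ.out.under
  rw [SetComp.part_under] at hcard
  rw [ePart, uSec, hunder, smul_mul_assoc, Finset.sum_mul, hcard, hlen, expCoeff]
  congr 2
  · simp [SetComp.length, SetComp.under, SetComp.relabel]
  symm
  refine Finset.sum_bij' (fun φ _ => φ.under) (fun x _ => x.reorder Φ.out) ?_ ?_ ?_ ?_ ?_
  all_goals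
    have hiff : ∀ φ : SetComp n (Dual G), (⟦φ⟧ : SetPart n (Dual G)) = Φ ↔
        φ.blocks.Perm Φ.out.blocks := by
      intro φ
      conv_lhs => rw [← Quotient.out_eq Φ]
      exact Quotient.eq
    have hpart : ∀ φ : SetComp n (Dual G), φ.blocks.Perm Φ.out.blocks →
      φ.part = Φ.out.part := fun φ h => SetComp.part_eq_iff.2 (h.map _)
    have hback : ∀ φ : SetComp n (Dual G), φ.blocks.Perm Φ.out.blocks →
        φ.under.reorder Φ.out = φ := by
      intro φ h
      refine SetComp.eq_of_under_eq (SetComp.under_reorder ?_) fun c hc => ?_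
      · rw [SetComp.part_under, hpart φ h]
      · rw [h.mem_iff]
        refine (SetComp.reorder_perm ?_).mem_iff.1 hc
        rw [SetComp.part_under, hpart φ h]
  · intro φ hφ
    rw [Finset.mem_filter, hiff] at hφ
    rw [Finset.mem_filter, SetComp.part_under, hpart φ hφ.2]
    exact ⟨Finset.mem_univ _, rfl⟩
  · intro x hx
    rw [Finset.mem_filter, hiff]
    exact ⟨Finset.mem_univ _, SetComp.reorder_perm (Finset.mem_filter.1 hx).2.ge⟩
  · intro φ hφ
    rw [Finset.mem_filter, hiff] at hφ
    exact hback φ hφ.2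
  · intro x hx
    exact SetComp.under_reorder (Finset.mem_filter.1 hx).2.symm
  · intro φ hφ
    rw [Finset.mem_filter, hiff] at hφ
    rw [H_toIdem_mul_Q (by rw [SetComp.part_under, hpart φ hφ.2]), hback φ hφ.2]

/-- All `Φ` of type `λ` have `ℓ(λ)` blocks, so the normalisation is common; the result has the form
of the definition of `vazirani`. -/
theorem eType_eq_sum (l : IntPart n (Dual G)) :
    eType l = ((l.length.factorial : ℕ) : ℂ)⁻¹ •
      ∑ α : IntComp n (Dual G) with (⟦α⟧ : IntPart n (Dual G)) = l, symQ α := by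
  have h1 : ∀ Φ : SetPart n (Dual G), Φ.type = l → ePart Φ = ((l.length.factorial : ℕ) : ℂ)⁻¹ •
      ∑ φ : SetComp n (Dual G) with (⟦φ⟧ : SetPart n (Dual G)) = Φ, Q φ := by
    rintro Φ rfl
    induction Φ using Quotient.inductionOn with
    | h φ =>
      have hl : (SetPart.type ⟦φ⟧).length = φ.length := List.length_map _
      rw [ePart_eq_sum _ φ rfl, expCoeff, hl]
  rw [eType, Finset.sum_congr rfl fun Φ hΦ => h1 Φ (Finset.mem_filter.1 hΦ).2,
    ← Finset.smul_sum]
  congr 1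
  simp only [symQ]
  trans ∑ φ : SetComp n (Dual G) with (⟦φ.type⟧ : IntPart n (Dual G)) = l, Q φ
  · rw [← Finset.sum_fiberwise_of_maps_to (t := univ.filter fun Φ : SetPart n (Dual G) =>
      Φ.type = l) (g := fun φ => (⟦φ⟧ : SetPart n (Dual G)))
      (s := univ.filter fun φ : SetComp n (Dual G) => (⟦φ.type⟧ : IntPart n (Dual G)) = l)]
    · refine Finset.sum_congr rfl fun Φ hΦ => Finset.sum_congr ?_ fun _ _ => rfl
      ext φ
      have := (Finset.mem_filter.1 hΦ).2
      simp only [Finset.mem_filter, Finset.mem_univ, true_and]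
      constructor
      · rintro rfl
        exact ⟨this, rfl⟩
      · exact fun h => h.2
    · intro φ hφ
      rw [Finset.mem_filter] at hφ ⊢
      exact ⟨Finset.mem_univ _, hφ.2⟩
  · rw [← Finset.sum_fiberwise_of_maps_to (t := univ.filter fun α : IntComp n (Dual G) =>
      (⟦α⟧ : IntPart n (Dual G)) = l) (g := SetComp.type)
      (s := univ.filter fun φ : SetComp n (Dual G) => (⟦φ.type⟧ : IntPart n (Dual G)) = l)]
    · refine Finset.sum_congr rfl fun α hα => Finset.sum_congr ?_ fun _ _ => rfl
      ext φ
      have := (Finset.mem_filter.1 hα).2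
      simp only [Finset.mem_filter, Finset.mem_univ, true_and, and_iff_right_iff_imp]
      rintro rfl
      exact this
    · intro φ hφ
      rw [Finset.mem_filter] at hφ ⊢
      exact ⟨Finset.mem_univ _, hφ.2⟩

end characters

end symmetrized

/-! ### Compositions that cut a word into increasing monochromatic pieces -/

section cuts

variable {A B G : Type*}

/-- `q` is a label-preserving refinement of `p`. -/
def Refines (p q : List (ℕ × G)) : Prop :=
  ∃ R : List (List (ℕ × G)), R.flatten = q ∧ IsGrp List.sum p R

/-- `p` cuts the word `l` into increasing monochromatic pieces. -/
def Cuts [LT A] (l : List (A × G)) (p : List (ℕ × G)) : Prop :=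
  ∃ W : List (List (A × G)), W.flatten = l ∧
    List.Forall₂ (fun (b : ℕ × G) (r : List (A × G)) =>
      r.length = b.1 ∧ (r.Pairwise fun x y => x.1 < y.1) ∧ ∀ x ∈ r, x.2 = b.2) p W

theorem IntComp.le_iff {n : ℕ} {p q : IntComp n G} : p ≤ q ↔ Refines p.blocks q.blocks := Iff.rfl

theorem refines_nil_left {q : List (ℕ × G)} : Refines [] q ↔ q = [] := by
  constructor
  · rintro ⟨R, rfl, h⟩
    cases h
    rfl
  · rintro rfl
    exact ⟨[], rfl, List.Forall₂.nil⟩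

theorem refines_cons {b : ℕ × G} {p q : List (ℕ × G)} : Refines (b :: p) q ↔
    ∃ r q', q = r ++ q' ∧ (r.map Prod.fst).sum = b.1 ∧ (∀ c ∈ r, c.2 = b.2) ∧ Refines p q' := by
  constructor
  · rintro ⟨R, rfl, h⟩
    rcases h with _ | ⟨h1, h2⟩
    exact ⟨_, _, rfl, h1.1, h1.2, _, rfl, h2⟩
  · rintro ⟨r, _, rfl, h1, h2, R, rfl, h3⟩
    exact ⟨r :: R, rfl, List.Forall₂.cons ⟨h1, h2⟩ h3⟩

variable [LT A] in
theorem cuts_nil_right {l : List (A × G)} : Cuts l [] ↔ l = [] := by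
  constructor
  · rintro ⟨R, rfl, h⟩
    cases h
    rfl
  · rintro rfl
    exact ⟨[], rfl, List.Forall₂.nil⟩

variable [LT A] in
theorem cuts_cons {b : ℕ × G} {l : List (A × G)} {p : List (ℕ × G)} : Cuts l (b :: p) ↔
    ∃ r l', l = r ++ l' ∧ r.length = b.1 ∧ (r.Pairwise fun x y => x.1 < y.1) ∧
      (∀ x ∈ r, x.2 = b.2) ∧ Cuts l' p := by
  constructor
  · rintro ⟨R, rfl, h⟩
    rcases h with _ | ⟨h1, h2⟩
    exact ⟨_, _, rfl, h1.1, h1.2.1, h1.2.2, _, rfl, h2⟩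
  · rintro ⟨r, _, rfl, h1, h2, h2', R, rfl, h3⟩
    exact ⟨r :: R, rfl, List.Forall₂.cons ⟨h1, h2, h2'⟩ h3⟩

variable [LT A] in
theorem Cuts.sum_eq {l : List (A × G)} {p : List (ℕ × G)} (h : Cuts l p) :
    (p.map Prod.fst).sum = l.length := by
  induction p generalizing l with
  | nil =>
    rw [cuts_nil_right] at h
    simp [h]
  | cons b p ih =>
    obtain ⟨r, l', rfl, h1, -, -, h⟩ := cuts_cons.1 h
    simp [ih h, h1]

/-- Each first block is at most the size of the other. By positivity neither is subdivided, and the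
tails are compared by induction. -/
theorem Refines.antisymm {p q : List (ℕ × G)} (hp : ∀ b ∈ p, 0 < b.1) (hq : ∀ b ∈ q, 0 < b.1)
    (h : Refines p q) (h' : Refines q p) : p = q := by
  induction p generalizing q with
  | nil => exact (refines_nil_left.1 h).symm
  | cons b p ih =>
    rcases q with _ | ⟨c, q⟩
    · exact refines_nil_left.1 h'
    obtain ⟨r, q', h1, h2, h3, h4⟩ := refines_cons.1 h
    obtain ⟨r', p', h1', h2', h3', h4'⟩ := refines_cons.1 h'
    have hb := hp b (by simp)
    have hc := hq c (by simp)
    rcases r with _ | ⟨c₀, r⟩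
    · simp at h2
      omega
    rcases r' with _ | ⟨b₀, r'⟩
    · simp at h2'
      omega
    simp only [List.cons_append, List.cons.injEq] at h1 h1'
    obtain ⟨rfl, rfl⟩ := h1
    obtain ⟨rfl, rfl⟩ := h1'
    simp only [List.map_cons, List.sum_cons] at h2 h2'
    have hr : r = [] := by
      rcases r with _ | ⟨d, r⟩
      · rfl
      · have := hq d (by simp)
        simp at h2
        omega
    have hr' : r' = [] := by
      rcases r' with _ | ⟨d, r'⟩
      · rfl
      · have := hp d (by simp)
        simp at h2'
        omega
    subst hr hr'
    have hcb : c = b := by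
      refine Prod.ext ?_ (h3 c (by simp))
      simpa using h2
    rw [hcb]
    congr 1
    exact ih (fun b hb => hp b (by simp at hb ⊢; exact Or.inr hb))
      (fun b hb => hq b (by simp at hb ⊢; exact Or.inr hb)) h4 h4'

variable [LT A] in
theorem cuts_append {l₁ l₂ : List (A × G)} {p₁ p₂ : List (ℕ × G)}
    (h : (p₁.map Prod.fst).sum = l₁.length) :
    Cuts (l₁ ++ l₂) (p₁ ++ p₂) ↔ Cuts l₁ p₁ ∧ Cuts l₂ p₂ := by
  induction p₁ generalizing l₁ with
  | nil =>
    have : l₁ = [] := by simpa using h.symm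
    simp [this, cuts_nil_right]
  | cons b p₁ ih =>
    rw [List.cons_append, cuts_cons, cuts_cons]
    simp only [List.map_cons, List.sum_cons] at h
    constructor
    · rintro ⟨r, l', h1, h2, h3, h4, h5⟩
      obtain ⟨t, rfl⟩ : r <+: l₁ := by
        refine List.prefix_of_prefix_length_le (l₃ := l₁ ++ l₂) ⟨l', h1.symm⟩
          (List.prefix_append _ _) ?_
        omega
      rw [List.append_assoc, List.append_cancel_left_eq] at h1
      subst h1
      rw [List.length_append] at h
      obtain ⟨h6, h7⟩ := (ih (by omega)).1 h5
      exact ⟨⟨r, t, rfl, h2, h3, h4, h6⟩, h7⟩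
    · rintro ⟨⟨r, t, rfl, h2, h3, h4, h6⟩, h7⟩
      rw [List.length_append] at h
      exact ⟨r, t ++ l₂, by simp, h2, h3, h4, (ih (by omega)).2 ⟨h6, h7⟩⟩

theorem cuts_of_pairwise [LT A] {t : List (A × G)} {r : List (ℕ × G)} {g : G}
    (h : (r.map Prod.fst).sum = t.length) (ht : t.Pairwise fun x y => x.1 < y.1)
    (ht' : ∀ x ∈ t, x.2 = g) (hr : ∀ c ∈ r, c.2 = g) : Cuts t r := by
  induction r generalizing t with
  | nil => exact cuts_nil_right.2 (by simpa using h.symm)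
  | cons b r ih =>
    simp only [List.map_cons, List.sum_cons] at h
    rw [cuts_cons]
    refine ⟨t.take b.1, t.drop b.1, (List.take_append_drop _ _).symm, ?_, ?_, ?_, ?_⟩
    · rw [List.length_take]
      omega
    · exact ht.sublist (List.take_sublist _ _)
    · intro x hx
      rw [ht' x (List.mem_of_mem_take hx), hr b (by simp)]
    · refine ih ?_ (ht.sublist (List.drop_sublist _ _))
        (fun x hx => ht' x (List.mem_of_mem_drop hx)) (fun c hc => hr c (by simp [hc]))
      rw [List.length_drop]
      omega

theorem Cuts.of_refines [LT A] {l : List (A × G)} {p q : List (ℕ × G)} (h : Cuts l q)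
    (hqp : Refines q p) : Cuts l p := by
  induction q generalizing l p with
  | nil => rwa [refines_nil_left.1 hqp]
  | cons b q ih =>
    obtain ⟨t, l', rfl, h1, h2, h3, h4⟩ := cuts_cons.1 h
    obtain ⟨r, p', rfl, h5, h6, h7⟩ := refines_cons.1 hqp
    exact (cuts_append (h5.trans h1.symm)).2
      ⟨cuts_of_pairwise (h5.trans h1.symm) h2 h3 h6, ih h4 h7⟩

/-- Every word has a coarsest compatible composition. -/
theorem exists_coarsest [Preorder A] (l : List (A × G)) :
    ∃ p : List (ℕ × G), (∀ b ∈ p, 0 < b.1) ∧ Cuts l p ∧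
      ∀ q : List (ℕ × G), (∀ b ∈ q, 0 < b.1) → Cuts l q → Refines p q := by
  induction l with
  | nil =>
    refine ⟨[], by simp, cuts_nil_right.2 rfl, fun q hq hc => ?_⟩
    rcases q with _ | ⟨b, q⟩
    · exact refines_nil_left.2 rfl
    · have := hc.sum_eq
      have := hq b (by simp)
      simp at *
      omega
  | cons x l ih =>
    obtain ⟨p, hp0, hp1, hp2⟩ := ih
    have hsingle : ∀ q : List (ℕ × G), (∀ b ∈ q, 0 < b.1) → Cuts (x :: l) ((1, x.2) :: q) →
        Cuts l q := by
      intro q hq h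
      obtain ⟨r, l', h1, h2, -, -, h5⟩ := cuts_cons.1 h
      obtain ⟨y, rfl⟩ := List.length_eq_one_iff.1 h2
      simp only [List.singleton_append, List.cons.injEq] at h1
      rwa [h1.2]
    -- The new letter enlarges the first block exactly when it prolongs an increasing run of its
    -- colour; otherwise it opens a block of size one.
    by_cases hx : ∃ y l', l = y :: l' ∧ x.1 < y.1 ∧ x.2 = y.2
    · obtain ⟨y, l', rfl, hxy, hxy'⟩ := hx
      rcases p with _ | ⟨⟨a, g⟩, p⟩
      · simpa using hp1.sum_eq
      have ha := hp0 (a, g) (by simp)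
      simp only at ha
      obtain ⟨r, t, h1, h2, h3, h4, h5⟩ := cuts_cons.1 hp1
      rcases r with _ | ⟨y', r⟩
      · simp at h2
        omega
      simp only [List.cons_append, List.cons.injEq] at h1
      obtain ⟨rfl, rfl⟩ := h1
      have hg : x.2 = g := hxy'.trans (h4 y (by simp))
      refine ⟨(a + 1, g) :: p, ?_, ?_, ?_⟩
      · simp only [List.mem_cons, forall_eq_or_imp] at hp0 ⊢
        exact ⟨Nat.succ_pos _, hp0.2⟩
      · rw [cuts_cons]
        refine ⟨x :: y :: r, t, rfl, by simpa using h2, ?_, ?_, h5⟩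
        · rw [List.pairwise_cons]
          refine ⟨fun z hz => ?_, h3⟩
          rcases List.mem_cons.1 hz with rfl | hz
          · exact hxy
          · exact hxy.trans ((List.pairwise_cons.1 h3).1 z hz)
        · intro z hz
          rcases List.mem_cons.1 hz with rfl | hz
          · exact hg
          · exact h4 z hz
      · intro q hq hc
        rcases q with _ | ⟨⟨b, g'⟩, q⟩
        · simpa using hc.sum_eq
        have hb := hq (b, g') (by simp)
        simp only at hb
        have hq' : ∀ b ∈ q, 0 < b.1 := fun b hb => hq b (by simp [hb])
        have hg' : g' = g := by
          obtain ⟨r', t', h1, h2, -, h4, -⟩ := cuts_cons.1 hc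
          rcases r' with _ | ⟨x', r'⟩
          · simp at h2
            omega
          simp only [List.cons_append, List.cons.injEq] at h1
          rw [← hg, h1.1]
          exact (h4 x' (by simp)).symm
        subst hg'
        -- A competing composition restricts to the shorter word by losing its first block if that
        -- has size one, and by shrinking it otherwise.
        obtain rfl | hb1 : b = 1 ∨ 1 < b := by omega
        · rw [← hg] at hc
          obtain ⟨r', q', h1, h2, h3, h4⟩ := refines_cons.1 (hp2 q hq' (hsingle q hq' hc))
          refine refines_cons.2 ⟨(1, g') :: r', q', by simp [h1], ?_, ?_, h4⟩
          · simp only [List.map_cons, List.sum_cons]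
            omega
          · simpa using h3
        · have hc' : Cuts (y :: (r ++ t)) ((b - 1, g') :: q) := by
            obtain ⟨r', t', h1, h2, h3, h4, h5⟩ := cuts_cons.1 hc
            rcases r' with _ | ⟨x', r'⟩
            · simp at h2
              omega
            simp only [List.cons_append, List.cons.injEq] at h1
            refine cuts_cons.2 ⟨r', t', h1.2, ?_, (List.pairwise_cons.1 h3).2, ?_, h5⟩
            · simp at h2 ⊢
              omega
            · exact fun z hz => h4 z (by simp [hz])
          have hpos : ∀ c ∈ (b - 1, g') :: q, 0 < c.1 := by
            simp only [List.mem_cons, forall_eq_or_imp]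
            exact ⟨by omega, hq'⟩
          obtain ⟨r', q', h1, h2, h3, h4⟩ := refines_cons.1 (hp2 _ hpos hc')
          rcases r' with _ | ⟨c, r'⟩
          · simp at h2
            omega
          simp only [List.cons_append, List.cons.injEq] at h1
          obtain ⟨rfl, rfl⟩ := h1
          refine refines_cons.2 ⟨(b, g') :: r', q', rfl, ?_, ?_, h4⟩
          · simp only [List.map_cons, List.sum_cons] at h2 ⊢
            omega
          · simpa using h3
    · refine ⟨(1, x.2) :: p, ?_, ?_, ?_⟩
      · simp only [List.mem_cons, forall_eq_or_imp]
        exact ⟨Nat.one_pos, hp0⟩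
      · exact cuts_cons.2 ⟨[x], l, rfl, rfl, by simp, by simp, hp1⟩
      · intro q hq hc
        rcases q with _ | ⟨⟨b, g'⟩, q⟩
        · simpa using hc.sum_eq
        have hb := hq (b, g') (by simp)
        simp only at hb
        have hq' : ∀ b ∈ q, 0 < b.1 := fun b hb => hq b (by simp [hb])
        obtain ⟨r', t', h1, h2, h3, h4, h5⟩ := cuts_cons.1 hc
        rcases r' with _ | ⟨x', r'⟩
        · simp at h2
          omega
        simp only [List.cons_append, List.cons.injEq] at h1
        obtain ⟨rfl, rfl⟩ := h1
        have hr' : r' = [] := by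
          rcases r' with _ | ⟨y, r'⟩
          · rfl
          · exfalso
            refine hx ⟨y, r' ++ t', rfl, (List.pairwise_cons.1 h3).1 y (by simp), ?_⟩
            rw [h4 x (by simp), h4 y (by simp)]
        subst hr'
        have hg : x.2 = g' := h4 x (by simp)
        have hb1 : b = 1 := by simpa using h2.symm
        subst hb1 hg
        refine refines_cons.2 ⟨[(1, x.2)], q, rfl, by simp, by simp, hp2 q hq' h5⟩

theorem cuts_map_iff {A B : Type*} [LinearOrder A] [Preorder B] {f : A → B} (hf : StrictMono f)
    {l : List (A × G)} {p : List (ℕ × G)} :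
    Cuts (l.map fun x => (f x.1, x.2)) p ↔ Cuts l p := by
  have hpw : ∀ r : List (A × G), ((r.map fun x => (f x.1, x.2)).Pairwise fun x y => x.1 < y.1) ↔
      r.Pairwise fun x y => x.1 < y.1 := by
    intro r
    rw [List.pairwise_map]
    simp only [hf.lt_iff_lt]
  induction p generalizing l with
  | nil => simp [cuts_nil_right]
  | cons b p ih =>
    rw [cuts_cons, cuts_cons]
    constructor
    · rintro ⟨r, l', h1, h2, h3, h4, h5⟩
      obtain ⟨r, l', rfl, rfl, rfl⟩ := List.map_eq_append_iff.1 h1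
      exact ⟨r, l', rfl, by simpa using h2, (hpw r).1 h3,
        fun x hx => h4 _ (List.mem_map_of_mem hx), ih.1 h5⟩
    · rintro ⟨r, l', rfl, h2, h3, h4, h5⟩
      refine ⟨_, _, List.map_append, by simpa using h2, (hpw r).2 h3, ?_, ih.2 h5⟩
      intro x hx
      obtain ⟨y, hy, rfl⟩ := List.mem_map.1 hx
      exact h4 y hy

end cuts

/-! ### The elements `X_p` and their products under `⋆` -/

section MR

variable {n m : ℕ} {G : Type*}

theorem Wreath.compatible_iff {a : Wreath n G} {p : IntComp n G} :
    a.Compatible p ↔ Cuts a.word p.blocks := Iff.rfl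

theorem Wreath.exists_isCo (a : Wreath n G) : ∃ p : IntComp n G, a.IsCo p := by
  obtain ⟨p, hp0, hp1, hp2⟩ := exists_coarsest a.word
  exact ⟨⟨p, hp0, by rw [hp1.sum_eq, Wreath.word, List.length_ofFn]⟩, hp1,
    fun q hq => hp2 q.blocks q.pos hq⟩

/-- The compositions compatible with `a` are exactly the refinements of the unique `co(a)`, so each
compatible `a` occurs in exactly one `Y_q` with `q ≤ p`. -/
theorem X_eq_sum [Finite G] (p : IntComp n G) :
    X p = ∑ a : Wreath n G with a.Compatible p, MonoidAlgebra.single a 1 := by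
  simp only [X, Y, Finset.sum_filter (p := fun a => Wreath.IsCo a _)]
  rw [Finset.sum_comm, Finset.sum_filter (p := fun a => Wreath.Compatible a p)]
  refine Finset.sum_congr rfl fun a _ => ?_
  obtain ⟨c, hc⟩ := a.exists_isCo
  have huniq : ∀ q, a.IsCo q → q = c := fun q hq => IntComp.ext
    ((IntComp.le_iff.1 (hq.2 c hc.1)).antisymm q.pos c.pos (hc.2 q hq.1))
  have hiff : a.Compatible p ↔ c ≤ p := ⟨fun h => hc.2 p h, fun h => Cuts.of_refines hc.1 h⟩
  rw [hiff]
  split_ifs with h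
  · rw [Finset.sum_eq_single_of_mem c (by simpa using h), if_pos hc]
    exact fun q _ hq => if_neg fun h' => hq (huniq q h')
  · refine Finset.sum_eq_zero fun q hq => if_neg fun h' => h ?_
    rw [← huniq q h']
    exact (Finset.mem_filter.1 hq).2

variable [Group G]

theorem X_mem_MR [Finite G] (p : IntComp n G) : X p ∈ MR n G :=
  Submodule.sum_mem _ fun q _ => Submodule.subset_span ⟨q, rfl⟩

/-- The concatenation of compositions. -/
def IntComp.append (p : IntComp n G) (q : IntComp m G) : IntComp (n + m) G where
  blocks := p.blocks ++ q.blocks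
  pos b hb := (List.mem_append.1 hb).elim (p.pos b) (q.pos b)
  sum_eq := by rw [List.map_append, List.sum_append, p.sum_eq, q.sum_eq]

theorem starHom_eq_sum [Finite G] (a : WAlg G n) (b : WAlg G m) :
    starHom a b = ∑ u : Wreath n G, ∑ v : Wreath m G, (a.coeff u * b.coeff v) • starElt u v := by
  rw [starHom, Finsupp.sum_fintype _ _ (by simp)]
  refine Finset.sum_congr rfl fun u _ => ?_
  rw [Finsupp.sum_fintype _ _ (by simp)]

/-- The product `⋆` on homogeneous elements as a bilinear map. -/
def starBilin (G : Type*) [Group G] [Finite G] (n m : ℕ) :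
    WAlg G n →ₗ[ℂ] WAlg G m →ₗ[ℂ] WAlg G (n + m) :=
  LinearMap.mk₂ ℂ starHom
    (fun a b c => by
      simp only [starHom_eq_sum, ← Finset.sum_add_distrib, ← add_smul, ← add_mul]
      rfl)
    (fun r a c => by
      simp only [starHom_eq_sum, Finset.smul_sum, smul_smul, ← mul_assoc]
      rfl)
    (fun a b c => by
      simp only [starHom_eq_sum, ← Finset.sum_add_distrib, ← add_smul, ← mul_add]
      rfl)
    (fun r a c => by
      simp only [starHom_eq_sum, Finset.smul_sum, smul_smul, mul_left_comm r]
      rfl)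

@[simp] theorem starBilin_apply [Finite G] (a : WAlg G n) (b : WAlg G m) :
    starBilin G n m a b = starHom a b := rfl

theorem starHom_single [Finite G] (u : Wreath n G) (v : Wreath m G) :
    starHom (MonoidAlgebra.single u 1) (MonoidAlgebra.single v 1) = starElt u v := by
  simp [starHom, MonoidAlgebra.coeff_single]

theorem mul_prod_perm_castAdd (w : Equiv.Perm (Fin (n + m))) (u : Wreath n G) (v : Wreath m G)
    (i : Fin n) : ((⟨w, fun _ => 1⟩ : Wreath (n + m) G) * u.prod v).perm (Fin.castAdd m i) =
      w (Fin.castAdd m (u.perm i)) := by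
  change w (finSumFinEquiv.permCongr (Equiv.Perm.sumCongr u.perm v.perm) (Fin.castAdd m i)) = _
  simp [Equiv.permCongr_apply]

theorem mul_prod_perm_natAdd (w : Equiv.Perm (Fin (n + m))) (u : Wreath n G) (v : Wreath m G)
    (j : Fin m) : ((⟨w, fun _ => 1⟩ : Wreath (n + m) G) * u.prod v).perm (Fin.natAdd n j) =
      w (Fin.natAdd n (v.perm j)) := by
  change w (finSumFinEquiv.permCongr (Equiv.Perm.sumCongr u.perm v.perm) (Fin.natAdd n j)) = _
  simp [Equiv.permCongr_apply]

theorem mul_prod_col (w : Equiv.Perm (Fin (n + m))) (u : Wreath n G) (v : Wreath m G) :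
    ((⟨w, fun _ => 1⟩ : Wreath (n + m) G) * u.prod v).col = Fin.append u.col v.col := by
  change (fun i => 1 * Fin.append u.col v.col i) = _
  simp

theorem word_mul_prod (w : Equiv.Perm (Fin (n + m))) (u : Wreath n G) (v : Wreath m G) :
    ((⟨w, fun _ => 1⟩ : Wreath (n + m) G) * u.prod v).word =
      (u.word.map fun x => (w (Fin.castAdd m x.1), x.2)) ++
        (v.word.map fun x => (w (Fin.natAdd n x.1), x.2)) := by
  rw [Wreath.word, List.ofFn_add, Wreath.word, Wreath.word, List.map_ofFn, List.map_ofFn]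
  congr 1
  · congr 1
    funext i
    refine Prod.ext (mul_prod_perm_castAdd w u v i) ?_
    rw [mul_prod_col]
    exact Fin.append_left _ _ _
  · congr 1
    funext i
    refine Prod.ext (mul_prod_perm_natAdd w u v i) ?_
    rw [mul_prod_col]
    exact Fin.append_right _ _ _

/-- The composition has a cut at position `n`, so nothing is required across the two halves, and a
shuffle preserves all comparisons within each half. -/
theorem compatible_mul_prod {w : Equiv.Perm (Fin (n + m))} (hw : w ∈ shuffles n m)
    (u : Wreath n G) (v : Wreath m G) (p : IntComp n G) (q : IntComp m G) :
    ((⟨w, fun _ => 1⟩ : Wreath (n + m) G) * u.prod v).Compatible (p.append q) ↔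
      u.Compatible p ∧ v.Compatible q := by
  have hw' := (Finset.mem_filter.1 hw).2
  rw [Wreath.compatible_iff, Wreath.compatible_iff, Wreath.compatible_iff, word_mul_prod,
    IntComp.append, cuts_append, cuts_map_iff (f := fun i => w (Fin.castAdd m i)) hw'.1,
    cuts_map_iff (f := fun i => w (Fin.natAdd n i)) hw'.2]
  rw [List.length_map, p.sum_eq, Wreath.word, List.length_ofFn]

/-- A strictly increasing map on `Fin k` is determined by its range. This gives uniqueness in the
shuffle factorisation. -/
theorem perm_eq_of_strictMono {k : ℕ} {B : Type*} [PartialOrder B] {f g : Fin k → B}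
    (hf : StrictMono f) (hg : StrictMono g) {u v : Equiv.Perm (Fin k)}
    (h : ∀ i, f (u i) = g (v i)) : f = g ∧ u = v := by
  have hfg : f = g := by
    rw [← hf.range_inj hg, ← u.surjective.range_comp f, ← v.surjective.range_comp g]
    congr 1
    funext i
    exact h i
  refine ⟨hfg, Equiv.ext fun i => hf.injective ?_⟩
  rw [h i, hfg]

theorem exists_strictMono_comp {k : ℕ} {B : Type*} [LinearOrder B] {f : Fin k → B}
    (hf : Function.Injective f) : ∃ σ : Equiv.Perm (Fin k), StrictMono (f ∘ σ) :=
  ⟨Tuple.sort f, (Tuple.monotone_sort f).strictMono_of_injective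
    (hf.comp (Tuple.sort f).injective)⟩

/-- Every coloured permutation is uniquely a shuffle times a pair, and compatibility with `p.append
q` only concerns the pair. -/
theorem starHom_X [Finite G] (p : IntComp n G) (q : IntComp m G) :
    starHom (X p) (X q) = X (p.append q) := by
  rw [← starBilin_apply, X_eq_sum, X_eq_sum, X_eq_sum]
  simp only [map_sum, LinearMap.sum_apply, starBilin_apply, starHom_single, starElt]
  rw [Finset.sum_comm]
  rw [← Finset.sum_product', ← Finset.sum_product']
  refine Finset.sum_bij (fun x _ => (⟨x.2, fun _ => 1⟩ : Wreath (n + m) G) * x.1.1.prod x.1.2)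
    ?_ ?_ ?_ ?_
  · rintro ⟨⟨u, v⟩, w⟩ h
    simp only [Finset.mem_product, Finset.mem_filter, Finset.mem_univ, true_and] at h
    rw [Finset.mem_filter, compatible_mul_prod h.2]
    exact ⟨Finset.mem_univ _, h.1⟩
  · rintro ⟨⟨u, v⟩, w⟩ h ⟨⟨u', v'⟩, w'⟩ h' he
    simp only [Finset.mem_product, shuffles, Finset.mem_filter, Finset.mem_univ, true_and]
      at h h' he
    obtain ⟨h1, h2⟩ := perm_eq_of_strictMono h.2.1 h'.2.1 (u := u.perm) (v := u'.perm) (by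
      intro i
      rw [← mul_prod_perm_castAdd w u v, he, mul_prod_perm_castAdd])
    obtain ⟨h3, h4⟩ := perm_eq_of_strictMono h.2.2 h'.2.2 (u := v.perm) (v := v'.perm) (by
      intro i
      rw [← mul_prod_perm_natAdd w u v, he, mul_prod_perm_natAdd])
    have hcol : Fin.append u.col v.col = Fin.append u'.col v'.col := by
      rw [← mul_prod_col w, he, mul_prod_col]
    have hu : u = u' := Wreath.ext h2 (funext fun i => by
      simpa using congrFun hcol (Fin.castAdd m i))
    have hv : v = v' := Wreath.ext h4 (funext fun i => by
      simpa using congrFun hcol (Fin.natAdd n i))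
    have hw : w = w' := Equiv.ext fun i => by
      refine Fin.addCases (fun i => ?_) (fun i => ?_) i
      · exact congrFun h1 i
      · exact congrFun h3 i
    rw [hu, hv, hw]
  · intro a ha
    replace ha := (Finset.mem_filter.1 ha).2
    obtain ⟨σ, hσ⟩ := exists_strictMono_comp (f := fun i => a.perm (Fin.castAdd m i))
      (a.perm.injective.comp (Fin.castAdd_injective n m))
    obtain ⟨τ, hτ⟩ := exists_strictMono_comp (f := fun i => a.perm (Fin.natAdd n i))
      (a.perm.injective.comp (Fin.natAdd_injective m n))
    -- Sorting the values of `a` in each half yields the shuffle; the inverse sorting permutations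
    -- with the colours of `a` form the pair.
    let w : Equiv.Perm (Fin (n + m)) :=
      a.perm * finSumFinEquiv.permCongr (Equiv.Perm.sumCongr σ τ)
    have hw1 : ∀ i, w (Fin.castAdd m i) = a.perm (Fin.castAdd m (σ i)) := by
      intro i
      simp [w, Equiv.permCongr_apply]
    have hw2 : ∀ i, w (Fin.natAdd n i) = a.perm (Fin.natAdd n (τ i)) := by
      intro i
      simp [w, Equiv.permCongr_apply]
    have hw : w ∈ shuffles n m := by
      rw [shuffles, Finset.mem_filter]
      refine ⟨Finset.mem_univ _, ?_, ?_⟩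
      · simp only [hw1]
        exact hσ
      · simp only [hw2]
        exact hτ
    let u : Wreath n G := ⟨σ⁻¹, fun i => a.col (Fin.castAdd m i)⟩
    let v : Wreath m G := ⟨τ⁻¹, fun i => a.col (Fin.natAdd n i)⟩
    have heq : (⟨w, fun _ => 1⟩ : Wreath (n + m) G) * u.prod v = a := by
      refine Wreath.ext (Equiv.ext fun i => ?_) ?_
      · refine Fin.addCases (fun i => ?_) (fun i => ?_) i
        · rw [mul_prod_perm_castAdd, hw1]
          simp [u]
        · rw [mul_prod_perm_natAdd, hw2]
          simp [v]
      · rw [mul_prod_col]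
        exact Fin.append_castAdd_natAdd
    refine ⟨⟨⟨u, v⟩, w⟩, ?_, heq⟩
    rw [← heq, compatible_mul_prod hw] at ha
    simpa using ⟨ha, hw⟩
  · intros
    rfl

theorem starHom_zero_left [Finite G] (b : WAlg G m) : starHom (0 : WAlg G n) b = 0 :=
  LinearMap.map_zero₂ (starBilin G n m) b

theorem starHom_zero_right [Finite G] (a : WAlg G n) : starHom a (0 : WAlg G m) = 0 :=
  map_zero (starBilin G n m a)

/-- Zero components contribute nothing, so the index sets may be enlarged. Bilinearity needs this,
since summands and their sum have different supports. -/
theorem extStar_eq_sum [Finite G] {a b : WTot G} {s t : Finset ℕ}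
    (ha : DFinsupp.support a ⊆ s) (hb : DFinsupp.support b ⊆ t) :
    extStar a b = ∑ n ∈ s, ∑ m ∈ t, DirectSum.of (WAlg G) (n + m) (starHom (a n) (b m)) := by
  rw [extStar, Finset.sum_subset ha]
  · refine Finset.sum_congr rfl fun n _ => Finset.sum_subset hb fun m _ hm => ?_
    have hm : b m = 0 := DFinsupp.notMem_support_iff.1 hm
    rw [hm, starHom_zero_right, map_zero]
  · intro n _ hn
    have hn : a n = 0 := DFinsupp.notMem_support_iff.1 hn
    refine Finset.sum_eq_zero fun m _ => ?_
    rw [hn, starHom_zero_left, map_zero]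

/-- The product `⋆` as a bilinear map. -/
def extStarBilin (G : Type*) [Group G] [Finite G] : WTot G →ₗ[ℂ] WTot G →ₗ[ℂ] WTot G :=
  LinearMap.mk₂ ℂ extStar
    (fun a b c => by
      rw [extStar_eq_sum (a := a + b) (DFinsupp.support_add) subset_rfl,
        extStar_eq_sum (a := a) Finset.subset_union_left subset_rfl,
        extStar_eq_sum (a := b) Finset.subset_union_right subset_rfl, ← Finset.sum_add_distrib]
      refine Finset.sum_congr rfl fun n _ => ?_
      rw [← Finset.sum_add_distrib]
      refine Finset.sum_congr rfl fun m _ => ?_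
      rw [← map_add, DirectSum.add_apply, ← starBilin_apply, LinearMap.map_add₂]
      rfl)
    (fun r a c => by
      rw [extStar_eq_sum (a := r • a) (DFinsupp.support_smul _ _) subset_rfl,
        extStar_eq_sum (a := a) subset_rfl subset_rfl, Finset.smul_sum]
      refine Finset.sum_congr rfl fun n _ => ?_
      rw [Finset.smul_sum]
      refine Finset.sum_congr rfl fun m _ => ?_
      rw [DirectSum.smul_apply, ← starBilin_apply, LinearMap.map_smul₂]
      exact (DirectSum.lof ℂ ℕ (WAlg G) (n + m)).map_smul r _)
    (fun a b c => by
      rw [extStar_eq_sum (b := b + c) subset_rfl (DFinsupp.support_add),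
        extStar_eq_sum (b := b) subset_rfl Finset.subset_union_left,
        extStar_eq_sum (b := c) subset_rfl Finset.subset_union_right, ← Finset.sum_add_distrib]
      refine Finset.sum_congr rfl fun n _ => ?_
      rw [← Finset.sum_add_distrib]
      refine Finset.sum_congr rfl fun m _ => ?_
      rw [← map_add, DirectSum.add_apply, ← starBilin_apply, map_add]
      rfl)
    (fun r a c => by
      rw [extStar_eq_sum (b := r • c) subset_rfl (DFinsupp.support_smul _ _),
        extStar_eq_sum (b := c) subset_rfl subset_rfl, Finset.smul_sum]
      refine Finset.sum_congr rfl fun n _ => ?_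
      rw [Finset.smul_sum]
      refine Finset.sum_congr rfl fun m _ => ?_
      rw [DirectSum.smul_apply, ← starBilin_apply, map_smul]
      exact (DirectSum.lof ℂ ℕ (WAlg G) (n + m)).map_smul r _)

@[simp] theorem extStarBilin_apply [Finite G] (a b : WTot G) :
    extStarBilin G a b = extStar a b := rfl

theorem extStar_of [Finite G] (a : WAlg G n) (b : WAlg G m) :
    extStar (DirectSum.of (WAlg G) n a) (DirectSum.of (WAlg G) m b) =
      DirectSum.of (WAlg G) (n + m) (starHom a b) := by
  rw [extStar_eq_sum (a := DirectSum.of (WAlg G) n a) (b := DirectSum.of (WAlg G) m b)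
    (s := {n}) (t := {m}) DFinsupp.support_single_subset DFinsupp.support_single_subset, Finset.sum_singleton, Finset.sum_singleton,
    DirectSum.of_eq_same, DirectSum.of_eq_same]

/-- `X_p` as an element of the direct sum. -/
def totX [Finite G] (p : IntComp n G) : WTot G := DirectSum.of (WAlg G) n (X p)

theorem extStar_totX [Finite G] (p : IntComp n G) (q : IntComp m G) :
    extStar (totX p) (totX q) = totX (p.append q) := by
  rw [totX, totX, extStar_of, starHom_X, totX]

theorem of_smul (n : ℕ) (c : ℂ) (a : WAlg G n) :
    DirectSum.of (WAlg G) n (c • a) = c • DirectSum.of (WAlg G) n a :=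
  (DirectSum.lof ℂ ℕ (WAlg G) n).map_smul c a

end MR

/-! ### Logarithmic expansion of the products `r_p` -/

section vazirani

variable {n : ℕ} {G : Type*}

theorem relabel_blocks_eq {r r' : IntComp n Unit} {c : G}
    (h : (r.relabel fun _ => c).blocks = (r'.relabel fun _ => c).blocks) : r = r' := by
  refine IntComp.ext ?_
  have := congrArg (List.map fun b : ℕ × G => (b.1, ())) h
  simpa only [IntComp.relabel, List.map_map, Function.comp_def, List.map_id'] using this

/-- Splitting off the first block of a composition that is refined. -/
theorem sum_refinements_cons [Finite G] {V : Type*} [AddCommMonoid V] {m k : ℕ} (hm : 0 < m)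
    (c : G) (l : List (ℕ × G))
    (F : IntComp (m + k) G → List (List (ℕ × G)) → V) :
    ∑ q : IntComp (m + k) G, ∑ S ∈ groupings q.blocks with IsGrp List.sum ((m, c) :: l) S, F q S =
      ∑ r : IntComp m Unit, ∑ q : IntComp k G, ∑ S ∈ groupings q.blocks with IsGrp List.sum l S,
        F ((r.relabel fun _ => c).append q) ((r.relabel fun _ => c).blocks :: S) := by
  simp only [Finset.sum_sigma']
  symm
  refine Finset.sum_bij (fun x _ => ⟨(x.1.relabel fun _ => c).append x.2.1,
    (x.1.relabel fun _ => c).blocks :: x.2.2⟩) ?_ ?_ ?_ ?_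
  · rintro ⟨r, q, S⟩ h
    simp only [Finset.mem_sigma, Finset.mem_univ, true_and, Finset.mem_filter, mem_groupings]
      at h ⊢
    obtain ⟨⟨h1, h2⟩, h3⟩ := h
    refine ⟨⟨by rw [List.flatten_cons, h1]; rfl, ?_⟩, List.Forall₂.cons ⟨?_, ?_⟩ h3⟩
    · simp only [List.mem_cons, not_or]
      refine ⟨fun h0 => ?_, h2⟩
      have := (r.relabel fun _ => c).sum_eq
      rw [← h0] at this
      simp at this
      omega
    · exact (r.relabel fun _ => c).sum_eq
    · intro d hd
      obtain ⟨_, _, rfl⟩ := List.mem_map.1 hd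
      rfl
  · rintro ⟨r, q, S⟩ h ⟨r', q', S'⟩ h' he
    simp only [Finset.mem_sigma, Finset.mem_univ, true_and, Finset.mem_filter, mem_groupings]
      at h h'
    simp only [Sigma.mk.injEq, heq_eq_eq, List.cons.injEq] at he
    have h1 := relabel_blocks_eq he.2.1
    have h2 := he.2.2
    subst h1 h2
    have h3 : q = q' := IntComp.ext (h.1.1.symm.trans h'.1.1)
    subst h3
    rfl
  · rintro ⟨q, S⟩ h
    simp only [Finset.mem_sigma, Finset.mem_univ, true_and, Finset.mem_filter, mem_groupings] at h
    obtain ⟨⟨h1, h2⟩, h3⟩ := h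
    rcases h3 with _ | ⟨⟨h4, h5⟩, h6⟩
    rename_i r S
    simp only [List.flatten_cons] at h1
    simp only [List.mem_cons, not_or] at h2
    have hpos : ∀ b ∈ r ++ S.flatten, 0 < b.1 := h1 ▸ q.pos
    have hsum : (S.flatten.map Prod.fst).sum = k := by
      have := q.sum_eq
      rw [← h1, List.map_append, List.sum_append, h4] at this
      simp only at this
      omega
    have hr : (r.map fun b => (b.1, ())).map (fun b => (b.1, c)) = r := by
      rw [List.map_map]
      conv_rhs => rw [← List.map_id r]
      refine List.map_congr_left fun b hb => ?_
      exact Prod.ext rfl (h5 b hb).symm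
    -- All labels in the first piece equal `c`, so forgetting them loses nothing.
    refine ⟨⟨⟨r.map fun b => (b.1, ()), ?_, ?_⟩, ⟨S.flatten, ?_, hsum⟩, S⟩, ?_, ?_⟩
    · intro b hb
      obtain ⟨d, hd, rfl⟩ := List.mem_map.1 hb
      exact hpos d (List.mem_append_left _ hd)
    · rw [List.map_map]
      exact h4
    · exact fun b hb => hpos b (List.mem_append_right _ hb)
    · simp only [Finset.mem_sigma, Finset.mem_univ, true_and, Finset.mem_filter, mem_groupings]
      exact ⟨h2.2, h6⟩
    · simp only [IntComp.relabel, IntComp.append, hr]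
      congr 1
      exact IntComp.ext h1
  · intros
    rfl

theorem refCoeff_eq_sum_filter (f : ℕ → ℂ) {M L : Type*} (σ : List M → M) (p q : List (M × L)) :
    refCoeff f σ p q = ∑ S ∈ groupings q with IsGrp σ p S, wt f S := by
  rw [refCoeff, Finset.sum_filter]

/-- `r_p` for a list of labelled integers. -/
def rList (l : List (ℕ × ℤˣ)) : WTot ℤˣ :=
  starProd (l.map fun b => DirectSum.of (WAlg ℤˣ) b.1 (reutenauer b.1 b.2))

/-- Each factor is a log-weighted sum over compositions of one block, and `⋆` concatenates them. The
outcome has the coefficients of `symR_eq_sum`. -/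
theorem rList_eq_sum (l : List (ℕ × ℤˣ)) (hl : ∀ b ∈ l, 0 < b.1) {n : ℕ}
    (hn : (l.map Prod.fst).sum = n) :
    rList l = ∑ q : IntComp n ℤˣ, refCoeff logCoeff List.sum l q.blocks • totX q := by
  induction l generalizing n with
  | nil =>
    simp only [List.map_nil, List.sum_nil] at hn
    subst hn
    have hempty : ∀ q : IntComp 0 ℤˣ, q.blocks = [] := fun q => by
      simpa using q.length_le
    let q₀ : IntComp 0 ℤˣ := ⟨[], by simp, rfl⟩
    have huniq : (univ : Finset (IntComp 0 ℤˣ)) = {q₀} := by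
      ext q
      simpa using IntComp.ext (hempty q)
    rw [huniq, Finset.sum_singleton]
    have h1 : refCoeff logCoeff List.sum [] q₀.blocks = 1 := by
      simp [refCoeff, q₀, groupings, IsGrp]
    rw [h1, one_smul, totX, X_eq_sum]
    -- For the empty composition, `X` is the empty word, the unit of `⋆`.
    have h2 : (univ.filter fun a : Wreath 0 ℤˣ => a.Compatible q₀) = {1} := by
      ext a
      have : a = 1 := Wreath.ext (Subsingleton.elim _ _) (Subsingleton.elim _ _)
      simp only [Finset.mem_filter, Finset.mem_univ, true_and, Finset.mem_singleton, this]
      exact iff_true_intro (cuts_nil_right.2 rfl)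
    rw [h2, Finset.sum_singleton]
    rfl
  | cons b l ih =>
    obtain ⟨m, c⟩ := b
    simp only [List.map_cons, List.sum_cons] at hn
    obtain ⟨k, hk⟩ : ∃ k, (l.map Prod.fst).sum = k := ⟨_, rfl⟩
    rw [hk] at hn
    subst hn
    have hm : 0 < m := hl (m, c) (by simp)
    have h1 : rList ((m, c) :: l) =
        extStar (DirectSum.of (WAlg ℤˣ) m (reutenauer m c)) (rList l) := rfl
    have h2 : DirectSum.of (WAlg ℤˣ) m (reutenauer m c) =
        ∑ r : IntComp m Unit, logCoeff r.length • totX (r.relabel fun _ => c) := by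
      rw [reutenauer, map_sum]
      refine Finset.sum_congr rfl fun r _ => ?_
      rw [of_smul]
      rfl
    rw [h1, h2, ih (fun b hb => hl b (by simp [hb])) hk, ← extStarBilin_apply]
    simp only [map_sum, LinearMap.sum_apply, map_smul, LinearMap.smul_apply, extStarBilin_apply,
      extStar_totX, refCoeff_eq_sum_filter, Finset.sum_smul]
    rw [sum_refinements_cons hm c l (F := fun q S => wt logCoeff S • totX q)]
    conv_rhs => rw [Finset.sum_comm]
    refine Finset.sum_congr rfl fun q _ => ?_
    rw [Finset.sum_comm]
    refine Finset.sum_congr rfl fun S _ => ?_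
    rw [Finset.smul_sum]
    refine Finset.sum_congr rfl fun r _ => ?_
    have hr : ((r.relabel fun _ => c : IntComp m ℤˣ).blocks).length = r.length :=
      List.length_map _
    rw [wt_cons, smul_smul, hr, mul_comm]

theorem rProd_eq_sum (p : IntComp n ℤˣ) :
    rProd p = ∑ q : IntComp n ℤˣ, refCoeff logCoeff List.sum p.blocks q.blocks • totX q :=
  rList_eq_sum p.blocks p.pos p.sum_eq

end vazirani

/-! ### Sums over the labellings of a list of sizes -/

section labelings

variable {n : ℕ} {G V : Type*} [Finite G]

/-- The lists of labelled integers with given underlying integers. -/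
def labelings (G : Type*) [Finite G] : List ℕ → Finset (List (ℕ × G))
  | [] => {[]}
  | m :: S => ((Set.finite_univ (α := G)).toFinset ×ˢ labelings G S).image
      fun x => (m, x.1) :: x.2

theorem mem_labelings {S : List ℕ} {l : List (ℕ × G)} :
    l ∈ labelings G S ↔ l.map Prod.fst = S := by
  induction S generalizing l with
  | nil => simp [labelings]
  | cons m S ih =>
    simp only [labelings, Finset.mem_image, Finset.mem_product, Set.Finite.mem_toFinset,
      Set.mem_univ, true_and, ih, Prod.exists]
    constructor
    · rintro ⟨g, l, rfl, rfl⟩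
      rfl
    · intro h
      rcases l with _ | ⟨⟨m', g⟩, l⟩
      · simp at h
      · simp only [List.map_cons, List.cons.injEq] at h
        exact ⟨g, l, h.2, by rw [h.1]⟩

theorem sum_labelings_cons [Fintype G] [AddCommMonoid V] (m : ℕ) (S : List ℕ)
    (F : List (ℕ × G) → V) : ∑ l ∈ labelings G (m :: S), F l =
      ∑ g : G, ∑ l ∈ labelings G S, F ((m, g) :: l) := by
  have : (Set.finite_univ (α := G)).toFinset = univ := by
    ext
    simp
  rw [labelings, Finset.sum_image, Finset.sum_product, this]
  rintro ⟨a, b⟩ _ ⟨c, d⟩ _ h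
  simpa using h

/-- Plain lists carry no fixed total `n`, which makes induction on the blocks possible. -/
theorem sum_labelings_eq [AddCommMonoid V] {M : Type*} (α : IntComp n M)
    (F : List (ℕ × G) → V) :
    ∑ p : IntComp n G with p.blocks.map Prod.fst = α.blocks.map Prod.fst, F p.blocks =
      ∑ l ∈ labelings G (α.blocks.map Prod.fst), F l := by
  refine Finset.sum_bij (fun p _ => p.blocks) ?_ ?_ ?_ ?_
  · intro p hp
    exact mem_labelings.2 (Finset.mem_filter.1 hp).2
  · exact fun _ _ _ _ h => IntComp.ext h
  · intro l hl
    rw [mem_labelings] at hl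
    refine ⟨⟨l, fun b hb => ?_, by rw [hl, α.sum_eq]⟩, ?_, rfl⟩
    · have : b.1 ∈ α.blocks.map Prod.fst := hl ▸ List.mem_map_of_mem hb
      obtain ⟨c, hc, hcb⟩ := List.mem_map.1 this
      exact hcb ▸ α.pos c hc
    · rw [Finset.mem_filter]
      exact ⟨Finset.mem_univ _, hl⟩
  · intros
    rfl

end labelings

/-! ### Character expansion of the products `I_α` -/

section vazirani

variable {n : ℕ}

/-- A character of `ℤˣ` takes a square root of `1` at `-1`, and the value `1` would make it trivial.
The two cases of the definition are thus one character sum. -/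
theorem vazI_eq_sum (m : ℕ) (χ : Dual ℤˣ) :
    vazI m χ = (2 : ℂ)⁻¹ • ∑ g : ℤˣ, (starRingEnd ℂ ((χ g : ℂˣ) : ℂ)) • reutenauer m g := by
  have huniv : (univ : Finset ℤˣ) = {1, -1} := by
    ext g
    simp [Int.units_eq_one_or g]
  have hsq : ((χ (-1) : ℂˣ) : ℂ) * ((χ (-1) : ℂˣ) : ℂ) = 1 := by
    rw [← Units.val_mul, ← map_mul]
    simp
  rw [huniv, Finset.sum_pair (by decide), map_one, vazI]
  split_ifs with h
  · subst h
    simp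
  · have h1 : ((χ (-1) : ℂˣ) : ℂ) = -1 := by
      rcases mul_self_eq_one_iff.1 hsq with h1 | h1
      · refine absurd (MonoidHom.ext fun g => ?_) h
        rcases Int.units_eq_one_or g with rfl | rfl
        · simp
        · exact Units.ext (by simpa using h1)
      · exact h1
    rw [h1]
    simp [sub_eq_add_neg]

/-- Multilinearity of `⋆`: each factor is a sum over one label, and the character values multiply to
`evalInt`. -/
theorem starProd_vazI_eq_sum (α : List (ℕ × Dual ℤˣ)) :
    starProd (α.map fun b => DirectSum.of (WAlg ℤˣ) b.1 (vazI b.1 b.2)) =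
      ((2 : ℂ) ^ α.length)⁻¹ • ∑ l ∈ labelings ℤˣ (α.map Prod.fst),
        (starRingEnd ℂ (evalInt α l)) • rList l := by
  induction α with
  | nil => simp [labelings, evalInt, rList]
  | cons b α ih =>
    have h1 : starProd ((b :: α).map fun b => DirectSum.of (WAlg ℤˣ) b.1 (vazI b.1 b.2)) =
        extStar (DirectSum.of (WAlg ℤˣ) b.1 (vazI b.1 b.2))
          (starProd (α.map fun b => DirectSum.of (WAlg ℤˣ) b.1 (vazI b.1 b.2))) := rfl
    have h2 : DirectSum.of (WAlg ℤˣ) b.1 (vazI b.1 b.2) = (2 : ℂ)⁻¹ • ∑ g : ℤˣ,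
        (starRingEnd ℂ ((b.2 g : ℂˣ) : ℂ)) • DirectSum.of (WAlg ℤˣ) b.1 (reutenauer b.1 g) := by
      rw [vazI_eq_sum, of_smul, map_sum]
      simp only [of_smul]
    have h3 : ∀ (g : ℤˣ) (l : List (ℕ × ℤˣ)), rList ((b.1, g) :: l) =
        extStar (DirectSum.of (WAlg ℤˣ) b.1 (reutenauer b.1 g)) (rList l) := fun _ _ => rfl
    have h4 : ∀ (g : ℤˣ) (l : List (ℕ × ℤˣ)), evalInt (b :: α) ((b.1, g) :: l) =
        ((b.2 g : ℂˣ) : ℂ) * evalInt α l := by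
      intro g l
      simp [evalInt]
    rw [h1, ih, h2, List.map_cons, sum_labelings_cons, ← extStarBilin_apply]
    simp only [h3, h4, map_sum, LinearMap.sum_apply, map_smul, LinearMap.smul_apply,
      extStarBilin_apply, Finset.smul_sum, smul_smul, List.length_cons, pow_succ, mul_inv, map_mul]
    rw [Finset.sum_comm]
    refine Finset.sum_congr rfl fun g _ => Finset.sum_congr rfl fun l _ => ?_
    congr 1
    ring

theorem vazIProd_eq_sum (α : IntComp n (Dual ℤˣ)) :
    vazIProd α = ((2 : ℂ) ^ α.length)⁻¹ •
      ∑ p : IntComp n ℤˣ with p.blocks.map Prod.fst = α.blocks.map Prod.fst,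
        (starRingEnd ℂ (evalInt α.blocks p.blocks)) • rProd p := by
  rw [vazIProd, starProd_vazI_eq_sum, IntComp.length]
  congr 1
  exact (sum_labelings_eq α fun l => (starRingEnd ℂ (evalInt α.blocks l)) • rList l).symm

end vazirani

/-! ### Orbits, invariants and Hsiao's map -/

section HsiaoMap

variable {n : ℕ} {L G : Type*}

theorem exists_blocks_of_card {A : Type*} (p : List (ℕ × L)) (T : Finset A)
    (h : (p.map Prod.fst).sum = #T) : ∃ z : List (Finset A × L),
      (z.map fun b => (b.1.card, b.2)) = p ∧ (z.Pairwise fun a b => Disjoint a.1 b.1) ∧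
      (∀ b ∈ z, b.1 ⊆ T) ∧ ∀ i ∈ T, ∃ b ∈ z, i ∈ b.1 := by
  induction p generalizing T with
  | nil =>
    have : T = ∅ := by simpa using h.symm
    subst this
    exact ⟨[], by simp⟩
  | cons b p ih =>
    simp only [List.map_cons, List.sum_cons] at h
    obtain ⟨S, hS, hSc⟩ := Finset.exists_subset_card_eq (s := T) (n := b.1) (by omega)
    obtain ⟨z, rfl, h2, h3, h4⟩ := ih (T \ S) (by rw [Finset.card_sdiff_of_subset hS]; omega)
    refine ⟨(S, b.2) :: z, by simp [hSc], ?_, ?_, ?_⟩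
    · rw [List.pairwise_cons]
      exact ⟨fun c hc => (Finset.disjoint_sdiff).mono_right (h3 c hc), h2⟩
    · simp only [List.mem_cons, forall_eq_or_imp]
      exact ⟨hS, fun c hc => (h3 c hc).trans Finset.sdiff_subset⟩
    · intro i hi
      by_cases hiS : i ∈ S
      · exact ⟨(S, b.2), by simp, hiS⟩
      · obtain ⟨c, hc, hic⟩ := h4 i (by simp [hi, hiS])
        exact ⟨c, by simp [hc], hic⟩

theorem SetComp.type_surjective : Function.Surjective (SetComp.type (n := n) (L := L)) := by
  intro p
  obtain ⟨z, h1, h2, -, h4⟩ := exists_blocks_of_card p.blocks (univ : Finset (Fin n))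
    (by simp [p.sum_eq])
  refine ⟨⟨z, ?_, h2, fun i => h4 i (Finset.mem_univ i)⟩, IntComp.ext h1⟩
  intro b hb
  rw [← Finset.card_pos]
  exact p.pos (b.1.card, b.2) (h1 ▸ List.mem_map.2 ⟨b, hb, rfl⟩)

theorem SetComp.exists_index (s : SetComp n L) : ∃ f : Fin n → ℕ,
    (∀ i j (hj : j < s.blocks.length), f i = j ↔ i ∈ (s.blocks[j]).1) ∧
      ∀ i, f i < s.blocks.length := by
  have : ∀ i, ∃ j, ∃ hj : j < s.blocks.length, i ∈ (s.blocks[j]).1 := by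
    intro i
    obtain ⟨b, hb, hi⟩ := s.cover i
    obtain ⟨j, hj, rfl⟩ := List.getElem_of_mem hb
    exact ⟨j, hj, hi⟩
  choose f hf hf' using this
  refine ⟨f, fun i j hj => ⟨?_, fun hi => ?_⟩, hf⟩
  · rintro rfl
    exact hf' i
  · have := s.eq_of_subset (List.getElem_mem (hf i)) (List.getElem_mem hj) (S := {i})
      (by simp) (by simpa using hf' i) (by simpa using hi)
    exact (s.nodup_blocks.getElem_inj_iff).1 this

/-- Blocks in equal positions have equal sizes; bijections between them glue to a permutation of
`[n]`. The index functions present the blocks as fibres, those beyond the last block being empty. -/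
theorem SetComp.exists_permute_eq {s t : SetComp n L} (h : s.type = t.type) :
    ∃ w : Equiv.Perm (Fin n), s.permute w = t := by
  obtain ⟨f, hf, hf'⟩ := s.exists_index
  obtain ⟨g, hg, hg'⟩ := t.exists_index
  have hb : s.blocks.map (fun b => (b.1.card, b.2)) = t.blocks.map (fun b => (b.1.card, b.2)) :=
    congrArg IntComp.blocks h
  have hlen : s.blocks.length = t.blocks.length := by simpa using congrArg List.length hb
  have hget : ∀ j (hj : j < s.blocks.length), ((s.blocks[j]).1.card, (s.blocks[j]).2) =
      ((t.blocks[j]'(hlen ▸ hj)).1.card, (t.blocks[j]'(hlen ▸ hj)).2) := by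
    intro j hj
    have h3 : (s.blocks.map fun b => (b.1.card, b.2))[j]'(by simpa using hj) =
      (t.blocks.map fun b => (b.1.card, b.2))[j]'(by simpa using hlen ▸ hj) := by simp only [hb]
    simpa using h3
  have hcard : ∀ j, Nonempty ({i // f i = j} ≃ {i // g i = j}) := by
    intro j
    by_cases hj : j < s.blocks.length
    · have e1 : {i // f i = j} ≃ (s.blocks[j]).1 := Equiv.subtypeEquivRight fun i => hf i j hj
      have e2 : {i // g i = j} ≃ (t.blocks[j]'(hlen ▸ hj)).1 :=
        Equiv.subtypeEquivRight fun i => hg i j (hlen ▸ hj)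
      exact ⟨(e1.trans (Finset.equivOfCardEq (Prod.ext_iff.1 (hget j hj)).1)).trans e2.symm⟩
    · have h1 : IsEmpty {i // f i = j} := ⟨fun i => hj (i.2 ▸ hf' i.1)⟩
      have h2 : IsEmpty {i // g i = j} := ⟨fun i => hj (by rw [hlen, ← i.2]; exact hg' i.1)⟩
      exact ⟨Equiv.equivOfIsEmpty _ _⟩
  let w : Equiv.Perm (Fin n) := Equiv.ofFiberEquiv fun j => (hcard j).some
  have hw : ∀ i, g (w i) = f i := Equiv.ofFiberEquiv_map _
  refine ⟨w, SetComp.ext (List.ext_getElem (by simpa [SetComp.permute] using hlen) ?_)⟩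
  intro j h1 h2
  have hj : j < s.blocks.length := hlen ▸ h2
  simp only [SetComp.permute, List.getElem_map]
  refine Prod.ext ?_ (Prod.ext_iff.1 (hget j hj)).2
  ext i
  rw [← hg i j h2]
  simp only [Finset.mem_map, Equiv.toEmbedding_apply, ← hf _ j hj]
  constructor
  · rintro ⟨i, hi, rfl⟩
    rw [hw, hi]
  · intro hi
    exact ⟨w.symm i, by rw [← hw, Equiv.apply_symm_apply, hi], Equiv.apply_symm_apply _ _⟩

theorem SetComp.permute_injective (w : Equiv.Perm (Fin n)) :
    Function.Injective (SetComp.permute (L := L) w) := by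
  intro s t h
  refine SetComp.ext ?_
  have hinj : Function.Injective fun b : Finset (Fin n) × L => (b.1.map w.toEmbedding, b.2) := by
    rintro ⟨S, a⟩ ⟨T, b⟩ h
    simpa using h
  exact hinj.list_map (congrArg SetComp.blocks h)

theorem coeff_eq_of_mem_invariants {a : HAlg n G} (ha : a ∈ invariants n G) {s t : SetComp n G}
    (h : s.type = t.type) : a.coeff s = a.coeff t := by
  obtain ⟨w, rfl⟩ := SetComp.exists_permute_eq h
  rw [invariants, Submodule.mem_iInf] at ha
  have h1 : MonoidAlgebra.mapDomainLinearMap ℂ ℂ (SetComp.permute w) a = a := ha w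
  conv_rhs => rw [← h1]
  exact (Finsupp.mapDomain_apply (SetComp.permute_injective w) a.coeff s).symm

theorem coeff_symH [Finite G] (p : IntComp n G) (s : SetComp n G) :
    (symH p).coeff s = if s.type = p then 1 else 0 := by
  rw [symH, MonoidAlgebra.coeff_sum, Finsupp.finsetSum_apply]
  simp only [H, MonoidAlgebra.coeff_single, Finsupp.single_apply]
  rw [Finset.sum_ite_eq']
  simp

/-- Coefficients of an invariant are constant on types, so each can be read at one chosen
composition of that type. -/
theorem eq_sum_of_mem_invariants [Finite G] {a : HAlg n G} (ha : a ∈ invariants n G) :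
    a = ∑ p : IntComp n G,
      a.coeff (Function.surjInv SetComp.type_surjective p) • symH p := by
  apply MonoidAlgebra.coeff_injective
  ext s
  rw [MonoidAlgebra.coeff_sum, Finsupp.finsetSum_apply]
  simp only [MonoidAlgebra.coeff_smul, Finsupp.smul_apply, coeff_symH, smul_eq_mul, mul_ite,
    mul_one, mul_zero]
  rw [Finset.sum_ite_eq, if_pos (Finset.mem_univ _)]
  exact coeff_eq_of_mem_invariants ha (Function.surjInv_eq SetComp.type_surjective _).symm

variable [Group G] [Finite G]

/-- Hsiao's map. -/
def hsiaoMap (n : ℕ) (G : Type*) [Group G] [Finite G] : invariants n G →ₗ[ℂ] MR n G where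
  toFun a := ∑ p : IntComp n G,
    (a : HAlg n G).coeff (Function.surjInv SetComp.type_surjective p) • ⟨X p, X_mem_MR p⟩
  map_add' a b := by
    simp only [Submodule.coe_add, MonoidAlgebra.coeff_add, Finsupp.add_apply, add_smul,
      Finset.sum_add_distrib]
  map_smul' c a := by
    simp only [Submodule.coe_smul, MonoidAlgebra.coeff_smul, Finsupp.smul_apply, smul_eq_mul,
      mul_smul, Finset.smul_sum, RingHom.id_apply]

theorem isHsiaoMap_hsiaoMap : IsHsiaoMap (hsiaoMap n G) := by
  intro p
  simp only [hsiaoMap, LinearMap.coe_mk, AddHom.coe_mk, coeff_symH,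
    Function.surjInv_eq SetComp.type_surjective]
  simp

/-- An expansion in the `symH p` yields invariance and the image together; uniqueness of the map
also comes from it. -/
theorem IsHsiaoMap.apply_eq {f : invariants n G →ₗ[ℂ] MR n G} (hf : IsHsiaoMap f)
    (c : IntComp n G → ℂ) {a : HAlg n G} (ha : a = ∑ p : IntComp n G, c p • symH p) :
    ∃ h : a ∈ invariants n G, (f ⟨a, h⟩ : WAlg G n) = ∑ p : IntComp n G, c p • X p := by
  subst ha
  refine ⟨Submodule.sum_mem _ fun p _ => Submodule.smul_mem _ _ (symH_mem p), ?_⟩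
  have : (⟨∑ p : IntComp n G, c p • symH p,
      Submodule.sum_mem _ fun p _ => Submodule.smul_mem _ _ (symH_mem p)⟩ : invariants n G) =
      ∑ p : IntComp n G, c p • ⟨symH p, symH_mem p⟩ := by
    apply Subtype.ext
    simp
  rw [this, map_sum, Submodule.coe_sum]
  refine Finset.sum_congr rfl fun p _ => ?_
  rw [map_smul, Submodule.coe_smul, hf]

theorem existsUnique_isHsiaoMap (n : ℕ) (G : Type*) [Group G] [Finite G] :
    ∃! f : invariants n G →ₗ[ℂ] MR n G, IsHsiaoMap f := by
  refine ⟨hsiaoMap n G, isHsiaoMap_hsiaoMap, fun f hf => LinearMap.ext fun a => Subtype.ext ?_⟩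
  obtain ⟨_, h1⟩ := hf.apply_eq _ (eq_sum_of_mem_invariants a.2)
  obtain ⟨_, h2⟩ := isHsiaoMap_hsiaoMap.apply_eq _ (eq_sum_of_mem_invariants a.2)
  exact h1.trans h2.symm

/-- Linear combinations of elements of known image. -/
theorem exists_apply_sum_eq {f : invariants n G →ₗ[ℂ] MR n G} {ι : Type*} (S : Finset ι)
    (k : ℂ) (c : ι → ℂ) (a : ι → HAlg n G) (b : ι → WTot G)
    (h : ∀ i ∈ S, ∃ h : a i ∈ invariants n G, DirectSum.of (WAlg G) n (f ⟨a i, h⟩) = b i) :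
    ∃ h : k • ∑ i ∈ S, c i • a i ∈ invariants n G,
      DirectSum.of (WAlg G) n (f ⟨k • ∑ i ∈ S, c i • a i, h⟩) = k • ∑ i ∈ S, c i • b i := by
  have hmem : ∀ i ∈ S, a i ∈ invariants n G := fun i hi => (h i hi).1
  refine ⟨Submodule.smul_mem _ _ (Submodule.sum_mem _ fun i hi =>
    Submodule.smul_mem _ _ (hmem i hi)), ?_⟩
  have : (⟨k • ∑ i ∈ S, c i • a i, Submodule.smul_mem _ _ (Submodule.sum_mem _ fun i hi =>
      Submodule.smul_mem _ _ (hmem i hi))⟩ : invariants n G) =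
      k • ∑ i ∈ S.attach, c i • ⟨a i, hmem i i.2⟩ := by
    apply Subtype.ext
    simp [Finset.sum_attach S fun i => c i • a i]
  rw [this, map_smul, map_sum, Submodule.coe_smul, of_smul, Submodule.coe_sum, map_sum,
    ← Finset.sum_attach S fun i => c i • b i]
  congr 1
  refine Finset.sum_congr rfl fun i _ => ?_
  obtain ⟨_, h2⟩ := h i i.2
  rw [map_smul, Submodule.coe_smul, of_smul, h2]

end HsiaoMap

/-! ### Images of the three families -/

section main

variable {n : ℕ} {f : invariants n ℤˣ →ₗ[ℂ] MR n ℤˣ}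

/-- `symR_eq_sum` and `rProd_eq_sum` have identical coefficients, in `symH q` and in `X q`
respectively. -/
theorem IsHsiaoMap.apply_symR (hf : IsHsiaoMap f) (p : IntComp n ℤˣ) :
    ∃ h : symR p ∈ invariants n ℤˣ,
      DirectSum.of (WAlg ℤˣ) n (f ⟨symR p, h⟩) = rProd p := by
  obtain ⟨h, h'⟩ := hf.apply_eq _ (symR_eq_sum p)
  refine ⟨h, ?_⟩
  rw [h', map_sum, rProd_eq_sum]
  exact Finset.sum_congr rfl fun q _ => of_smul _ _ _

theorem IsHsiaoMap.apply_symQ (hf : IsHsiaoMap f) (α : IntComp n (Dual ℤˣ)) :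
    ∃ h : symQ α ∈ invariants n ℤˣ,
      DirectSum.of (WAlg ℤˣ) n (f ⟨symQ α, h⟩) = vazIProd α := by
  have hcard : (Nat.card ℤˣ : ℂ) = 2 := by
    rw [Nat.card_eq_fintype_card, Fintype.card_units_int]
    norm_num
  rw [vazIProd_eq_sum, symQ_eq_sum, hcard]
  exact exists_apply_sum_eq _ _ _ _ _ fun p _ => hf.apply_symR p

theorem IsHsiaoMap.apply_eType (hf : IsHsiaoMap f) (l : IntPart n (Dual ℤˣ)) :
    ∃ h : eType l ∈ invariants n ℤˣ,
      DirectSum.of (WAlg ℤˣ) n (f ⟨eType l, h⟩) = vazirani l := by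
  rw [eType_eq_sum, vazirani]
  have := exists_apply_sum_eq (f := f)
    (univ.filter fun α : IntComp n (Dual ℤˣ) => (⟦α⟧ : IntPart n (Dual ℤˣ)) = l)
    ((l.length.factorial : ℂ))⁻¹ (fun _ => 1) _ _ fun α _ => hf.apply_symQ α
  simpa only [one_smul] using this

end main

end HsiaoMR

end

theorem mainTheorem6 (n : ℕ) :
    (∃! f : HsiaoMR.invariants n ℤˣ →ₗ[ℂ] HsiaoMR.MR n ℤˣ, HsiaoMR.IsHsiaoMap f) ∧
    ∀ f : HsiaoMR.invariants n ℤˣ →ₗ[ℂ] HsiaoMR.MR n ℤˣ, HsiaoMR.IsHsiaoMap f →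
      (∀ p : HsiaoMR.IntComp n ℤˣ,
        ∃ h : HsiaoMR.symR p ∈ HsiaoMR.invariants n ℤˣ,
          DirectSum.of (HsiaoMR.WAlg ℤˣ) n (f ⟨HsiaoMR.symR p, h⟩) = HsiaoMR.rProd p) ∧
      (∀ α : HsiaoMR.IntComp n (HsiaoMR.Dual ℤˣ),
        ∃ h : HsiaoMR.symQ α ∈ HsiaoMR.invariants n ℤˣ,
          DirectSum.of (HsiaoMR.WAlg ℤˣ) n (f ⟨HsiaoMR.symQ α, h⟩) = HsiaoMR.vazIProd α) ∧
      (∀ l : HsiaoMR.IntPart n (HsiaoMR.Dual ℤˣ),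
        ∃ h : HsiaoMR.eType l ∈ HsiaoMR.invariants n ℤˣ,
          DirectSum.of (HsiaoMR.WAlg ℤˣ) n (f ⟨HsiaoMR.eType l, h⟩) = HsiaoMR.vazirani l) := by
  exact ⟨HsiaoMR.existsUnique_isHsiaoMap n ℤˣ,
    fun f hf => ⟨hf.apply_symR, hf.apply_symQ, hf.apply_eType⟩⟩
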